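/- Let $Q(z)=\sum_{j=1}^N p_j z^j$ with $p_j\ge 0$ and $\sum_{j=1}^N p_j=1$, and put $q=Q'(1)$. Let $\psi$ be the analytic solution of $\psi'(w)=1-Q(\psi(w))$, $\psi(0)=0$, continued analytically to connected open neighbourhoods of $[0,\infty)$ in $\mathbb C$. For a real function $f$ on $[1,\infty)$ such that $e^{-by}f$ is integrable for every $b>0$, write $\widehat f(\xi)=\int_1^\infty e^{-i\xi y}f(y)\,dy$ for $\operatorname{Im}\xi\le 0$, $\xi\ne 0$ (the integral being $\lim_{T\to\infty}\int_1^T$, whenever the limit exists). For real functions $w,\eta$ of this kind write $\eta=\mathcal N^{-1}(w)$ if there are a connected open neighbourhood $U$ of $[0,\infty)$ in $\mathbb C$ and an analytic function $\psi$ as above on $U$ such that, for all $\xi\neq0$ with $\operatorname{Im}\xi\le0$, $\widehat w(\xi)$ and $\widehat\eta(\xi)$ exist, $\widehat w(\xi)\in U$ and $\widehat\eta(\xi)=\psi(\widehat w(\xi))$; that is, $\mathcal N^{-1}=\mathcal F^{-1}\circ\psi\circ\mathcal F$. We say that $\mathcal N^{-1}(w)$ is well defined if there is such an $\eta$ and it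 is unique up to equality almost everywhere. Let $w^*(y)=1/y$ for $y\ge1$. For $\gamma\ge0$ let $L^2_\gamma$ be the space of measurable real functions $f$ on $[1,\infty)$ with $\|f\|_{2,\gamma}=\bigl(\int_1^\infty (y^\gamma|f(y)|)^2\,dy\bigr)^{1/2}<\infty$. Proposition. Let $\gamma>1/2$. Then $\eta^*_1=\mathcal N^{-1}(\frac1q w^*)$ is well defined and lies in $L^2_\gamma$, and there exist $\varepsilon>0$ and $C>0$, depending only on $Q$ and $\gamma$, such that for all $d\in L^2_\gamma$ with $\|d\|_{2,\gamma}\le\varepsilon$ the function $\mathcal N^{-1}(\frac1q w^*+d)$ is well defined, lies in $L^2_\gamma$, and satisfies $$\bigl\|\mathcal N^{-1}(\tfrac1q w^*+d)-\eta^*_1\bigr\|_{2,\gamma}\le C\,\|d\|_{2,\gamma}.$$ -/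

import Mathlib

open MeasureTheory Set Filter Topology

noncomputable section

namespace Coarsening

/-- The function `w*`, equal to `1 / y` for `y ≥ 1` and to `0` for `y < 1`. -/
def wStar (y : ℝ) : ℝ := if 1 ≤ y then 1 / y else 0

/-- Membership in the real weighted space `L²_γ` of functions on `[1, ∞)`. Functions are total
functions on `ℝ`, of which only the values on `[1, ∞)` matter. -/
def MemL2 (γ : ℝ) (f : ℝ → ℝ) : Prop :=
  MemLp (fun y : ℝ => y ^ γ * f y) 2 (volume.restrict (Ici 1))

/-- The norm `‖f‖_{2,γ} = (∫_1^∞ (y^γ |f y|)² dy)^{1/2}` of `L²_γ`. -/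
def normL2 (γ : ℝ) (f : ℝ → ℝ) : ℝ :=
  Real.sqrt (∫ y in Ici (1 : ℝ), (y ^ γ * |f y|) ^ 2)

/-- `y ↦ exp (-b y) f y` is integrable on `[1, ∞)` for every `b > 0`, so that the Fourier
transform of `f` is given by an absolutely convergent integral on `Im ξ < 0`. -/
def ExpIntegrable (f : ℝ → ℝ) : Prop :=
  ∀ b : ℝ, 0 < b → IntegrableOn (fun y : ℝ => Real.exp (-b * y) * f y) (Ici 1)

/-- The Fourier transform `∫_1^∞ exp (-i ξ y) f y dy` of `f` at `ξ` converges and equals `z`.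
The integral is the limit of the integrals over `[1, T]`; where `exp (-i ξ y) f y` is integrable
on `[1, ∞)` this is the Lebesgue integral, and the limit also covers `w*` at real `ξ ≠ 0`. -/
def HasFourier (f : ℝ → ℝ) (ξ z : ℂ) : Prop :=
  Tendsto (fun T : ℝ => ∫ y in (1 : ℝ)..T, Complex.exp (-Complex.I * ξ * (y : ℂ)) * (f y : ℂ))
    atTop (𝓝 z)

/-- `ψ` is, on the connected open neighbourhood `U` of the half-line `[0, ∞)`, the analytic solution
of `ψ' = 1 - Q(ψ)`, `ψ 0 = 0`. -/
structure IsPsi (Q : Polynomial ℝ) (U : Set ℂ) (ψ : ℂ → ℂ) : Prop where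
  isOpen : IsOpen U
  isPreconnected : IsPreconnected U
  mem_of_nonneg : ∀ x : ℝ, 0 ≤ x → (x : ℂ) ∈ U
  map_zero : ψ 0 = 0
  hasDerivAt : ∀ z ∈ U, HasDerivAt ψ (1 - Polynomial.aeval (ψ z) Q) z

/-- The relation `η = 𝒩⁻¹ w`, where `𝒩⁻¹ = ℱ⁻¹ ∘ ψ ∘ ℱ`: for all `ξ ≠ 0` in the closed lower
half-plane, the Fourier transform of `w` at `ξ` lies in a domain of `ψ`, and `ψ` maps it to the
Fourier transform of `η` at `ξ`. -/
def IsNInv (Q : Polynomial ℝ) (w η : ℝ → ℝ) : Prop :=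
  ExpIntegrable w ∧ ExpIntegrable η ∧
    ∃ (U : Set ℂ) (ψ : ℂ → ℂ), IsPsi Q U ψ ∧
      ∀ ξ : ℂ, ξ.im ≤ 0 → ξ ≠ 0 → ∃ z ∈ U, HasFourier w ξ z ∧ HasFourier η ξ (ψ z)

end Coarsening

end

/-! With `s = iξ` the relation between `w` and `η` becomes one between Laplace transforms on `Re s ≥
0`, `s ≠ 0`. The transform of `w*` is the exponential integral `E1`, and `ψ` is locally inverse to
the primitive `F` of `1 / (1 - Q)` with `F 0 = 0`. On the unit disc `Re F' ≥ 1/2`, so `F` is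
univalent there (`IsPrim.norm_sub_le`). At `1` it has a logarithmic singularity of strength `1/q`,
and `exp (-q F)` continues to a univalent chart `T` (`IsPGF.exists_logChart`). This matches `E1 s ~
-log s` at `0`.

For `γ > 1/2` the space `L²_γ` is a convolution algebra (`eLpNorm_cv_le`) embedded in `L¹`, and the
Laplace transforms at points of the closed half-plane are characters that separate its elements
(`eq_of_chi_eq`). Since `w*` is not in this algebra, `ψ` is not applied to `w* / q + d` directly.
Instead, once the unperturbed solution `X₀` is known, one solves `X' = d - Q(X) * d`, `X(0) = X₀`,
in the algebra. Under a character, `F(X)` moves with constant velocity, the transform of `d`, so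
`X(1)` has the required transform. Picard–Lindelöf gives the solution together with its Lipschitz
dependence on `d` (`exists_flow`). Near `s = 0` the transform of `X` may leave the unit disc, and
`T` replaces `F` (`IsFlow.chart_eq`).

It remains to find `X₀`. After damping by `e^{-by}` with `b` large, `w* / q` is small in `L²_1`, and
the flow from `0` produces `η` with `F(lap η) = E1 / q` on `Re s ≥ b` (`exists_lap_lift`).
Differentiating this identity gives a delay equation for `η`, and the tail function `g` of `η`
satisfies `y g = g * κ` with a kernel `κ` that is non-negative as long as `η` is a sub-probability
density. Moving to the right by unit steps, `η ≥ 0` and `∫ η ≤ 1` (`IsProfile.step`). Hence `|lap η|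
< 1` off the origin and the identity extends to the punctured closed half-plane. Blow-up of `E1` at
`0` forces mass one; the chart then bounds `(1 - lap η) / s` along the positive axis, so `g` is
integrable, and the two equations raise the order of the moments step by step (`IsProfile.mi_all`).
Thus `η` lies in every `L²_γ`.

Uniqueness needs only `Re s` large: there the transform of `w` is near `0`, where any two solutions
`ψ` agree, and the Laplace transform is injective (`IsNInv.unique`). -/

namespace Coarsening

/-! ### Laplace transforms and convolution on the half-line. -/

/-- `f` vanishes on the negative half-line and `e^{-by} f` is integrable. -/
structure LapInt (b : ℝ) (f : ℝ → ℝ) : Prop where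
  zero : ∀ y < 0, f y = 0
  int : Integrable (fun y : ℝ => Real.exp (-b * y) * f y)

/-- The Laplace transform of a function on `ℝ`. -/
noncomputable def lap (f : ℝ → ℝ) (s : ℂ) : ℂ := ∫ y : ℝ, Complex.exp (-s * (y : ℂ)) * (f y : ℂ)

/-- Convolution of real functions. -/
noncomputable def cv (f g : ℝ → ℝ) (x : ℝ) : ℝ := ∫ t, f t * g (x - t)

theorem LapInt.aesm {b : ℝ} {f : ℝ → ℝ} (h : LapInt b f) : AEStronglyMeasurable f := by
  have h1 : AEStronglyMeasurable (fun y : ℝ => Real.exp (b * y) * (Real.exp (-b * y) * f y)) :=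
    (by fun_prop : Continuous fun y : ℝ => Real.exp (b * y)).aestronglyMeasurable.mul h.int.1
  refine h1.congr (Eventually.of_forall fun y => ?_)
  simp [← mul_assoc, ← Real.exp_add]

theorem norm_cexp_mul (s : ℂ) (y r : ℝ) :
    ‖Complex.exp (-s * (y : ℂ)) * (r : ℂ)‖ = Real.exp (-s.re * y) * |r| := by
  simp [Complex.norm_exp]

theorem aesm_cexp_mul {f : ℝ → ℝ} {μ : Measure ℝ} (h : AEStronglyMeasurable f μ) (s : ℂ) :
    AEStronglyMeasurable (fun y : ℝ => Complex.exp (-s * (y : ℂ)) * (f y : ℂ)) μ :=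
  (by fun_prop : Continuous fun y : ℝ => Complex.exp (-s * (y : ℂ))).aestronglyMeasurable.mul
    (Complex.continuous_ofReal.comp_aestronglyMeasurable h)

theorem LapInt.absInt {b : ℝ} {f : ℝ → ℝ} (h : LapInt b f) :
    Integrable (fun y : ℝ => Real.exp (-b * y) * |f y|) := by
  refine h.int.norm.congr (Eventually.of_forall fun y => ?_)
  simp

theorem LapInt.exp_le {b c : ℝ} {f : ℝ → ℝ} (h : LapInt b f) (hc : b ≤ c) (y : ℝ) :
    Real.exp (-c * y) * |f y| ≤ Real.exp (-b * y) * |f y| := by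
  rcases lt_or_ge y 0 with hy | hy
  · simp [h.zero y hy]
  · have : -c * y ≤ -b * y := by nlinarith
    gcongr

theorem LapInt.cint {b : ℝ} {f : ℝ → ℝ} (h : LapInt b f) {s : ℂ} (hs : b ≤ s.re) :
    Integrable (fun y : ℝ => Complex.exp (-s * (y : ℂ)) * (f y : ℂ)) := by
  refine h.absInt.mono' (aesm_cexp_mul h.aesm s) (Eventually.of_forall fun y => ?_)
  rw [norm_cexp_mul]
  exact h.exp_le hs y

theorem LapInt.mono {b c : ℝ} {f : ℝ → ℝ} (h : LapInt b f) (hc : b ≤ c) : LapInt c f := by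
  refine ⟨h.zero, h.absInt.mono' ?_ (Eventually.of_forall fun y => ?_)⟩
  · exact (by fun_prop : Continuous fun y : ℝ => Real.exp (-c * y)).aestronglyMeasurable.mul h.aesm
  · simpa [abs_mul] using h.exp_le hc y

theorem LapInt.norm_lap_le {b : ℝ} {f : ℝ → ℝ} (h : LapInt b f) {s : ℂ} (hs : b ≤ s.re) :
    ‖lap f s‖ ≤ ∫ y : ℝ, Real.exp (-b * y) * |f y| := by
  refine norm_integral_le_of_norm_le h.absInt (Eventually.of_forall fun y => ?_)
  rw [norm_cexp_mul]
  exact h.exp_le hs y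

theorem lap_congr {f g : ℝ → ℝ} (h : f =ᵐ[volume] g) (s : ℂ) : lap f s = lap g s := by
  refine integral_congr_ae ?_
  filter_upwards [h] with y hy
  rw [hy]

theorem LapInt.add {b : ℝ} {f g : ℝ → ℝ} (hf : LapInt b f) (hg : LapInt b g) :
    LapInt b (fun y => f y + g y) := by
  refine ⟨fun y hy => by simp [hf.zero y hy, hg.zero y hy], ?_⟩
  refine (hf.int.add hg.int).congr (Eventually.of_forall fun y => ?_)
  simp only [Pi.add_apply, mul_add]

theorem LapInt.const_mul {b : ℝ} {f : ℝ → ℝ} (hf : LapInt b f) (c : ℝ) :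
    LapInt b (fun y => c * f y) := by
  refine ⟨fun y hy => by simp [hf.zero y hy], ?_⟩
  refine (hf.int.const_mul c).congr (Eventually.of_forall fun y => ?_)
  simp only; ring

theorem LapInt.sub {b : ℝ} {f g : ℝ → ℝ} (hf : LapInt b f) (hg : LapInt b g) :
    LapInt b (fun y => f y - g y) := by
  have := hf.add (hg.const_mul (-1))
  simpa [sub_eq_add_neg] using this

theorem LapInt.sum {ι : Type*} {b : ℝ} (t : Finset ι) {f : ι → ℝ → ℝ}
    (h : ∀ i ∈ t, LapInt b (f i)) : LapInt b (fun y => ∑ i ∈ t, f i y) := by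
  refine ⟨fun y hy => Finset.sum_eq_zero fun i hi => (h i hi).zero y hy, ?_⟩
  simp only [Finset.mul_sum]
  exact integrable_finsetSum _ fun i hi => (h i hi).int

theorem lap_add {b : ℝ} {f g : ℝ → ℝ} (hf : LapInt b f) (hg : LapInt b g) {s : ℂ}
    (hs : b ≤ s.re) : lap (fun y => f y + g y) s = lap f s + lap g s := by
  simp only [lap, Complex.ofReal_add, mul_add]
  exact integral_add (hf.cint hs) (hg.cint hs)

theorem lap_sub {b : ℝ} {f g : ℝ → ℝ} (hf : LapInt b f) (hg : LapInt b g) {s : ℂ}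
    (hs : b ≤ s.re) : lap (fun y => f y - g y) s = lap f s - lap g s := by
  simp only [lap, Complex.ofReal_sub, mul_sub]
  exact integral_sub (hf.cint hs) (hg.cint hs)

theorem lap_const_mul (f : ℝ → ℝ) (c : ℝ) (s : ℂ) :
    lap (fun y => c * f y) s = c * lap f s := by
  simp only [lap, Complex.ofReal_mul]
  rw [← integral_const_mul]
  congr 1; ext y; ring

theorem lap_sum {ι : Type*} {b : ℝ} (t : Finset ι) {f : ι → ℝ → ℝ}
    (h : ∀ i ∈ t, LapInt b (f i)) {s : ℂ} (hs : b ≤ s.re) :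
    lap (fun y => ∑ i ∈ t, f i y) s = ∑ i ∈ t, lap (f i) s := by
  simp only [lap, Complex.ofReal_sum, Finset.mul_sum]
  exact integral_finsetSum _ fun i hi => (h i hi).cint hs

theorem exp_cv (b : ℝ) (f g : ℝ → ℝ) (x : ℝ) :
    Real.exp (-b * x) * cv f g x =
      cv (fun y => Real.exp (-b * y) * f y) (fun y => Real.exp (-b * y) * g y) x := by
  simp only [cv]
  rw [← integral_const_mul]
  congr 1; ext t
  have : Real.exp (-b * x) = Real.exp (-b * t) * Real.exp (-b * (x - t)) := by
    rw [← Real.exp_add]; ring_nf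
  rw [this]; ring

theorem LapInt.cv {b : ℝ} {f g : ℝ → ℝ} (hf : LapInt b f) (hg : LapInt b g) :
    LapInt b (cv f g) := by
  constructor
  · intro y hy
    refine integral_eq_zero_of_ae (Eventually.of_forall fun t => ?_)
    rcases lt_or_ge t 0 with ht | ht
    · simp [hf.zero t ht]
    · simp [hg.zero (y - t) (by linarith)]
  · have := hf.int.integrable_convolution (ContinuousLinearMap.mul ℝ ℝ) hg.int
    refine this.congr (Eventually.of_forall fun x => ?_)
    simp only [exp_cv]
    rfl

theorem LapInt.cv_integrable_ae {b : ℝ} {f g : ℝ → ℝ} (hf : LapInt b f) (hg : LapInt b g) :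
    ∀ᵐ x, Integrable (fun t => f t * g (x - t)) := by
  have := hf.int.ae_convolution_exists (ContinuousLinearMap.mul ℝ ℝ) hg.int
  filter_upwards [this] with x hx
  have h2 : Integrable (fun t => Real.exp (b * x) *
    ((Real.exp (-b * t) * f t) * (Real.exp (-b * (x - t)) * g (x - t)))) :=
    Integrable.const_mul hx _
  refine h2.congr (Eventually.of_forall fun t => ?_)
  have : Real.exp (b * x) * Real.exp (-b * t) * Real.exp (-b * (x - t)) = 1 := by
    rw [← Real.exp_add, ← Real.exp_add]; ring_nf; simp
  simp only
  linear_combination f t * g (x - t) * this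

theorem lap_cv {b : ℝ} {f g : ℝ → ℝ} (hf : LapInt b f) (hg : LapInt b g) {s : ℂ}
    (hs : b ≤ s.re) : lap (cv f g) s = lap f s * lap g s := by
  have := integral_convolution (μ := volume) (ν := volume) (ContinuousLinearMap.mul ℝ ℂ)
    (hf.cint hs) (hg.cint hs)
  simp only [ContinuousLinearMap.mul_apply'] at this
  rw [lap, lap, lap, ← this]
  congr 1; ext x
  simp only [convolution, ContinuousLinearMap.mul_apply', cv]
  rw [← integral_complex_ofReal, ← integral_const_mul]
  congr 1; ext t
  have : Complex.exp (-s * x) = Complex.exp (-s * t) * Complex.exp (-s * ((x - t : ℝ) : ℂ)) := by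
    rw [← Complex.exp_add]; push_cast; ring_nf
  rw [this]; push_cast; ring

theorem charFun_withDensity_ofReal {D : ℝ → ℝ} (hD : Integrable D) (t : ℝ) :
    charFun (volume.withDensity fun y => ENNReal.ofReal (D y)) t =
      ∫ y : ℝ, Complex.exp (t * y * Complex.I) * ((max (D y) 0 : ℝ) : ℂ) := by
  rw [charFun_apply_real, integral_withDensity_eq_integral_toReal_smul₀]
  · congr 1; ext y
    rw [ENNReal.toReal_ofReal', Complex.real_smul, mul_comm]
  · exact hD.1.aemeasurable.ennreal_ofReal
  · exact Eventually.of_forall fun y => by simp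

/-- The positive and negative parts of `D` are densities of finite measures with the same
characteristic function, so they agree almost everywhere. Two functions with disjoint supports that
agree both vanish. -/
theorem ae_eq_zero_of_fourier {D : ℝ → ℝ} (hD : Integrable D)
    (h : ∀ t : ℝ, ∫ y : ℝ, Complex.exp (t * y * Complex.I) * (D y : ℂ) = 0) : D =ᵐ[volume] 0 := by
  have fin : ∀ G : ℝ → ℝ, Integrable G →
      IsFiniteMeasure (volume.withDensity fun y => ENNReal.ofReal (G y)) := fun G hG =>
    isFiniteMeasure_withDensity_ofReal hG.2
  have hD' : Integrable (fun y => -D y) := hD.neg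
  have i1 := fin D hD
  have i2 := fin (fun y => -D y) hD'
  have key : volume.withDensity (fun y => ENNReal.ofReal (D y)) =
      volume.withDensity fun y => ENNReal.ofReal (-D y) := by
    refine Measure.ext_of_charFun (funext fun t => ?_)
    have intg : ∀ G : ℝ → ℝ, Integrable G → Integrable fun y : ℝ =>
        Complex.exp (t * y * Complex.I) * ((max (G y) 0 : ℝ) : ℂ) := by
      intro G hG
      refine hG.norm.mono' ?_ (Eventually.of_forall fun y => ?_)
      · refine (by fun_prop : Continuous fun y : ℝ =>
          Complex.exp (t * y * Complex.I)).aestronglyMeasurable.mul ?_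
        exact Complex.continuous_ofReal.comp_aestronglyMeasurable
          (hG.1.sup aestronglyMeasurable_const)
      · simp only [norm_mul, Complex.norm_real, Real.norm_eq_abs]
        rw [show (t : ℂ) * y * Complex.I = ((t * y : ℝ) : ℂ) * Complex.I by push_cast; ring,
          Complex.norm_exp_ofReal_mul_I, one_mul]
        rw [abs_of_nonneg (le_max_right _ _)]
        exact max_le (le_abs_self _) (abs_nonneg _)
    rw [charFun_withDensity_ofReal hD, charFun_withDensity_ofReal hD', ← sub_eq_zero,
      ← integral_sub (intg D hD) (intg _ hD'), ← h t]
    congr 1; ext y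
    rw [← mul_sub, ← Complex.ofReal_sub]
    congr 2
    rcases le_total (D y) 0 with h | h
    · simp [h]
    · simp [h]
  rw [withDensity_eq_iff hD.1.aemeasurable.ennreal_ofReal
    hD'.1.aemeasurable.ennreal_ofReal hD.lintegral_lt_top.ne] at key
  filter_upwards [key] with y hy
  have := congrArg ENNReal.toReal hy
  rw [ENNReal.toReal_ofReal', ENNReal.toReal_ofReal'] at this
  rcases le_total (D y) 0 with h | h
  · simp [h] at this; simp [this]
  · simp [h] at this; simp [this]

/-- A single vertical line suffices: on it, the transform of `f - g` is the Fourier transform of the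
integrable function `e^{-by} (f - g)`. -/
theorem lap_inj {b : ℝ} {f g : ℝ → ℝ} (hf : LapInt b f) (hg : LapInt b g)
    (h : ∀ s : ℂ, s.re = b → lap f s = lap g s) : f =ᵐ[volume] g := by
  have hD := (hf.sub hg).int
  have := ae_eq_zero_of_fourier hD (fun t => by
    have h1 := h (b - t * Complex.I) (by simp)
    rw [← sub_eq_zero, ← lap_sub hf hg (by simp)] at h1
    rw [← h1, lap]
    congr 1; ext y
    push_cast
    rw [← mul_assoc, ← Complex.exp_add]
    ring_nf)
  filter_upwards [this] with y hy
  simp only [Pi.zero_apply, mul_eq_zero, Real.exp_ne_zero, false_or] at hy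
  linarith

theorem LapInt.continuousOn_lap {b : ℝ} {f : ℝ → ℝ} (h : LapInt b f) :
    ContinuousOn (lap f) {s | b ≤ s.re} := by
  refine continuousOn_of_dominated (bound := fun y => Real.exp (-b * y) * |f y|)
    (fun s _ => aesm_cexp_mul h.aesm s) (fun s hs => Eventually.of_forall fun y => ?_) h.absInt
    (Eventually.of_forall fun y => by fun_prop)
  rw [norm_cexp_mul]
  exact h.exp_le hs y

theorem mul_exp_le {δ y : ℝ} (hδ : 0 < δ) : y * Real.exp (-δ * y) ≤ 1 / δ := by
  have h1 : δ * y ≤ Real.exp (δ * y) := by linarith [Real.add_one_le_exp (δ * y)]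
  rw [neg_mul, Real.exp_neg, ← div_eq_mul_inv, div_le_div_iff₀ (Real.exp_pos _) hδ]
  linarith

theorem LapInt.id_mul {b c : ℝ} {f : ℝ → ℝ} (h : LapInt b f) (hc : b < c) :
    LapInt c (fun y => y * f y) := by
  refine ⟨fun y hy => by simp [h.zero y hy], (h.absInt.const_mul (1 / (c - b))).mono' ?_
    (Eventually.of_forall fun y => ?_)⟩
  · exact (by fun_prop : Continuous fun y : ℝ => Real.exp (-c * y)).aestronglyMeasurable.mul
      (continuous_id.aestronglyMeasurable.mul h.aesm)
  · rcases lt_or_ge y 0 with hy | hy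
    · simp [h.zero y hy]
    · have e : Real.exp (-c * y) = Real.exp (-(c - b) * y) * Real.exp (-b * y) := by
        rw [← Real.exp_add]; ring_nf
      have := mul_exp_le (y := y) (sub_pos.2 hc)
      rw [Real.norm_eq_abs, abs_mul, abs_mul, abs_of_nonneg hy, Real.abs_exp, e]
      calc _ = (y * Real.exp (-(c - b) * y)) * (Real.exp (-b * y) * |f y|) := by ring
        _ ≤ _ := by gcongr

theorem LapInt.hasDerivAt_lap {b : ℝ} {f : ℝ → ℝ} (h : LapInt b f) {s : ℂ} (hs : b < s.re) :
    HasDerivAt (lap f) (-lap (fun y => y * f y) s) s := by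
  -- The gap between `b` and `c` absorbs the factor `y` produced by differentiation under the
  -- integral.
  obtain ⟨c, hbc, hcs⟩ := exists_between hs
  have h' := h.id_mul hbc
  have hU : {z : ℂ | c < z.re} ∈ 𝓝 s := (isOpen_lt continuous_const Complex.continuous_re).mem_nhds hcs
  have key := hasDerivAt_integral_of_dominated_loc_of_deriv_le
    (F := fun (s : ℂ) (y : ℝ) => Complex.exp (-s * (y : ℂ)) * (f y : ℂ))
    (F' := fun (s : ℂ) (y : ℝ) => -(Complex.exp (-s * (y : ℂ)) * ((y * f y : ℝ) : ℂ)))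
    (bound := fun y => Real.exp (-c * y) * |y * f y|) (μ := volume) hU
    (Eventually.of_forall fun s => aesm_cexp_mul h.aesm s) (h.cint hs.le)
    (aesm_cexp_mul h'.aesm s).neg
    (Eventually.of_forall fun y z hz => ?_) h'.absInt
    (Eventually.of_forall fun y z hz => ?_)
  · have h2 := key.2
    rw [integral_neg] at h2
    exact h2
  · rw [norm_neg, norm_cexp_mul]
    exact h'.exp_le (le_of_lt hz) y
  · have h1 : HasDerivAt (fun s : ℂ => -s * (y : ℂ)) (-(y : ℂ)) z := by
      simpa using (hasDerivAt_id z).neg.mul_const (y : ℂ)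
    refine (h1.cexp.mul_const (f y : ℂ)).congr_deriv ?_
    push_cast
    ring

/-- Dominated convergence as the damping grows; the integrand tends to `0` except possibly at `y =
0`. The bound is uniform in the imaginary part. -/
theorem LapInt.exists_lap_small {b : ℝ} {f : ℝ → ℝ} (h : LapInt b f) {ε : ℝ} (hε : 0 < ε) :
    ∃ c, b ≤ c ∧ ∀ s : ℂ, c ≤ s.re → ‖lap f s‖ ≤ ε := by
  have lim : Tendsto (fun c : ℝ => ∫ y : ℝ, Real.exp (-c * y) * |f y|) atTop
      (𝓝 (∫ y : ℝ, (0 : ℝ))) := by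
    refine tendsto_integral_filter_of_dominated_convergence
      (fun y => Real.exp (-b * y) * |f y|) ?_ ?_ h.absInt ?_
    · exact Eventually.of_forall fun c =>
        (by fun_prop : Continuous fun y : ℝ => Real.exp (-c * y)).aestronglyMeasurable.mul
          h.aesm.norm
    · filter_upwards [eventually_ge_atTop b] with c hc
      refine Eventually.of_forall fun y => ?_
      rw [Real.norm_of_nonneg (by positivity)]
      exact h.exp_le hc y
    · have h0 : ∀ᵐ y : ℝ, y ≠ 0 := by simp [ae_iff]
      filter_upwards [h0] with y hy
      rcases lt_or_gt_of_ne hy with hy | hy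
      · simp [h.zero y hy]
      · have : Tendsto (fun c : ℝ => -c * y) atTop atBot := by
          have := tendsto_id.const_mul_atTop hy
          have := tendsto_neg_atTop_atBot.comp this
          refine this.congr fun c => ?_
          simp; ring
        simpa using (Real.tendsto_exp_atBot.comp this).mul_const |f y|
  rw [integral_zero] at lim
  obtain ⟨c, hc⟩ := ((lim.eventually (ge_mem_nhds hε)).and (eventually_ge_atTop b)).exists
  exact ⟨c, hc.2, fun s hs => ((h.mono hc.2).norm_lap_le hs).trans hc.1⟩

theorem lap_ofReal (f : ℝ → ℝ) (b : ℝ) :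
    lap f b = ((∫ y : ℝ, Real.exp (-b * y) * f y : ℝ) : ℂ) := by
  rw [← integral_complex_ofReal]
  simp [lap]

end Coarsening

/-! ### The convolution algebra `L²_γ` and its characters. -/

namespace Coarsening

/-- The Hilbert space `L²(1, ∞)`, in which `L²_γ` is represented by `f ↦ y^γ f`. -/
abbrev E : Type := Lp ℝ 2 (volume.restrict (Ici (1 : ℝ)))

/-- The element of `L²_γ` represented by `u`, extended by zero. -/
noncomputable def fn (γ : ℝ) (u : ℝ → ℝ) (y : ℝ) : ℝ := if 1 ≤ y then y ^ (-γ) * u y else 0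

/-- The weight `y^{-γ}` on `[1, ∞)`, with values in `ℝ≥0∞`. -/
noncomputable def wt (γ : ℝ) (t : ℝ) : ENNReal := if 1 ≤ t then ENNReal.ofReal (t ^ (-γ)) else 0

/-- The absolute value of `u` on `[1, ∞)`, with values in `ℝ≥0∞`. -/
noncomputable def am (u : ℝ → ℝ) (t : ℝ) : ENNReal := if 1 ≤ t then ‖u t‖ₑ else 0

theorem measurable_wt (γ : ℝ) : Measurable (wt γ) :=
  Measurable.ite measurableSet_Ici (by fun_prop) measurable_const

theorem measurable_am {u : ℝ → ℝ} (hu : Measurable u) : Measurable (am u) :=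
  Measurable.ite measurableSet_Ici (by fun_prop) measurable_const

theorem measurable_fn (γ : ℝ) {u : ℝ → ℝ} (hu : Measurable u) : Measurable (fn γ u) :=
  Measurable.ite measurableSet_Ici (by fun_prop) measurable_const

theorem enorm_fn (γ : ℝ) (u : ℝ → ℝ) (t : ℝ) : ‖fn γ u t‖ₑ = wt γ t * am u t := by
  unfold fn wt am
  split_ifs with h
  · rw [enorm_mul, Real.enorm_of_nonneg (by positivity)]
  · simp

theorem lintegral_mul_sq_le {α : Type*} [MeasurableSpace α] {μ : Measure α} {f g : α → ENNReal}
    (hf : AEMeasurable f μ) (hg : AEMeasurable g μ) :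
    (∫⁻ x, f x * g x ∂μ) ^ 2 ≤ (∫⁻ x, f x ^ 2 ∂μ) * ∫⁻ x, g x ^ 2 ∂μ := by
  have h := ENNReal.lintegral_mul_le_Lp_mul_Lq μ Real.HolderConjugate.two_two hf hg
  simp only [ENNReal.rpow_ofNat, Pi.mul_apply] at h
  calc _ ≤ ((∫⁻ x, f x ^ 2 ∂μ) ^ (1 / (2 : ℝ)) * (∫⁻ x, g x ^ 2 ∂μ) ^ (1 / (2 : ℝ))) ^ 2 := by gcongr
    _ = _ := by
      rw [mul_pow, ← ENNReal.rpow_ofNat, ← ENNReal.rpow_ofNat, ← ENNReal.rpow_mul,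
        ← ENNReal.rpow_mul]
      norm_num

/-- This is where `γ > 1/2` enters: square integrability of the weight yields both the embedding in
`L¹` and the boundedness of convolution. -/
theorem lintegral_wt_sq_lt_top {γ : ℝ} (hγ : 1 / 2 < γ) : ∫⁻ t, wt γ t ^ 2 < ⊤ := by
  have h1 : IntegrableOn (fun t : ℝ => t ^ (-(2 * γ))) (Ici 1) := by
    rw [integrableOn_Ici_iff_integrableOn_Ioi]
    exact integrableOn_Ioi_rpow_of_lt (by linarith) one_pos
  have h2 := h1.lintegral_lt_top
  rw [← lintegral_indicator measurableSet_Ici] at h2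
  refine lt_of_le_of_lt (lintegral_mono fun t => ?_) h2
  simp only [wt, indicator, mem_Ici]
  split_ifs with h
  · rw [← ENNReal.ofReal_pow (by positivity), ← Real.rpow_natCast, ← Real.rpow_mul (by linarith)]
    apply le_of_eq; congr 2; push_cast; ring
  · simp

/-- The larger of `t` and `x - t` is at least `x / 2`, so one of the two weights can be traded for
`2^γ x^{-γ}`. -/
theorem wt_mul_le {γ : ℝ} (hγ : 0 ≤ γ) (x t : ℝ) :
    wt γ t * wt γ (x - t) ≤ ENNReal.ofReal (2 ^ γ * x ^ (-γ)) * (wt γ t + wt γ (x - t)) := by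
  have key : ∀ a b : ℝ, 1 ≤ a → 1 ≤ b → a ≤ b → wt γ a * wt γ b ≤
      ENNReal.ofReal (2 ^ γ * (a + b) ^ (-γ)) * (wt γ a + wt γ b) := by
    intro a b ha hb hab
    calc wt γ a * wt γ b ≤ wt γ a * ENNReal.ofReal (2 ^ γ * (a + b) ^ (-γ)) := by
          gcongr
          rw [wt, if_pos hb]
          apply ENNReal.ofReal_le_ofReal
          have h1 : b ^ (-γ) ≤ ((a + b) / 2) ^ (-γ) :=
            Real.rpow_le_rpow_of_nonpos (by linarith) (by linarith) (by linarith)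
          refine h1.trans (le_of_eq ?_)
          rw [Real.div_rpow (by linarith) (by norm_num), Real.rpow_neg (by norm_num : (0:ℝ) ≤ 2)]
          field_simp
      _ ≤ _ := by
          rw [mul_comm]
          gcongr
          exact le_self_add
  by_cases h1 : 1 ≤ t
  · by_cases h2 : 1 ≤ x - t
    · rcases le_total t (x - t) with h | h
      · simpa using key t (x - t) h1 h2 h
      · have := key (x - t) t h2 h1 h
        rw [sub_add_cancel] at this
        rwa [mul_comm, add_comm]
    · simp [wt, h2]
  · simp [wt, h1]

/-- The square of the constant in the convolution inequality. -/
noncomputable def cvConst (γ : ℝ) : ENNReal :=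
  ENNReal.ofReal (2 ^ γ) ^ 2 * (4 * ∫⁻ t, wt γ t ^ 2)

theorem cvConst_lt_top {γ : ℝ} (hγ : 1 / 2 < γ) : cvConst γ < ⊤ := by
  have := lintegral_wt_sq_lt_top hγ
  unfold cvConst
  finiteness

theorem lintegral_wt_mul_sq_le {γ : ℝ} (hγ : 0 ≤ γ) (x : ℝ) :
    ∫⁻ t, (wt γ t * wt γ (x - t)) ^ 2 ≤ ENNReal.ofReal (x ^ (-γ)) ^ 2 * cvConst γ := by
  have hm := measurable_wt γ
  have hm2 : Measurable fun t => wt γ (x - t) := hm.comp (measurable_const.sub measurable_id)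
  calc ∫⁻ t, (wt γ t * wt γ (x - t)) ^ 2
      ≤ ∫⁻ t, ENNReal.ofReal (2 ^ γ * x ^ (-γ)) ^ 2 * (2 * (wt γ t ^ 2 + wt γ (x - t) ^ 2)) := by
        refine lintegral_mono fun t => ?_
        calc _ ≤ (ENNReal.ofReal (2 ^ γ * x ^ (-γ)) * (wt γ t + wt γ (x - t))) ^ 2 :=
              pow_le_pow_left' (wt_mul_le hγ x t) 2
          _ = ENNReal.ofReal (2 ^ γ * x ^ (-γ)) ^ 2 * (wt γ t + wt γ (x - t)) ^ 2 := mul_pow ..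
          _ ≤ _ := by
              gcongr
              have := ENNReal.rpow_add_le_mul_rpow_add_rpow (wt γ t) (wt γ (x - t))
                (p := 2) (by norm_num)
              simp only [ENNReal.rpow_ofNat] at this
              norm_num at this
              exact this
    _ = ENNReal.ofReal (2 ^ γ * x ^ (-γ)) ^ 2 * (2 * ((∫⁻ t, wt γ t ^ 2) + ∫⁻ t, wt γ t ^ 2)) := by
        rw [lintegral_const_mul _ (by fun_prop), lintegral_const_mul _ (by fun_prop),
          lintegral_add_left (by fun_prop), lintegral_sub_left_eq_self (fun t => wt γ t ^ 2)]
    _ = _ := by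
        rw [ENNReal.ofReal_mul (by positivity), cvConst]
        ring

/-- Cauchy–Schwarz, with the two weights kept together in one factor. By `wt_mul_le` the decay
`x^{-γ}` comes out of that factor and cancels the outer `x^γ`. -/
theorem enorm_cv_sq_le {γ : ℝ} (hγ : 0 ≤ γ) {u v : ℝ → ℝ} (hu : Measurable u) (hv : Measurable v)
    {x : ℝ} (hx : 1 ≤ x) :
    ‖x ^ γ * cv (fn γ u) (fn γ v) x‖ₑ ^ 2 ≤
      cvConst γ * ∫⁻ t, am u t ^ 2 * am v (x - t) ^ 2 := by
  have hs : Measurable fun t : ℝ => x - t := measurable_const.sub measurable_id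
  have m1 := measurable_wt γ
  have m2 := m1.comp hs
  have m3 := measurable_am hu
  have m4 := (measurable_am hv).comp hs
  have h1 : ‖cv (fn γ u) (fn γ v) x‖ₑ ≤
      ∫⁻ t, (wt γ t * wt γ (x - t)) * (am u t * am v (x - t)) := by
    refine (enorm_integral_le_lintegral_enorm _).trans (le_of_eq ?_)
    congr 1; ext t
    rw [enorm_mul, enorm_fn, enorm_fn]; ring
  have e : ∀ t, (am u t * am v (x - t)) ^ 2 = am u t ^ 2 * am v (x - t) ^ 2 := fun t => mul_pow ..
  have h2 : ‖cv (fn γ u) (fn γ v) x‖ₑ ^ 2 ≤ (ENNReal.ofReal (x ^ (-γ)) ^ 2 * cvConst γ) *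
      ∫⁻ t, am u t ^ 2 * am v (x - t) ^ 2 := by
    refine (pow_le_pow_left' h1 2).trans ?_
    refine (lintegral_mul_sq_le (m1.mul m2).aemeasurable (m3.mul m4).aemeasurable).trans ?_
    refine mul_le_mul' (lintegral_wt_mul_sq_le hγ x) (le_of_eq ?_)
    congr 1; ext t
    exact e t
  rw [enorm_mul, mul_pow, Real.enorm_of_nonneg (by positivity)]
  calc _ ≤ ENNReal.ofReal (x ^ γ) ^ 2 * ((ENNReal.ofReal (x ^ (-γ)) ^ 2 * cvConst γ) *
      ∫⁻ t, am u t ^ 2 * am v (x - t) ^ 2) := by gcongr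
    _ = (ENNReal.ofReal (x ^ γ) * ENNReal.ofReal (x ^ (-γ))) ^ 2 * (cvConst γ *
      ∫⁻ t, am u t ^ 2 * am v (x - t) ^ 2) := by ring
    _ = _ := by
      rw [← ENNReal.ofReal_mul (by positivity), ← Real.rpow_add (by linarith)]
      simp

theorem lintegral_cv_sq_le {γ : ℝ} (hγ : 0 ≤ γ) {u v : ℝ → ℝ} (hu : Measurable u)
    (hv : Measurable v) :
    ∫⁻ x in Ici (1 : ℝ), ‖x ^ γ * cv (fn γ u) (fn γ v) x‖ₑ ^ 2 ≤
      cvConst γ * ((∫⁻ t, am u t ^ 2) * ∫⁻ t, am v t ^ 2) := by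
  have m3 := measurable_am hu
  have m4 := measurable_am hv
  have m5 : Measurable fun p : ℝ × ℝ => am u p.2 ^ 2 * am v (p.1 - p.2) ^ 2 := by fun_prop
  calc _ ≤ ∫⁻ x in Ici (1 : ℝ), cvConst γ * ∫⁻ t, am u t ^ 2 * am v (x - t) ^ 2 :=
        setLIntegral_mono' measurableSet_Ici fun x hx => enorm_cv_sq_le hγ hu hv hx
    _ ≤ ∫⁻ x, cvConst γ * ∫⁻ t, am u t ^ 2 * am v (x - t) ^ 2 := setLIntegral_le_lintegral _ _
    _ = cvConst γ * ∫⁻ x, ∫⁻ t, am u t ^ 2 * am v (x - t) ^ 2 :=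
        lintegral_const_mul _ m5.lintegral_prod_right'
    _ = cvConst γ * ∫⁻ t, ∫⁻ x, am u t ^ 2 * am v (x - t) ^ 2 := by
        rw [lintegral_lintegral_swap m5.aemeasurable]
    _ = cvConst γ * ∫⁻ t, am u t ^ 2 * ∫⁻ x, am v x ^ 2 := by
        congr 2; ext t
        rw [lintegral_const_mul _ (by fun_prop),
          lintegral_sub_right_eq_self (fun x => am v x ^ 2)]
    _ = _ := by rw [lintegral_mul_const _ (by fun_prop)]

theorem lintegral_am_sq (u : E) : ∫⁻ t, am u t ^ 2 = ‖u‖ₑ ^ 2 := by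
  have e : (fun t => am u t ^ 2) = (Ici (1 : ℝ)).indicator fun t => ‖u t‖ₑ ^ 2 := by
    ext t
    simp only [am, indicator, mem_Ici]
    split_ifs <;> simp
  rw [Lp.enorm_def, eLpNorm_eq_lintegral_rpow_enorm_toReal (by norm_num) (by norm_num),
    ← ENNReal.rpow_ofNat (_ ^ _), ← ENNReal.rpow_mul, e, lintegral_indicator measurableSet_Ici]
  norm_num

theorem eLpNorm_two_le {f : ℝ → ℝ} {μ : Measure ℝ} {c : ENNReal}
    (h : ∫⁻ x, ‖f x‖ₑ ^ 2 ∂μ ≤ c ^ 2) : eLpNorm f 2 μ ≤ c := by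
  rw [eLpNorm_eq_lintegral_rpow_enorm_toReal (by norm_num) (by norm_num)]
  calc _ = (∫⁻ x, ‖f x‖ₑ ^ 2 ∂μ) ^ (1 / (2 : ℝ)) := by norm_num
    _ ≤ (c ^ 2) ^ (1 / (2 : ℝ)) := by gcongr
    _ = c := by rw [← ENNReal.rpow_ofNat, ← ENNReal.rpow_mul]; norm_num

theorem measurable_E (u : E) : Measurable u := (Lp.stronglyMeasurable u).measurable

theorem aesm_cv {f g : ℝ → ℝ} (hf : Measurable f) (hg : Measurable g) :
    StronglyMeasurable (cv f g) := by
  have : Measurable fun p : ℝ × ℝ => f p.2 * g (p.1 - p.2) := by fun_prop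
  exact this.stronglyMeasurable.integral_prod_right'

theorem eLpNorm_cv_le {γ : ℝ} (hγ : 1 / 2 < γ) (u v : E) :
    eLpNorm (fun x => x ^ γ * cv (fn γ u) (fn γ v) x) 2 (volume.restrict (Ici 1)) ≤
      cvConst γ ^ (1 / 2 : ℝ) * (‖u‖ₑ * ‖v‖ₑ) := by
  refine eLpNorm_two_le ((lintegral_cv_sq_le (by linarith) (measurable_E u)
    (measurable_E v)).trans (le_of_eq ?_))
  rw [lintegral_am_sq, lintegral_am_sq, mul_pow, mul_pow, ← ENNReal.rpow_ofNat (_ ^ _),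
    ← ENNReal.rpow_mul]
  norm_num

theorem memL2_cv {γ : ℝ} (hγ : 1 / 2 < γ) (u v : E) : MemL2 γ (cv (fn γ u) (fn γ v)) := by
  refine ⟨?_, (eLpNorm_cv_le hγ u v).trans_lt ?_⟩
  · have := (aesm_cv (measurable_fn γ (measurable_E u)) (measurable_fn γ (measurable_E v))).measurable
    exact (by fun_prop : Measurable fun x => x ^ γ * cv (fn γ u) (fn γ v) x).aestronglyMeasurable
  · have := cvConst_lt_top hγ
    exact ENNReal.mul_lt_top (by finiteness) (by finiteness)

theorem MemL2.memLp {γ : ℝ} {f : ℝ → ℝ} (hf : MemL2 γ f) :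
    MemLp (fun y : ℝ => y ^ γ * f y) 2 (volume.restrict (Ici 1)) := hf

/-- The element of `E` representing a function in `L²_γ`. -/
noncomputable def toE {γ : ℝ} {f : ℝ → ℝ} (hf : MemL2 γ f) : E := hf.memLp.toLp

/-- Convolution on `L²_γ`. -/
noncomputable def B {γ : ℝ} (hγ : 1 / 2 < γ) (u v : E) : E := toE (memL2_cv hγ u v)

/-- The constant in the convolution inequality. -/
noncomputable def cB (γ : ℝ) : ℝ := (cvConst γ ^ (1 / 2 : ℝ)).toReal

theorem norm_B_le {γ : ℝ} (hγ : 1 / 2 < γ) (u v : E) : ‖B hγ u v‖ ≤ cB γ * ‖u‖ * ‖v‖ := by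
  have h := eLpNorm_cv_le hγ u v
  have hc := cvConst_lt_top hγ
  rw [B, toE, Lp.norm_toLp, cB]
  have := ENNReal.toReal_mono (ENNReal.mul_lt_top (by finiteness) (by finiteness)).ne h
  rw [ENNReal.toReal_mul, ENNReal.toReal_mul, toReal_enorm, toReal_enorm] at this
  linarith

theorem fn_toE {γ : ℝ} {f : ℝ → ℝ} (hf : MemL2 γ f) :
    fn γ (toE hf) =ᵐ[volume] fun y => if 1 ≤ y then f y else 0 := by
  have h : (toE hf : ℝ → ℝ) =ᵐ[volume.restrict (Ici 1)] fun y => y ^ γ * f y := hf.memLp.coeFn_toLp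
  rw [Filter.EventuallyEq, ae_restrict_iff' measurableSet_Ici] at h
  filter_upwards [h] with y hy
  unfold fn
  split_ifs with h1
  · rw [hy h1, ← mul_assoc, ← Real.rpow_add (by linarith)]
    simp
  · rfl

theorem norm_toE {γ : ℝ} {f : ℝ → ℝ} (hf : MemL2 γ f) :
    ‖(toE hf)‖ = normL2 γ f := by
  rw [toE, Lp.norm_toLp, hf.memLp.eLpNorm_eq_integral_rpow_norm (by norm_num) (by norm_num), normL2,
    Real.sqrt_eq_rpow, ENNReal.toReal_ofReal (by positivity)]
  norm_num
  congr 1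
  refine setIntegral_congr_fun measurableSet_Ici fun y hy => ?_
  simp only [mem_Ici] at hy
  simp only [mul_pow, sq_abs]

theorem memL2_fn (γ : ℝ) (u : E) : MemL2 γ (fn γ u) := by
  refine (Lp.memLp u).ae_eq ?_
  refine (ae_restrict_iff' measurableSet_Ici).2 (Eventually.of_forall fun y (hy : 1 ≤ y) => ?_)
  simp [fn, if_pos hy, ← mul_assoc, ← Real.rpow_add (by linarith : 0 < y)]

theorem toE_fn (γ : ℝ) (u : E) : toE (memL2_fn γ u) = u := by
  refine Lp.ext ((memL2_fn γ u).memLp.coeFn_toLp.trans ?_)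
  refine (ae_restrict_iff' measurableSet_Ici).2 (Eventually.of_forall fun y (hy : 1 ≤ y) => ?_)
  simp [fn, if_pos hy, ← mul_assoc, ← Real.rpow_add (by linarith : 0 < y)]

theorem normL2_fn (γ : ℝ) (u : E) : normL2 γ (fn γ u) = ‖u‖ := by
  rw [← norm_toE (memL2_fn γ u), toE_fn]

theorem lintegral_fn_le (γ : ℝ) (u : E) :
    ∫⁻ t, ‖fn γ u t‖ₑ ≤ (∫⁻ t, wt γ t ^ 2) ^ (1 / 2 : ℝ) * ‖u‖ₑ := by
  have h := lintegral_mul_sq_le (μ := volume) (measurable_wt γ).aemeasurable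
    (measurable_am (measurable_E u)).aemeasurable
  simp only [enorm_fn]
  rw [lintegral_am_sq] at h
  calc ∫⁻ t, wt γ t * am u t = ((∫⁻ t, wt γ t * am u t) ^ 2) ^ (1 / 2 : ℝ) := by
        rw [← ENNReal.rpow_ofNat, ← ENNReal.rpow_mul]; norm_num
    _ ≤ ((∫⁻ t, wt γ t ^ 2) * ‖u‖ₑ ^ 2) ^ (1 / 2 : ℝ) := by gcongr
    _ = _ := by
        rw [ENNReal.mul_rpow_of_nonneg _ _ (by norm_num), ← ENNReal.rpow_ofNat (‖u‖ₑ),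
          ← ENNReal.rpow_mul]
        norm_num

theorem integrable_fn {γ : ℝ} (hγ : 1 / 2 < γ) (u : E) : Integrable (fn γ u) := by
  refine ⟨(measurable_fn γ (measurable_E u)).aestronglyMeasurable, ?_⟩
  have := lintegral_wt_sq_lt_top hγ
  exact (lintegral_fn_le γ u).trans_lt (ENNReal.mul_lt_top (by finiteness) (by finiteness))

theorem lapInt_fn {γ : ℝ} (hγ : 1 / 2 < γ) (u : E) : LapInt 0 (fn γ u) := by
  refine ⟨fun y hy => ?_, by simpa using integrable_fn hγ u⟩
  rw [fn, if_neg (by linarith)]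

/-- The norm of the embedding of `L²_γ` in `L¹`. -/
noncomputable def cL (γ : ℝ) : ℝ := ((∫⁻ t, wt γ t ^ 2) ^ (1 / 2 : ℝ)).toReal

theorem cL_nonneg (γ : ℝ) : 0 ≤ cL γ := ENNReal.toReal_nonneg

theorem norm_lap_fn_le {γ : ℝ} (hγ : 1 / 2 < γ) (u : E) {s : ℂ} (hs : 0 ≤ s.re) :
    ‖lap (fn γ u) s‖ ≤ cL γ * ‖u‖ := by
  refine ((lapInt_fn hγ u).norm_lap_le hs).trans ?_
  simp only [neg_zero, zero_mul, Real.exp_zero, one_mul]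
  have h := lintegral_wt_sq_lt_top hγ
  have h2 := ENNReal.toReal_mono (ENNReal.mul_lt_top (by finiteness) (by finiteness)).ne
    (lintegral_fn_le γ u)
  rw [ENNReal.toReal_mul, toReal_enorm] at h2
  refine le_trans (le_of_eq ?_) h2
  rw [integral_eq_lintegral_of_nonneg_ae (Eventually.of_forall fun _ => abs_nonneg _)
    (measurable_fn γ (measurable_E u)).abs.aestronglyMeasurable]
  simp only [← Real.norm_eq_abs, ofReal_norm]

theorem fn_add (γ : ℝ) (u v : E) :
    fn γ (u + v : E) =ᵐ[volume] fun y => fn γ u y + fn γ v y := by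
  have h := Lp.coeFn_add u v
  rw [Filter.EventuallyEq, ae_restrict_iff' measurableSet_Ici] at h
  filter_upwards [h] with y hy
  unfold fn
  split_ifs with h1
  · rw [hy h1, Pi.add_apply]; ring
  · simp

theorem fn_smul (γ : ℝ) (c : ℝ) (u : E) :
    fn γ (c • u : E) =ᵐ[volume] fun y => c * fn γ u y := by
  have h := Lp.coeFn_smul c u
  rw [Filter.EventuallyEq, ae_restrict_iff' measurableSet_Ici] at h
  filter_upwards [h] with y hy
  unfold fn
  split_ifs with h1
  · rw [hy h1, Pi.smul_apply, smul_eq_mul]; ring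
  · simp

/-- The Laplace transform at `s` as a functional on `L²_γ`. -/
noncomputable def chi {γ : ℝ} (hγ : 1 / 2 < γ) {s : ℂ} (hs : 0 ≤ s.re) : E →L[ℝ] ℂ :=
  LinearMap.mkContinuous
    { toFun := fun u => lap (fn γ u) s
      map_add' := fun u v => by
        rw [lap_congr (fn_add γ u v), lap_add (lapInt_fn hγ u) (lapInt_fn hγ v) hs]
      map_smul' := fun c u => by
        rw [lap_congr (fn_smul γ c u), lap_const_mul]; simp } (cL γ)
    fun u => norm_lap_fn_le hγ u hs

theorem chi_apply {γ : ℝ} (hγ : 1 / 2 < γ) {s : ℂ} (hs : 0 ≤ s.re) (u : E) :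
    chi hγ hs u = lap (fn γ u) s := rfl

theorem norm_chi_le {γ : ℝ} (hγ : 1 / 2 < γ) {s : ℂ} (hs : 0 ≤ s.re) (u : E) :
    ‖chi hγ hs u‖ ≤ cL γ * ‖u‖ := norm_lap_fn_le hγ u hs

/-- The weight is positive on `[1, ∞)` and can be cancelled. -/
theorem eq_of_fn_ae_eq {γ : ℝ} {u v : E} (h : fn γ u =ᵐ[volume] fn γ v) : u = v := by
  refine Lp.ext ((ae_restrict_iff' measurableSet_Ici).2 ?_)
  filter_upwards [h] with y hy h1
  simp only [mem_Ici] at h1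
  rw [fn, fn, if_pos h1, if_pos h1] at hy
  exact mul_left_cancel₀ (Real.rpow_pos_of_pos (by linarith) _).ne' hy

/-- The characters separate points, so identities in the algebra may be checked after transforming,
where convolution is multiplication. The bilinearity of `B` is obtained in this way. -/
theorem eq_of_chi_eq {γ : ℝ} (hγ : 1 / 2 < γ) {u v : E}
    (h : ∀ (s : ℂ) (hs : 0 ≤ s.re), chi hγ hs u = chi hγ hs v) : u = v :=
  eq_of_fn_ae_eq (lap_inj (lapInt_fn hγ u) (lapInt_fn hγ v) fun s hs => h s hs.ge)

theorem chi_toE {γ : ℝ} (hγ : 1 / 2 < γ) {s : ℂ} (hs : 0 ≤ s.re) {f : ℝ → ℝ} (hf : MemL2 γ f) :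
    chi hγ hs (toE hf) = lap (fun y => if 1 ≤ y then f y else 0) s :=
  lap_congr (fn_toE hf) s

theorem chi_B {γ : ℝ} (hγ : 1 / 2 < γ) {s : ℂ} (hs : 0 ≤ s.re) (u v : E) :
    chi hγ hs (B hγ u v) = chi hγ hs u * chi hγ hs v := by
  rw [chi_apply, chi_apply, chi_apply, ← lap_cv (lapInt_fn hγ u) (lapInt_fn hγ v) hs, B]
  refine lap_congr ((fn_toE _).trans (Eventually.of_forall fun y => ?_)) s
  dsimp only
  split_ifs with h
  · rfl
  -- Both factors live on `[1, ∞)`, so the convolution vanishes to the left of `1` and restricting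
  -- it to `[1, ∞)` loses nothing.
  · refine (integral_eq_zero_of_ae (Eventually.of_forall fun t => ?_)).symm
    by_cases h1 : 1 ≤ t
    · simp [fn, show ¬ 1 ≤ y - t by linarith]
    · simp [fn, h1]

/-- Convolution on `L²_γ` as a continuous bilinear map. -/
noncomputable def BL {γ : ℝ} (hγ : 1 / 2 < γ) : E →L[ℝ] E →L[ℝ] E :=
  LinearMap.mkContinuous₂ (LinearMap.mk₂ ℝ (B hγ)
    (fun u v w => eq_of_chi_eq hγ fun s hs => by simp only [chi_B, map_add, add_mul])
    (fun c u v => eq_of_chi_eq hγ fun s hs => by simp only [chi_B, map_smul, smul_mul_assoc])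
    (fun u v w => eq_of_chi_eq hγ fun s hs => by simp only [chi_B, map_add, mul_add])
    (fun c u v => eq_of_chi_eq hγ fun s hs => by simp only [chi_B, map_smul, mul_smul_comm]))
    (cB γ) (norm_B_le hγ)

theorem chi_BL {γ : ℝ} (hγ : 1 / 2 < γ) {s : ℂ} (hs : 0 ≤ s.re) (u v : E) :
    chi hγ hs (BL hγ u v) = chi hγ hs u * chi hγ hs v := chi_B hγ hs u v

end Coarsening

/-! ### Polynomials in the convolution algebra and the flow `X' = d - Q(X) * d`. -/

namespace Coarsening

/-- `pw hγ j X` is the convolution power of `X` of order `j + 1`. -/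
noncomputable def pw {γ : ℝ} (hγ : 1 / 2 < γ) : ℕ → E → E
  | 0, X => X
  | j + 1, X => BL hγ X (pw hγ j X)

/-- The value at `X` of a polynomial without constant term, in the convolution algebra `L²_γ`. -/
noncomputable def QE {γ : ℝ} (hγ : 1 / 2 < γ) (Q : Polynomial ℝ) (X : E) : E :=
  ∑ j ∈ Finset.range Q.natDegree, Q.coeff (j + 1) • pw hγ j X

theorem chi_pw {γ : ℝ} (hγ : 1 / 2 < γ) {s : ℂ} (hs : 0 ≤ s.re) (j : ℕ) (X : E) :
    chi hγ hs (pw hγ j X) = chi hγ hs X ^ (j + 1) := by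
  induction j with
  | zero => simp [pw]
  | succ j ih => rw [pw, chi_BL, ih, pow_succ' _ (j + 1)]

theorem chi_QE {γ : ℝ} (hγ : 1 / 2 < γ) {s : ℂ} (hs : 0 ≤ s.re) {Q : Polynomial ℝ}
    (hQ : Q.coeff 0 = 0) (X : E) : chi hγ hs (QE hγ Q X) = Polynomial.aeval (chi hγ hs X) Q := by
  rw [QE, map_sum, Polynomial.aeval_eq_sum_range, Finset.sum_range_succ', hQ]
  simp [chi_pw]

theorem contDiff_pw {γ : ℝ} (hγ : 1 / 2 < γ) (j : ℕ) : ContDiff ℝ 1 (pw hγ j) := by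
  induction j with
  | zero => exact contDiff_id
  | succ j ih => exact ((BL hγ).contDiff.comp contDiff_id).clm_apply ih

theorem contDiff_QE {γ : ℝ} (hγ : 1 / 2 < γ) (Q : Polynomial ℝ) : ContDiff ℝ 1 (QE hγ Q) :=
  ContDiff.sum fun j _ => (contDiff_pw hγ j).const_smul _

/-- The algebra has no unit here, so `(1 - Q(X)) * d` is written `d - Q(X) * d`. The parameter `d`
is made a second, constant coordinate of the state, which turns Lipschitz dependence on initial data
into the estimate in `d`. Picard–Lindelöf gives only a short time `τ`; since the field is linear in
`d`, running it with `τ⁻¹ d` for time `τ` amounts to running it with `d` for time one. -/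
theorem exists_flow {γ : ℝ} (hγ : 1 / 2 < γ) (Q : Polynomial ℝ) (X₀ : E) :
    ∃ ε : ℝ, 0 < ε ∧ ∃ C : ℝ, 0 < C ∧ ∀ d : E, ‖d‖ ≤ ε → ∃ X : ℝ → E, X 0 = X₀ ∧
      (∀ t ∈ Icc (0 : ℝ) 1,
        HasDerivWithinAt X (d - BL hγ (QE hγ Q (X t)) d) (Icc 0 1) t) ∧
      ∀ t ∈ Icc (0 : ℝ) 1, ‖X t - X₀‖ ≤ C * ‖d‖ := by
  let V : E × E → E × E := fun p => (p.2 - BL hγ (QE hγ Q p.1) p.2, 0)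
  have hV : ContDiff ℝ 1 V := by
    refine ContDiff.prodMk (contDiff_snd.sub ?_) contDiff_const
    exact ((BL hγ).contDiff.comp ((contDiff_QE hγ Q).comp contDiff_fst)).clm_apply contDiff_snd
  obtain ⟨τ, hτ, a, r, L, K, hr, hPL⟩ :=
    IsPicardLindelof.of_contDiffAt_one (hV.contDiffAt (x := (X₀, (0 : E))))
  obtain ⟨α, hα, L', hL'⟩ :=
    (hPL 0).exists_forall_mem_closedBall_eq_hasDerivWithinAt_lipschitzOnWith
  have hIcc : ∀ t ∈ Icc (0 : ℝ) 1, τ * t ∈ Icc (0 - τ) (0 + τ) := fun t ht =>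
    ⟨by nlinarith [ht.1], by nlinarith [ht.2]⟩
  -- the second component is constant along the flow
  have hsnd : ∀ x ∈ Metric.closedBall (X₀, (0 : E)) r, ∀ t ∈ Icc (0 : ℝ) 1,
      (α x (τ * t)).2 = x.2 := by
    intro x hx t ht
    have hd : ∀ u ∈ Icc (0 - τ) (0 + τ),
        HasDerivWithinAt (fun u => (α x u).2) 0 (Icc (0 - τ) (0 + τ)) u := fun u hu =>
      ((hα x hx).2 u hu).snd
    have := (convex_Icc (0 - τ) (0 + τ)).norm_image_sub_le_of_norm_hasDerivWithin_le (C := 0) hd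
      (fun u _ => by simp) (x := 0) (y := τ * t) ⟨by linarith, by linarith⟩ (hIcc t ht)
    rw [zero_mul, norm_le_zero_iff, sub_eq_zero] at this
    rw [this]
    exact congrArg Prod.snd (hα x hx).1
  have hderiv : ∀ x ∈ Metric.closedBall (X₀, (0 : E)) r, ∀ t ∈ Icc (0 : ℝ) 1,
      HasDerivWithinAt (fun t => (α x (τ * t)).1)
        (τ • (x.2 - BL hγ (QE hγ Q (α x (τ * t)).1) x.2)) (Icc 0 1) t := by
    intro x hx t ht
    have h1 : HasDerivWithinAt (fun u => (α x u).1) (V (α x (τ * t))).1 (Icc (0 - τ) (0 + τ))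
        (τ * t) := by
      have h := (hα x hx).2 (τ * t) (hIcc t ht)
      have h' := (hasFDerivWithinAt_iff_hasDerivWithinAt (f := fun u => (α x u).1)).1
        (HasFDerivWithinAt.fst h)
      simpa using h'
    have h2 : HasDerivWithinAt (fun t : ℝ => τ * t) τ (Icc 0 1) t := by
      simpa using ((hasDerivAt_id t).const_mul τ).hasDerivWithinAt
    have h3 := HasDerivWithinAt.scomp t h1 h2 (fun u hu => hIcc u hu)
    simp only [V, hsnd x hx t ht] at h3
    exact h3
  have hmem0 : (X₀, (0 : E)) ∈ Metric.closedBall (X₀, (0 : E)) (r : ℝ) :=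
    Metric.mem_closedBall_self r.2
  -- For `d = 0` the field vanishes, so the reference trajectory stays at `X₀`.
  have hconst : ∀ t ∈ Icc (0 : ℝ) 1, (α (X₀, 0) (τ * t)).1 = X₀ := by
    intro t ht
    have := (convex_Icc (0 : ℝ) 1).norm_image_sub_le_of_norm_hasDerivWithin_le (C := 0)
      (hderiv _ hmem0) (fun u _ => by simp) (x := 0) (y := t) ⟨by linarith, by linarith⟩ ht
    rw [zero_mul, norm_le_zero_iff, sub_eq_zero] at this
    rw [this, mul_zero]
    exact congrArg Prod.fst (hα _ hmem0).1
  have hr' : (0 : ℝ) < r := hr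
  -- `‖d‖ ≤ τ r` puts `τ⁻¹ d` in the ball of admissible initial data; the `+ 1` makes the constant
  -- positive when `L'` is zero.
  refine ⟨τ * r, by positivity, (L' + 1) / τ, by positivity, fun d hd => ?_⟩
  have hmem : (X₀, τ⁻¹ • d) ∈ Metric.closedBall (X₀, (0 : E)) (r : ℝ) := by
    rw [mem_closedBall_iff_norm, Prod.norm_def]
    simp only [Prod.fst_sub, sub_self, norm_zero, Prod.snd_sub, sub_zero, norm_smul, norm_inv,
      Real.norm_of_nonneg hτ.le]
    refine max_le r.2 ?_
    rw [inv_mul_le_iff₀ hτ]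
    exact hd
  refine ⟨fun t => (α (X₀, τ⁻¹ • d) (τ * t)).1, ?_, fun t ht => ?_, fun t ht => ?_⟩
  · simp only [mul_zero]
    exact congrArg Prod.fst (hα _ hmem).1
  · have := hderiv _ hmem t ht
    simpa [smul_sub, smul_smul, hτ.ne'] using this
  · have h1 := (hL' (τ * t) (hIcc t ht)).norm_sub_le hmem hmem0
    have h2 := (norm_fst_le _).trans h1
    rw [Prod.fst_sub, hconst t ht] at h2
    refine h2.trans ?_
    have h3 : ‖((X₀, τ⁻¹ • d) : E × E) - (X₀, 0)‖ = τ⁻¹ * ‖d‖ := by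
      rw [Prod.norm_def]
      simp only [Prod.mk_sub_mk, sub_self, sub_zero, norm_zero, norm_smul, norm_inv,
        Real.norm_of_nonneg hτ.le]
      exact max_eq_right (by positivity)
    rw [h3, div_eq_mul_inv, mul_assoc]
    gcongr
    linarith

end Coarsening

/-! ### The primitive `F` of `1 / (1 - Q)` and its logarithmic chart at `1`. -/

namespace Coarsening

/-- `Q` is the generating function of a probability distribution on the positive integers, with
mean `q`. -/
structure IsPGF (Q : Polynomial ℝ) (q : ℝ) : Prop where
  coeff_zero : Q.coeff 0 = 0
  nonneg : ∀ j : ℕ, 0 ≤ Q.coeff j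
  eval_one : Q.eval 1 = 1
  mean : q = Q.derivative.eval 1

/-- The function `(1 - Q) / (1 - s)`. -/
noncomputable def Rc (Q : Polynomial ℝ) (s : ℂ) : ℂ :=
  ∑ j ∈ Finset.range (Q.natDegree + 1), (Q.coeff j : ℂ) * ∑ i ∈ Finset.range j, s ^ i

theorem aeval_eq_sum (Q : Polynomial ℝ) (s : ℂ) :
    Polynomial.aeval s Q = ∑ j ∈ Finset.range (Q.natDegree + 1), (Q.coeff j : ℂ) * s ^ j := by
  rw [Polynomial.aeval_eq_sum_range]
  simp

namespace IsPGF

variable {Q : Polynomial ℝ} {q : ℝ}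

theorem sum_coeff (h : IsPGF Q q) : ∑ j ∈ Finset.range (Q.natDegree + 1), Q.coeff j = 1 := by
  have := h.eval_one
  rw [Polynomial.eval_eq_sum_range] at this
  simpa using this

theorem sum_mul_coeff (h : IsPGF Q q) :
    ∑ j ∈ Finset.range (Q.natDegree + 1), Q.coeff j * j = q := by
  rw [h.mean, Polynomial.derivative_eval, Polynomial.sum_over_range _ (by simp)]
  simp

theorem one_le_mean (h : IsPGF Q q) : 1 ≤ q := by
  rw [← h.sum_mul_coeff, ← h.sum_coeff]
  refine Finset.sum_le_sum fun j _ => ?_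
  rcases Nat.eq_zero_or_pos j with rfl | hj
  · simp [h.coeff_zero]
  · have : (1 : ℝ) ≤ j := by exact_mod_cast hj
    nlinarith [h.nonneg j]

theorem one_sub_aeval (h : IsPGF Q q) (s : ℂ) :
    1 - Polynomial.aeval s Q = (1 - s) * Rc Q s := by
  have h1 : (1 : ℂ) = ∑ j ∈ Finset.range (Q.natDegree + 1), (Q.coeff j : ℂ) := by
    rw [← Complex.ofReal_sum, h.sum_coeff]; simp
  rw [aeval_eq_sum, h1, Rc, ← Finset.sum_sub_distrib, ← h1, Finset.mul_sum]
  refine Finset.sum_congr rfl fun j _ => ?_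
  linear_combination -(Q.coeff j : ℂ) * mul_neg_geom_sum s j

theorem Rc_one (h : IsPGF Q q) : Rc Q 1 = q := by
  rw [← h.sum_mul_coeff, Rc]
  simp

theorem norm_aeval_le (h : IsPGF Q q) {s : ℂ} (hs : ‖s‖ ≤ 1) :
    ‖Polynomial.aeval s Q‖ ≤ ‖s‖ := by
  rw [aeval_eq_sum]
  calc _ ≤ ∑ j ∈ Finset.range (Q.natDegree + 1), Q.coeff j * ‖s‖ := by
        refine norm_sum_le_of_le _ fun j _ => ?_
        rcases Nat.eq_zero_or_pos j with rfl | hj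
        · simp [h.coeff_zero]
        · rw [norm_mul, norm_pow, Complex.norm_real, Real.norm_of_nonneg (h.nonneg j)]
          have := h.nonneg j
          gcongr
          exact pow_le_of_le_one (norm_nonneg _) hs hj.ne'
    _ = ‖s‖ := by rw [← Finset.sum_mul, h.sum_coeff, one_mul]

theorem one_sub_ne_zero (h : IsPGF Q q) {s : ℂ} (hs : ‖s‖ < 1) :
    1 - Polynomial.aeval s Q ≠ 0 := by
  intro h0
  have := h.norm_aeval_le hs.le
  rw [← sub_eq_zero.1 h0, norm_one] at this
  linarith

end IsPGF

theorem continuous_Rc (Q : Polynomial ℝ) : Continuous (Rc Q) := by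
  unfold Rc; fun_prop

theorem differentiable_Rc (Q : Polynomial ℝ) : Differentiable ℂ (Rc Q) := by
  unfold Rc; fun_prop

theorem differentiable_aeval (Q : Polynomial ℝ) :
    Differentiable ℂ fun s : ℂ => Polynomial.aeval s Q := by
  simp only [aeval_eq_sum]; fun_prop

/-- The map `w ↦ 1 / (1 - w)` carries the unit disc to the half-plane `Re > 1/2`. It is applied with
`w = Q(s)`. -/
theorem re_inv_one_sub {w : ℂ} (hw : ‖w‖ < 1) : 1 / 2 ≤ ((1 : ℂ) / (1 - w)).re := by
  have h1 : Complex.normSq w < 1 := by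
    rw [Complex.normSq_eq_norm_sq]
    have := norm_nonneg w
    nlinarith
  have h2 : 0 < Complex.normSq (1 - w) := by
    rw [Complex.normSq_pos, sub_ne_zero]
    rintro rfl
    simp at hw
  rw [one_div (1 - w), Complex.inv_re, le_div_iff₀ h2]
  simp only [Complex.normSq_apply, Complex.sub_re, Complex.one_re, Complex.sub_im,
    Complex.one_im] at *
  nlinarith

/-- `F` is the primitive of `1 / (1 - Q)` on the unit disc with `F 0 = 0`. -/
structure IsPrim (Q : Polynomial ℝ) (F : ℂ → ℂ) : Prop where
  zero : F 0 = 0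
  hasDerivAt : ∀ s : ℂ, ‖s‖ < 1 → HasDerivAt F (1 / (1 - Polynomial.aeval s Q)) s

theorem IsPGF.exists_prim {Q : Polynomial ℝ} {q : ℝ} (h : IsPGF Q q) : ∃ F, IsPrim Q F := by
  have hd : DifferentiableOn ℂ (fun s : ℂ => 1 / (1 - Polynomial.aeval s Q))
      (Metric.ball 0 1) := by
    refine DifferentiableOn.div (by fun_prop) ?_ fun s hs => h.one_sub_ne_zero (by simpa using hs)
    exact ((differentiable_const _).sub (differentiable_aeval Q)).differentiableOn
  obtain ⟨G, hG⟩ := hd.isExactOn_ball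
  refine ⟨fun s => G s - G 0, by simp, fun s hs => ?_⟩
  exact (hG s (by simpa using hs)).sub_const _

namespace IsPrim

variable {Q : Polynomial ℝ} {q : ℝ} {F : ℂ → ℂ}

/-- The Noshiro–Warschawski argument: on a convex set, a derivative with real part at least `1/2`
makes `F` injective with a 2-Lipschitz inverse. The mean value theorem is applied to `Re (conj (a -
b) F)` along the segment from `b` to `a`. -/
theorem norm_sub_le (hF : IsPrim Q F) (h : IsPGF Q q) {a b : ℂ} (ha : ‖a‖ < 1) (hb : ‖b‖ < 1) :
    ‖a - b‖ ≤ 2 * ‖F a - F b‖ := by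
  rcases eq_or_ne a b with rfl | hab
  · simp
  have hn : 0 < ‖a - b‖ := norm_pos_iff.2 (sub_ne_zero.2 hab)
  let c : ℂ := (starRingEnd ℂ) (a - b)
  have hseg : ∀ t ∈ Icc (0 : ℝ) 1, ‖b + t * (a - b)‖ < 1 := by
    intro t ht
    have : b + t * (a - b) ∈ Metric.ball (0 : ℂ) 1 := by
      have := (convex_ball (0 : ℂ) 1).add_smul_sub_mem (x := b) (y := a) (by simpa using hb)
        (by simpa using ha) ht
      simpa using this
    simpa using this
  have hder : ∀ t ∈ Icc (0 : ℝ) 1, HasDerivAt (fun t : ℝ => (c * F (b + t * (a - b))).re)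
      (‖a - b‖ ^ 2 * (1 / (1 - Polynomial.aeval (b + t * (a - b)) Q)).re) t := by
    intro t ht
    have h1 : HasDerivAt (fun t : ℝ => b + t * (a - b)) (a - b) t := by
      simpa using ((Complex.ofRealCLM.hasDerivAt (x := t)).mul_const (a - b)).const_add b
    have h2 := ((hF.hasDerivAt _ (hseg t ht)).comp t h1).const_mul c
    have h3 := (Complex.reCLM.hasFDerivAt.comp_hasDerivAt t h2)
    refine h3.congr_deriv ?_
    simp only [Complex.reCLM_apply]
    rw [show ∀ z : ℂ, c * (z * (a - b)) = ((‖a - b‖ ^ 2 : ℝ) : ℂ) * z by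
      intro z
      rw [← Complex.normSq_eq_norm_sq, Complex.normSq_eq_conj_mul_self]
      ring]
    rw [Complex.re_ofReal_mul]
  obtain ⟨t, ht, hslope⟩ := exists_hasDerivAt_eq_slope
    (fun t : ℝ => (c * F (b + t * (a - b))).re) _ zero_lt_one
    (fun t ht => (hder t ht).continuousAt.continuousWithinAt)
    (fun t ht => hder t (Ioo_subset_Icc_self ht))
  have h1 : ‖Polynomial.aeval (b + t * (a - b)) Q‖ < 1 :=
    (h.norm_aeval_le (hseg t (Ioo_subset_Icc_self ht)).le).trans_lt
      (hseg t (Ioo_subset_Icc_self ht))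
  have h2 := re_inv_one_sub h1
  have h3 : (c * (F a - F b)).re ≤ ‖a - b‖ * ‖F a - F b‖ := by
    refine (Complex.re_le_norm _).trans ?_
    rw [norm_mul, Complex.norm_conj]
  simp only [Complex.ofReal_one, one_mul, add_sub_cancel, Complex.ofReal_zero, zero_mul, add_zero,
    sub_zero, div_one] at hslope
  rw [mul_sub, Complex.sub_re, ← hslope] at h3
  have h4 : ‖a - b‖ * (‖a - b‖ * (1 / 2)) ≤ ‖a - b‖ * ‖F a - F b‖ := by nlinarith
  have := le_of_mul_le_mul_left h4 hn
  linarith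

theorem injOn (hF : IsPrim Q F) (h : IsPGF Q q) {a b : ℂ} (ha : ‖a‖ < 1) (hb : ‖b‖ < 1)
    (hab : F a = F b) : a = b := by
  have := hF.norm_sub_le h ha hb
  rw [hab, sub_self, norm_zero, mul_zero, norm_le_zero_iff, sub_eq_zero] at this
  exact this

theorem hasStrictDerivAt (hF : IsPrim Q F) {s : ℂ} (hs : ‖s‖ < 1) :
    HasStrictDerivAt F (1 / (1 - Polynomial.aeval s Q)) s := by
  have hd : DifferentiableOn ℂ F (Metric.ball 0 1) := fun z hz =>
    (hF.hasDerivAt z (by simpa using hz)).differentiableAt.differentiableWithinAt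
  have ha : AnalyticAt ℂ F s := hd.analyticAt (Metric.isOpen_ball.mem_nhds (by simpa using hs))
  have := ha.hasStrictDerivAt
  rwa [(hF.hasDerivAt s hs).deriv] at this

theorem image_mem_nhds (hF : IsPrim Q F) (h : IsPGF Q q) {s : ℂ} (hs : ‖s‖ < 1) {V : Set ℂ}
    (hV : V ∈ 𝓝 s) : F '' V ∈ 𝓝 (F s) := by
  rw [← (hF.hasStrictDerivAt hs).map_nhds_eq (one_div_ne_zero (h.one_sub_ne_zero hs))]
  exact image_mem_map hV

theorem isOpen_image (hF : IsPrim Q F) (h : IsPGF Q q) {V : Set ℂ} (hV : IsOpen V)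
    (hV1 : ∀ s ∈ V, ‖s‖ < 1) : IsOpen (F '' V) := by
  rw [isOpen_iff_mem_nhds]
  rintro _ ⟨s, hs, rfl⟩
  exact hF.image_mem_nhds h (hV1 s hs) (hV.mem_nhds hs)

/-- The inverse of `F` satisfies `ψ' = 1 - Q(ψ)`. -/
theorem hasDerivAt_inverse (hF : IsPrim Q F) (h : IsPGF Q q) {G : ℂ → ℂ} {s : ℂ} (hs : ‖s‖ < 1)
    {V : Set ℂ} (hV : V ∈ 𝓝 s) (hV1 : ∀ x ∈ V, ‖x‖ < 1) (hG : ∀ x ∈ V, G (F x) = x) :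
    HasDerivAt G (1 - Polynomial.aeval s Q) (F s) := by
  have hsV := mem_of_mem_nhds hV
  have him := hF.image_mem_nhds h hs hV
  -- Continuity of the inverse comes from the 2-Lipschitz bound of `norm_sub_le`.
  have hcont : ContinuousAt G (F s) := by
    rw [Metric.continuousAt_iff]
    intro ε hε
    obtain ⟨δ, hδ, hball⟩ := Metric.mem_nhds_iff.1 him
    refine ⟨min δ (ε / 2), by positivity, fun {z} hz => ?_⟩
    obtain ⟨x, hx, rfl⟩ := hball (Metric.mem_ball.2 (hz.trans_le (min_le_left _ _)))
    rw [hG x hx, hG s hsV, dist_eq_norm]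
    have := hF.norm_sub_le h (hV1 x hx) hs
    rw [dist_eq_norm] at hz
    linarith [hz.trans_le (min_le_right _ _)]
  have hd : HasDerivAt F (1 / (1 - Polynomial.aeval s Q)) (G (F s)) := by
    rw [hG s hsV]; exact hF.hasDerivAt s hs
  have := hd.of_local_left_inverse hcont (one_div_ne_zero (h.one_sub_ne_zero hs)) (by
    filter_upwards [him] with z hz
    obtain ⟨x, hx, rfl⟩ := hz
    rw [hG x hx])
  simpa using this

theorem continuousOn (hF : IsPrim Q F) : ContinuousOn F (Metric.ball 0 1) := fun z hz =>
  (hF.hasDerivAt z (by simpa using hz)).continuousAt.continuousWithinAt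

end IsPrim

/-- `T` continues `exp (-q F)` analytically to a disc of radius `ρ` about `1`, on which it is
univalent; `θ` is its inverse, defined on a disc of radius `σ` about `0`. -/
structure IsLogChart (Q : Polynomial ℝ) (q : ℝ) (F T θ : ℂ → ℂ) (ρ σ : ℝ) : Prop where
  ρ_pos : 0 < ρ
  σ_pos : 0 < σ
  map_one : T 1 = 0
  ne_zero : ∀ s, ‖s - 1‖ < ρ → s ≠ 1 → T s ≠ 0
  hasDerivAt : ∀ s, ‖s - 1‖ < ρ → s ≠ 1 →
    1 - Polynomial.aeval s Q ≠ 0 ∧ HasDerivAt T (-(q * T s) / (1 - Polynomial.aeval s Q)) s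
  differentiableAt : DifferentiableAt ℂ T 1
  eq_exp : ∀ s, ‖s - 1‖ < ρ → ‖s‖ < 1 → T s = Complex.exp (-(q * F s))
  θ_T : ∀ s, ‖s - 1‖ < ρ → θ (T s) = s
  θ_mem : ∀ w, ‖w‖ < σ → ‖θ w - 1‖ < ρ ∧ T (θ w) = w
  θ_hasDerivAt : ∀ w, ‖w‖ < σ → w ≠ 0 →
    HasDerivAt θ ((1 - Polynomial.aeval (θ w) Q) / -(q * w)) w
  θ_differentiableAt : DifferentiableAt ℂ θ 0

/-- Write `1 - Q = (1 - s) R` with `R(1) = q ≠ 0`. Then `q / (1 - Q)` is `1 / (1 - s)` plus a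
function analytic at `1`, so `exp (-q F)` is a constant times `(1 - s) exp (q K)` with `K` analytic.
This expression has a simple zero at `1`, hence a local inverse. -/
theorem IsPGF.exists_logChart {Q : Polynomial ℝ} {q : ℝ} (h : IsPGF Q q) {F : ℂ → ℂ}
    (hF : IsPrim Q F) : ∃ T θ ρ σ, IsLogChart Q q F T θ ρ σ := by
  have hq : (q : ℂ) ≠ 0 := by
    have := h.one_le_mean
    exact_mod_cast (by linarith : (0 : ℝ) < q).ne'
  have hR1 : Rc Q 1 ≠ 0 := by rw [h.Rc_one]; exact hq
  obtain ⟨ρ₁, hρ₁, hball⟩ := Metric.mem_nhds_iff.1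
    ((continuous_Rc Q).continuousAt.eventually_ne hR1)
  have hR : ∀ s ∈ Metric.ball (1 : ℂ) ρ₁, Rc Q s ≠ 0 := fun s hs => hball hs
  have hdR : DifferentiableOn ℂ (fun s => 1 / Rc Q s) (Metric.ball 1 ρ₁) :=
    DifferentiableOn.div (by fun_prop) (differentiable_Rc Q).differentiableOn hR
  have hdk := (Complex.differentiableOn_dslope (Metric.ball_mem_nhds (1 : ℂ) hρ₁)).2 hdR
  obtain ⟨K, hK⟩ := hdk.isExactOn_ball
  -- The regular part of the logarithmic derivative: `(1/R - 1/q) / (s - 1)` has a removable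
  -- singularity at `1`, which `dslope` fills in.
  set k := dslope (fun s => 1 / Rc Q s) 1 with hk
  have hk1 : ∀ s, s ≠ 1 → k s = (1 / Rc Q s - 1 / q) / (s - 1) := by
    intro s hs
    rw [hk, dslope_of_ne _ hs, slope_def_field, h.Rc_one]
  let T₀ : ℂ → ℂ := fun s => (1 - s) * Complex.exp (q * K s)
  have hT₀ : ∀ s ∈ Metric.ball (1 : ℂ) ρ₁, HasDerivAt T₀
      (-1 * Complex.exp (q * K s) + (1 - s) * (Complex.exp (q * K s) * (q * k s))) s := by
    intro s hs
    have h1 : HasDerivAt (fun s : ℂ => 1 - s) (-1) s := by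
      simpa using (hasDerivAt_id s).const_sub 1
    exact h1.mul ((hK s hs).const_mul (q : ℂ)).cexp
  have hT₀' : ∀ s ∈ Metric.ball (1 : ℂ) ρ₁, s ≠ 1 →
      1 - Polynomial.aeval s Q ≠ 0 ∧
      HasDerivAt T₀ (-(q * T₀ s) / (1 - Polynomial.aeval s Q)) s := by
    intro s hs hs1
    have e1 : (1 - s : ℂ) ≠ 0 := sub_ne_zero.2 hs1.symm
    have e2 : (s - 1 : ℂ) ≠ 0 := sub_ne_zero.2 hs1
    have e3 := hR s hs
    refine ⟨by rw [h.one_sub_aeval]; exact mul_ne_zero e1 e3, (hT₀ s hs).congr_deriv ?_⟩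
    rw [h.one_sub_aeval, hk1 s hs1]
    simp only [T₀]
    field_simp
    ring
  -- the constant relating `T₀` and `exp (-q F)`
  let W : Set ℂ := Metric.ball 0 1 ∩ Metric.ball 1 ρ₁
  have hWc : Convex ℝ W := (convex_ball _ _).inter (convex_ball _ _)
  have hWo : IsOpen W := Metric.isOpen_ball.inter Metric.isOpen_ball
  -- The product `exp (q F) T₀` is constant on the lens where both factors are available; dividing
  -- `T₀` by this constant normalises it to `exp (-q F)`.
  let P : ℂ → ℂ := fun s => Complex.exp (q * F s) * T₀ s
  have hP : ∀ s ∈ W, HasDerivAt P 0 s := by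
    intro s hs
    have hs1 : ‖s‖ < 1 := by simpa using hs.1
    have hne : s ≠ 1 := by rintro rfl; simp at hs1
    obtain ⟨h1, h2⟩ := hT₀' s hs.2 hne
    refine (((hF.hasDerivAt s hs1).const_mul (q : ℂ)).cexp.mul h2).congr_deriv ?_
    field_simp
    ring
  obtain ⟨x₀, hx₀⟩ : W.Nonempty := by
    have hm : min (ρ₁ / 2) (1 / 2) ≤ 1 / 2 := min_le_right _ _
    have hm' : min (ρ₁ / 2) (1 / 2) ≤ ρ₁ / 2 := min_le_left _ _
    have hm0 : 0 < min (ρ₁ / 2) (1 / 2 : ℝ) := by positivity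
    refine ⟨((1 - min (ρ₁ / 2) (1 / 2) : ℝ) : ℂ), ?_, ?_⟩
    · rw [mem_ball_zero_iff, Complex.norm_real, Real.norm_eq_abs, abs_lt]
      constructor <;> linarith
    · rw [mem_ball_iff_norm, ← Complex.ofReal_one, ← Complex.ofReal_sub, Complex.norm_real,
        Real.norm_eq_abs, abs_lt]
      constructor <;> linarith
  have hPc : ∀ s ∈ W, P s = P x₀ := by
    intro s hs
    have := hWc.norm_image_sub_le_of_norm_hasDerivWithin_le (C := 0)
      (fun x hx => (hP x hx).hasDerivWithinAt) (fun x _ => by simp) hx₀ hs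
    rw [zero_mul, norm_le_zero_iff, sub_eq_zero] at this
    exact this
  have hT₀ne : ∀ s, s ≠ 1 → T₀ s ≠ 0 := fun s hs =>
    mul_ne_zero (sub_ne_zero.2 hs.symm) (Complex.exp_ne_zero _)
  have hc0 : P x₀ ≠ 0 := by
    refine mul_ne_zero (Complex.exp_ne_zero _) (hT₀ne _ ?_)
    rintro rfl
    simpa using hx₀.1
  let T : ℂ → ℂ := fun s => T₀ s / P x₀
  have hT1 : HasDerivAt T (-Complex.exp (q * K 1) / P x₀) 1 := by
    refine ((hT₀ 1 (Metric.mem_ball_self hρ₁)).div_const (P x₀)).congr_deriv ?_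
    simp
  have hTd : DifferentiableOn ℂ T (Metric.ball 1 ρ₁) := fun s hs =>
    ((hT₀ s hs).div_const (P x₀)).differentiableAt.differentiableWithinAt
  have hTs := (hTd.analyticAt (Metric.ball_mem_nhds 1 hρ₁)).hasStrictDerivAt
  have hT1ne : deriv T 1 ≠ 0 := by
    rw [hT1.deriv]
    exact div_ne_zero (neg_ne_zero.2 (Complex.exp_ne_zero _)) hc0
  let e := (hTs.hasStrictFDerivAt_equiv hT1ne).toOpenPartialHomeomorph T
  have he : ∀ s, e s = T s := fun s => rfl
  have h1e : (1 : ℂ) ∈ e.source := (hTs.hasStrictFDerivAt_equiv hT1ne).mem_toOpenPartialHomeomorph_source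
  obtain ⟨ρ, hρ, hρe⟩ := Metric.mem_nhds_iff.1
    (Filter.inter_mem (Metric.ball_mem_nhds 1 hρ₁) (e.open_source.mem_nhds h1e))
  have hT1z : T 1 = 0 := by simp [T, T₀]
  have himo : IsOpen (e '' Metric.ball 1 ρ) :=
    e.isOpen_image_of_subset_source Metric.isOpen_ball fun s hs => (hρe hs).2
  obtain ⟨σ, hσ, hσe⟩ := Metric.mem_nhds_iff.1 (himo.mem_nhds
    ⟨1, Metric.mem_ball_self hρ, (he 1).trans hT1z⟩)
  have hTne : ∀ s, s ≠ 1 → T s ≠ 0 := fun s hs => div_ne_zero (hT₀ne s hs) hc0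
  have hTder : ∀ s, ‖s - 1‖ < ρ → s ≠ 1 → 1 - Polynomial.aeval s Q ≠ 0 ∧
      HasDerivAt T (-(q * T s) / (1 - Polynomial.aeval s Q)) s := by
    intro s hs hs1
    obtain ⟨h1, h2⟩ := hT₀' s (hρe (mem_ball_iff_norm.2 hs)).1 hs1
    refine ⟨h1, (h2.div_const (P x₀)).congr_deriv ?_⟩
    simp only [T]; field_simp
  have hθT : ∀ s, ‖s - 1‖ < ρ → e.symm (T s) = s := fun s hs =>
    e.left_inv (hρe (mem_ball_iff_norm.2 hs)).2
  have hθm : ∀ w, ‖w‖ < σ → ‖e.symm w - 1‖ < ρ ∧ T (e.symm w) = w := by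
    intro w hw
    obtain ⟨s, hs, rfl⟩ := hσe (mem_ball_zero_iff.2 hw)
    rw [he, hθT s (mem_ball_iff_norm.1 hs)]
    exact ⟨mem_ball_iff_norm.1 hs, rfl⟩
  refine ⟨T, e.symm, ρ, σ, hρ, hσ, hT1z, fun s _ hs1 => hTne s hs1, hTder, hT1.differentiableAt,
    ?_, hθT, hθm, ?_, ?_⟩
  · intro s hs hs1
    have := hPc s ⟨by simpa using hs1, (hρe (mem_ball_iff_norm.2 hs)).1⟩
    simp only [T]
    rw [← this, Complex.exp_neg]
    have h2 : T₀ s ≠ 0 := hT₀ne s (by rintro rfl; simp at hs1)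
    simp only [P]
    field_simp
  · intro w hw hw0
    obtain ⟨s, hs, rfl⟩ := hσe (mem_ball_zero_iff.2 hw)
    rw [he] at hw0 ⊢
    have hs' := mem_ball_iff_norm.1 hs
    have hs1 : s ≠ 1 := by rintro rfl; exact hw0 hT1z
    rw [hθT s hs']
    obtain ⟨h1, h2⟩ := hTder s hs' hs1
    have h3 : -(q * T s) / (1 - Polynomial.aeval s Q) ≠ 0 :=
      div_ne_zero (neg_ne_zero.2 (mul_ne_zero hq hw0)) h1
    have h4 := e.hasDerivAt_symm (a := T s) (f' := -(q * T s) / (1 - Polynomial.aeval s Q))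
      (e.map_source (hρe hs).2) h3 (by rw [hθT s hs']; exact h2)
    simpa using h4
  · have h1 : e.symm 0 = 1 := by rw [← hT1z]; exact hθT 1 (by simpa using hρ)
    refine (e.hasDerivAt_symm (a := 0) (f' := deriv T 1) ?_ hT1ne ?_).differentiableAt
    · rw [← hT1z]; exact e.map_source h1e
    · rw [h1]; exact hT1.differentiableAt.hasDerivAt

end Coarsening

/-! ### The domain of `ψ`, and uniqueness of the inverse. -/

namespace Coarsening

/-- `ψ` extends to a domain covering the `F`-image of a disc of radius `r < 1`, of a neighbourhood
of `1` in the unit disc, and a right half-plane. -/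
theorem exists_psi_domain {Q : Polynomial ℝ} {q : ℝ} (h : IsPGF Q q) {F T θ : ℂ → ℂ} {ρ σ : ℝ}
    (hF : IsPrim Q F) (hT : IsLogChart Q q F T θ ρ σ) {r : ℝ} (hr0 : 0 < r) (hr : r < 1) :
    ∃ σ' > 0, ∃ (O : Set ℂ) (ψ : ℂ → ℂ), IsOpen O ∧
      (∀ z ∈ O, HasDerivAt ψ (1 - Polynomial.aeval (ψ z) Q) z) ∧
      (∀ x, ‖x‖ < 1 → (‖x‖ < r ∨ ‖x - 1‖ < ρ) → F x ∈ O ∧ ψ (F x) = x) ∧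
      ∀ z x, ‖x - 1‖ < ρ → T x = Complex.exp (-(q * z)) → ‖T x‖ < σ' → z ∈ O ∧ ψ z = x := by
  have hq : (q : ℂ) ≠ 0 := by
    have := h.one_le_mean
    exact_mod_cast (by linarith : (0 : ℝ) < q).ne'
  obtain ⟨b, hb⟩ := (isCompact_closedBall (0 : ℂ) r).exists_bound_of_continuousOn
    (f := fun s => (q : ℂ) * F s) ((hF.continuousOn.mono fun s hs => by
      rw [mem_closedBall_zero_iff] at hs
      exact mem_ball_zero_iff.2 (hs.trans_lt hr)).const_smul (q : ℂ))
  -- On the disc of radius `r`, `|exp (-q F)| ≥ e^{-b}`. With this `σ'` the half-plane `H` therefore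
  -- misses the `F`-image of that disc, and on the rest of `F '' V` the branches `F⁻¹` and `θ ∘ exp
  -- (-q ·)` agree by the chart.
  let σ' := min σ (Real.exp (-b))
  let V : Set ℂ := {x | ‖x‖ < 1 ∧ (‖x‖ < r ∨ ‖x - 1‖ < ρ)}
  have hVo : IsOpen V :=
    (isOpen_lt continuous_norm continuous_const).inter
      ((isOpen_lt continuous_norm continuous_const).union
        (isOpen_lt (by fun_prop : Continuous fun x : ℂ => ‖x - 1‖) continuous_const))
  let H : Set ℂ := {z | ‖Complex.exp (-(q * z))‖ < σ'}
  have hHo : IsOpen H := isOpen_lt (by fun_prop) continuous_const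
  let G : ℂ → ℂ := Function.invFunOn F V
  have hG : ∀ x ∈ V, G (F x) = x := fun x hx => by
    have h1 : ∃ y ∈ V, F y = F x := ⟨x, hx, rfl⟩
    exact hF.injOn h (Function.invFunOn_mem h1).1 hx.1 (Function.invFunOn_eq h1)
  classical
  let ψ : ℂ → ℂ := fun z => if z ∈ H then θ (Complex.exp (-(q * z))) else G z
  have hψV : ∀ x ∈ V, ψ (F x) = x := by
    intro x hx
    simp only [ψ]
    split_ifs with hz
    · have h2 : ¬ ‖x‖ < r := by
        intro hxr
        have h3 := hb x (mem_closedBall_zero_iff.2 hxr.le)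
        have h4 : ‖Complex.exp (-(q * F x))‖ < Real.exp (-b) := hz.trans_le (min_le_right _ _)
        rw [Complex.norm_exp, Real.exp_lt_exp, Complex.neg_re] at h4
        linarith [Complex.re_le_norm (q * F x)]
      have h3 := hx.2.resolve_left h2
      rw [← hT.eq_exp x h3 hx.1, hT.θ_T x h3]
    · exact hG x hx
  refine ⟨σ', lt_min hT.σ_pos (Real.exp_pos _), F '' V ∪ H, ψ,
    (hF.isOpen_image h hVo fun s hs => hs.1).union hHo, ?_,
    fun x hx1 hx2 => ⟨Or.inl ⟨x, ⟨hx1, hx2⟩, rfl⟩, hψV x ⟨hx1, hx2⟩⟩, ?_⟩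
  · rintro z (⟨x, hx, rfl⟩ | hz)
    · rw [hψV x hx]
      exact hF.hasDerivAt_inverse h hx.1 (hVo.mem_nhds hx) (fun s hs => hs.1) hψV
    · have hw : ‖Complex.exp (-(q * z))‖ < σ := hz.trans_le (min_le_left _ _)
      have h1 : HasDerivAt (fun z : ℂ => Complex.exp (-(q * z)))
          (Complex.exp (-(q * z)) * -(q * 1)) z :=
        (((hasDerivAt_id z).const_mul (q : ℂ)).neg).cexp
      have h2 := (hT.θ_hasDerivAt _ hw (Complex.exp_ne_zero _)).comp z h1
      have h3 : ψ =ᶠ[𝓝 z] θ ∘ fun z => Complex.exp (-(q * z)) := by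
        filter_upwards [hHo.mem_nhds hz] with y hy
        simp only [ψ, if_pos hy, Function.comp]
      refine (h2.congr_of_eventuallyEq h3).congr_deriv ?_
      rw [show ψ z = θ (Complex.exp (-(q * z))) from if_pos hz]
      have := Complex.exp_ne_zero (-(q * z))
      field_simp
  · intro z x hx hTx hσ
    have hz : z ∈ H := by
      change ‖Complex.exp (-(q * z))‖ < σ'
      rwa [← hTx]
    refine ⟨Or.inr hz, ?_⟩
    rw [show ψ z = θ (Complex.exp (-(q * z))) from if_pos hz, ← hTx, hT.θ_T x hx]

/-- Near the origin every solution `ψ` inverts `F`. -/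
theorem IsPsi.exists_eq_inverse {Q : Polynomial ℝ} {q : ℝ} (h : IsPGF Q q) {F : ℂ → ℂ}
    (hF : IsPrim Q F) {U : Set ℂ} {ψ : ℂ → ℂ} (hψ : IsPsi Q U ψ) :
    ∃ ρ > 0, ∀ z, ‖z‖ < ρ → ‖ψ z‖ < 1 ∧ F (ψ z) = z := by
  have h0 : (0 : ℂ) ∈ U := by simpa using hψ.mem_of_nonneg 0 le_rfl
  have hc : ContinuousAt ψ 0 := (hψ.hasDerivAt 0 h0).continuousAt
  have h1 : ∀ᶠ z in 𝓝 (0 : ℂ), ‖ψ z‖ < 1 := by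
    have : ‖ψ 0‖ < 1 := by simp [hψ.map_zero]
    exact hc.norm.eventually_lt continuousAt_const this
  obtain ⟨ρ, hρ, hball⟩ := Metric.mem_nhds_iff.1 (Filter.inter_mem h1 (hψ.isOpen.mem_nhds h0))
  refine ⟨ρ, hρ, fun z hz => ⟨(hball (mem_ball_zero_iff.2 hz)).1, ?_⟩⟩
  -- By the differential equation, `F ∘ ψ` has derivative one wherever `ψ` stays in the unit disc.
  have hd : ∀ z ∈ Metric.ball (0 : ℂ) ρ, HasDerivAt (fun z => F (ψ z) - z) 0 z := by
    intro z hz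
    have hz1 := hball hz
    have h2 := (hF.hasDerivAt (ψ z) hz1.1).comp z (hψ.hasDerivAt z hz1.2)
    refine (h2.sub (hasDerivAt_id z)).congr_deriv ?_
    have := h.one_sub_ne_zero hz1.1
    field_simp
    simp
  have := (convex_ball (0 : ℂ) ρ).norm_image_sub_le_of_norm_hasDerivWithin_le (C := 0)
    (fun x hx => (hd x hx).hasDerivWithinAt) (fun x _ => by simp) (Metric.mem_ball_self hρ)
    (mem_ball_zero_iff.2 hz)
  rw [zero_mul, norm_le_zero_iff, hψ.map_zero, hF.zero] at this
  linear_combination this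

/-- The restriction of `f` to `[1, ∞)`, extended by zero. -/
noncomputable def ext1 (f : ℝ → ℝ) (y : ℝ) : ℝ := if 1 ≤ y then f y else 0

theorem ExpIntegrable.lapInt {f : ℝ → ℝ} (hf : ExpIntegrable f) {b : ℝ} (hb : 0 < b) :
    LapInt b (ext1 f) := by
  refine ⟨fun y hy => if_neg (by linarith), ?_⟩
  have := (integrable_indicator_iff measurableSet_Ici).2 (hf b hb)
  refine this.congr (Eventually.of_forall fun y => ?_)
  simp [ext1, indicator]

/-- Where the integral over `[1, ∞)` converges absolutely, it is the value of `HasFourier`. -/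
theorem hasFourier_of_integrable {f : ℝ → ℝ} {b : ℝ} (hf : LapInt b (ext1 f)) {ξ : ℂ}
    (hξ : b ≤ (Complex.I * ξ).re) : HasFourier f ξ (lap (ext1 f) (Complex.I * ξ)) := by
  have h1 := (hf.cint hξ)
  have h2 : IntegrableOn (fun y : ℝ => Complex.exp (-Complex.I * ξ * (y : ℂ)) * (f y : ℂ))
      (Ioi 1) := by
    refine (h1.integrableOn (s := Ioi 1)).congr_fun (fun y (hy : 1 < y) => ?_) measurableSet_Ioi
    simp [ext1, hy.le]
  have h3 := intervalIntegral_tendsto_integral_Ioi 1 h2 tendsto_id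
  have h4 : lap (ext1 f) (Complex.I * ξ) =
      ∫ y in Ioi (1 : ℝ), Complex.exp (-Complex.I * ξ * (y : ℂ)) * (f y : ℂ) := by
    rw [lap, ← integral_Ici_eq_integral_Ioi, ← integral_indicator measurableSet_Ici]
    congr 1; ext y
    by_cases hy : 1 ≤ y <;> simp [ext1, indicator, hy]
  rw [h4]
  exact h3

theorem HasFourier.unique {f : ℝ → ℝ} {ξ z w : ℂ} (h1 : HasFourier f ξ z)
    (h2 : HasFourier f ξ w) : z = w := tendsto_nhds_unique h1 h2

/-- The two domains and the two functions `ψ` may differ globally. For `Re s` large the transform of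
`w` lies in a disc about `0` where both invert `F`, so the transforms of `η₁` and `η₂` agree on a
vertical line. -/
theorem IsNInv.unique {Q : Polynomial ℝ} {q : ℝ} (h : IsPGF Q q) {w η₁ η₂ : ℝ → ℝ}
    (h1 : IsNInv Q w η₁) (h2 : IsNInv Q w η₂) : η₁ =ᵐ[volume.restrict (Ici 1)] η₂ := by
  obtain ⟨F, hF⟩ := h.exists_prim
  obtain ⟨hw, hη₁, U₁, ψ₁, hψ₁, H₁⟩ := h1
  obtain ⟨-, hη₂, U₂, ψ₂, hψ₂, H₂⟩ := h2
  obtain ⟨ρ₁, hρ₁, hinv₁⟩ := hψ₁.exists_eq_inverse h hF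
  obtain ⟨ρ₂, hρ₂, hinv₂⟩ := hψ₂.exists_eq_inverse h hF
  obtain ⟨c, hc1, hc⟩ := (hw.lapInt one_pos).exists_lap_small
    (show 0 < min ρ₁ ρ₂ / 2 by positivity)
  have hc0 : 0 < c := by linarith
  have key : ext1 η₁ =ᵐ[volume] ext1 η₂ := by
    refine lap_inj (hη₁.lapInt hc0) (hη₂.lapInt hc0) fun s hs => ?_
    set ξ : ℂ := -Complex.I * s with hξ
    have hIξ : Complex.I * ξ = s := by
      rw [hξ, ← mul_assoc, mul_neg, Complex.I_mul_I]; simp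
    have him : ξ.im ≤ 0 := by simp [hξ, hs, hc0.le]
    have hξ0 : ξ ≠ 0 := by
      intro h0
      rw [h0, mul_zero] at hIξ
      rw [← hIξ] at hs
      simp at hs
      linarith
    have hre : c ≤ (Complex.I * ξ).re := by rw [hIξ, hs]
    obtain ⟨z₁, -, hz₁, hv₁⟩ := H₁ ξ him hξ0
    obtain ⟨z₂, -, hz₂, hv₂⟩ := H₂ ξ him hξ0
    have e1 := hz₁.unique (hasFourier_of_integrable (hw.lapInt hc0) hre)
    have e2 := hz₂.unique (hasFourier_of_integrable (hw.lapInt hc0) hre)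
    have e3 := hv₁.unique (hasFourier_of_integrable (hη₁.lapInt hc0) hre)
    have e4 := hv₂.unique (hasFourier_of_integrable (hη₂.lapInt hc0) hre)
    rw [hIξ] at e1 e2 e3 e4
    have hsm := hc s hs.ge
    rw [← e1] at hsm
    have hm : 0 < min ρ₁ ρ₂ := by positivity
    have g1 := hinv₁ z₁ (by linarith [min_le_left ρ₁ ρ₂])
    have g2 := hinv₂ z₁ (by linarith [min_le_right ρ₁ ρ₂])
    rw [← e3, ← e4, e2, ← e1]
    exact hF.injOn h g1.1 g2.1 (g1.2.trans g2.2.symm)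
  rw [Filter.EventuallyEq, ae_restrict_iff' measurableSet_Ici]
  filter_upwards [key] with y hy hy1
  simpa [ext1, mem_Ici.1 hy1] using hy

end Coarsening

/-! ### The exponential integral `E1`. -/

namespace Coarsening

/-- The indicator function of `[a, ∞)`. -/
noncomputable def st (a : ℝ) (y : ℝ) : ℝ := if a ≤ y then 1 else 0

theorem st_nonneg (a y : ℝ) : 0 ≤ st a y := by unfold st; split_ifs <;> norm_num

theorem st_le_one (a y : ℝ) : st a y ≤ 1 := by unfold st; split_ifs <;> norm_num

theorem measurable_st (a : ℝ) : Measurable (st a) :=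
  Measurable.ite measurableSet_Ici measurable_const measurable_const

theorem lapInt_st {a b : ℝ} (ha : 0 ≤ a) (hb : 0 < b) : LapInt b (st a) := by
  refine ⟨fun y hy => if_neg (by linarith), ?_⟩
  have h1 := (integrableOn_Ici_iff_integrableOn_Ioi (f := fun y : ℝ => Real.exp (-b * y))
    (b := a) (μ := volume)).2 (exp_neg_integrableOn_Ioi a hb)
  refine ((integrable_indicator_iff measurableSet_Ici).2 h1).congr
    (Eventually.of_forall fun y => ?_)
  by_cases hy : a ≤ y <;> simp [st, indicator, hy]

theorem lap_st (a : ℝ) {s : ℂ} (hs : 0 < s.re) :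
    lap (st a) s = Complex.exp (-s * a) / s := by
  have h1 := integral_exp_mul_complex_Ioi (a := -s) (by simpa using hs) a
  rw [← integral_Ici_eq_integral_Ioi, ← integral_indicator measurableSet_Ici] at h1
  rw [lap]
  refine Eq.trans ?_ (h1.trans (by rw [neg_div_neg_eq]))
  congr 1; ext y
  by_cases hy : a ≤ y <;> simp [st, indicator, hy]

theorem lapInt_wStar {b : ℝ} (hb : 0 < b) : LapInt b wStar := by
  refine ⟨fun y hy => if_neg (by linarith), (lapInt_st zero_le_one hb).absInt.mono' ?_
    (Eventually.of_forall fun y => ?_)⟩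
  · refine (Measurable.mul (by fun_prop) ?_).aestronglyMeasurable
    exact Measurable.ite measurableSet_Ici (by fun_prop) measurable_const
  · rw [norm_mul, Real.norm_of_nonneg (Real.exp_pos _).le]
    gcongr
    unfold wStar st
    split_ifs with h
    · rw [Real.norm_of_nonneg (by positivity), abs_one, div_le_one (by linarith)]
      exact h
    · simp

theorem ext1_wStar : ext1 wStar = wStar := by
  ext y; unfold ext1 wStar; split_ifs <;> rfl

/-- The function `1 / y ^ 2` on `[1, ∞)`. -/
noncomputable def invSq (y : ℝ) : ℝ := if 1 ≤ y then 1 / y ^ 2 else 0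

theorem lapInt_invSq : LapInt 0 invSq := by
  refine ⟨fun y hy => if_neg (by linarith), ?_⟩
  have h1 := (integrableOn_Ici_iff_integrableOn_Ioi (f := fun y : ℝ => y ^ (-2 : ℝ))
    (b := 1) (μ := volume)).2 (integrableOn_Ioi_rpow_of_lt (by norm_num) one_pos)
  refine ((integrable_indicator_iff measurableSet_Ici).2 h1).congr
    (Eventually.of_forall fun y => ?_)
  by_cases hy : 1 ≤ y
  · have : 0 ≤ y := by linarith
    simp [invSq, indicator, hy, Real.rpow_neg this]
  · simp [invSq, indicator, hy]

/-- The Fourier transform of `w*`, as a function of `s = iξ`: the exponential integral. -/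
noncomputable def E1 (s : ℂ) : ℂ := (Complex.exp (-s) - lap invSq s) / s

/-- One integration by parts replaces `1/y` by the absolutely integrable `1/y²`. The boundary term
at `T` is at most `1/T` in modulus, also on the real axis in `ξ`, so the truncated integrals
converge there. -/
theorem hasFourier_wStar {ξ : ℂ} (him : ξ.im ≤ 0) (hξ : ξ ≠ 0) :
    HasFourier wStar ξ (E1 (Complex.I * ξ)) := by
  set s := Complex.I * ξ with hs
  have hs0 : s ≠ 0 := mul_ne_zero Complex.I_ne_zero hξ
  have hre : 0 ≤ s.re := by simp [hs, him]
  have e0 : ∀ y : ℝ, Complex.exp (-Complex.I * ξ * y) = Complex.exp (-s * y) := fun y => by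
    rw [hs]; ring_nf
  have hint : IntegrableOn (fun y : ℝ => Complex.exp (-s * y) * (invSq y : ℂ)) (Ioi 1) :=
    (lapInt_invSq.cint hre).integrableOn
  have hlim := intervalIntegral_tendsto_integral_Ioi 1 hint tendsto_id
  have hlap : ∫ y in Ioi (1 : ℝ), Complex.exp (-s * y) * (invSq y : ℂ) = lap invSq s := by
    rw [lap, ← integral_Ici_eq_integral_Ioi, ← integral_indicator measurableSet_Ici]
    congr 1; ext y
    by_cases hy : 1 ≤ y <;> simp [invSq, indicator, hy]
  rw [hlap] at hlim
  have hbd : Tendsto (fun T : ℝ => Complex.exp (-s * T) / T) atTop (𝓝 0) := by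
    rw [tendsto_zero_iff_norm_tendsto_zero]
    refine squeeze_zero' (Eventually.of_forall fun _ => norm_nonneg _) ?_ tendsto_inv_atTop_zero
    filter_upwards [eventually_gt_atTop (0 : ℝ)] with T hT
    rw [norm_div, Complex.norm_exp, Complex.norm_real, Real.norm_of_nonneg hT.le, ← one_div]
    gcongr
    rw [Real.exp_le_one_iff]
    simp
    positivity
  have hfin : Tendsto (fun T : ℝ => (Complex.exp (-s) - Complex.exp (-s * T) / T -
      ∫ y in (1 : ℝ)..T, Complex.exp (-s * y) * (invSq y : ℂ)) / s) atTop (𝓝 (E1 s)) := by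
    have := ((tendsto_const_nhds (x := Complex.exp (-s))).sub hbd).sub hlim
    simpa [E1] using this.div_const s
  refine hfin.congr' ?_
  filter_upwards [eventually_ge_atTop (1 : ℝ)] with T hT
  have hsub : ∀ y ∈ uIcc 1 T, (1 : ℝ) ≤ y := fun y hy => by
    rw [uIcc_of_le hT] at hy; exact hy.1
  have hu : ∀ y ∈ uIcc 1 T, HasDerivAt (fun y : ℝ => ((1 / y : ℝ) : ℂ))
      ((-(1 / y ^ 2) : ℝ) : ℂ) y := fun y hy => by
    have := hsub y hy
    have h1 : HasDerivAt (fun y : ℝ => 1 / y) (-(1 / y ^ 2)) y := by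
      simpa using hasDerivAt_inv (by linarith : y ≠ 0)
    exact h1.ofReal_comp
  have hv : ∀ y ∈ uIcc 1 T, HasDerivAt (fun y : ℝ => -(Complex.exp (-s * y) / s))
      (Complex.exp (-s * y)) y := fun y _ => by
    have h1 : HasDerivAt (fun y : ℝ => -s * (y : ℂ)) (-s * 1) y :=
      (Complex.ofRealCLM.hasDerivAt (x := y)).const_mul (-s)
    refine ((h1.cexp.div_const s).neg).congr_deriv ?_
    field_simp
  have hcont : ContinuousOn (fun y : ℝ => ((-(1 / y ^ 2) : ℝ) : ℂ)) (uIcc 1 T) := by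
    refine Complex.continuous_ofReal.comp_continuousOn (ContinuousOn.neg ?_)
    exact continuousOn_const.div (by fun_prop) fun y hy => by
      have := hsub y hy
      positivity
  have hparts := intervalIntegral.integral_mul_deriv_eq_deriv_mul hu hv
    hcont.intervalIntegrable (by apply Continuous.intervalIntegrable; fun_prop)
  have e1 : ∫ y in (1 : ℝ)..T, Complex.exp (-Complex.I * ξ * y) * (wStar y : ℂ) =
      ∫ y in (1 : ℝ)..T, ((1 / y : ℝ) : ℂ) * Complex.exp (-s * y) := by
    refine intervalIntegral.integral_congr fun y hy => ?_
    simp only [wStar, if_pos (hsub y hy)]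
    rw [e0, mul_comm]
  have e2 : ∫ y in (1 : ℝ)..T, ((-(1 / y ^ 2) : ℝ) : ℂ) * -(Complex.exp (-s * y) / s) =
      (∫ y in (1 : ℝ)..T, Complex.exp (-s * y) * (invSq y : ℂ)) / s := by
    rw [← intervalIntegral.integral_div]
    refine intervalIntegral.integral_congr fun y hy => ?_
    simp only [invSq, if_pos (hsub y hy)]
    push_cast; ring
  rw [e1, hparts, e2]
  push_cast
  field_simp
  ring

theorem E1_eq_lap {s : ℂ} (hs : 0 < s.re) : E1 s = lap wStar s := by
  have e : Complex.I * (-Complex.I * s) = s := by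
    rw [← mul_assoc, mul_neg, Complex.I_mul_I]; simp
  have h1 := hasFourier_wStar (ξ := -Complex.I * s) (by simp [hs.le]) (by
    intro h; rw [h] at e; simp [← e] at hs)
  have h2 := hasFourier_of_integrable (f := wStar) (b := s.re) (ξ := -Complex.I * s)
    (by rw [ext1_wStar]; exact lapInt_wStar hs) (by rw [e])
  rw [e] at h1 h2
  rw [h1.unique h2, ext1_wStar]

theorem hasDerivAt_E1 {s : ℂ} (hs : 0 < s.re) : HasDerivAt E1 (-(Complex.exp (-s) / s)) s := by
  have h1 := (lapInt_wStar (half_pos hs)).hasDerivAt_lap (half_lt_self hs)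
  have e : (fun y => y * wStar y) = st 1 := by
    ext y; unfold wStar st
    split_ifs with h
    · field_simp
    · simp
  rw [e, lap_st 1 hs] at h1
  have h2 : E1 =ᶠ[𝓝 s] lap wStar := by
    filter_upwards [(isOpen_lt continuous_const Complex.continuous_re).mem_nhds hs] with z hz
    exact E1_eq_lap hz
  simpa using h1.congr_of_eventuallyEq h2

theorem continuousOn_E1 : ContinuousOn E1 {s : ℂ | 0 ≤ s.re ∧ s ≠ 0} := by
  refine ContinuousOn.div (ContinuousOn.sub (by fun_prop) ?_) continuousOn_id fun s hs => hs.2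
  exact lapInt_invSq.continuousOn_lap.mono fun s hs => hs.1

theorem exists_norm_E1_le : ∃ C : ℝ, ∀ s : ℂ, 0 ≤ s.re → ‖E1 s‖ ≤ C / ‖s‖ := by
  refine ⟨1 + ∫ y : ℝ, Real.exp (-0 * y) * |invSq y|, fun s hs => ?_⟩
  rw [E1, norm_div]
  gcongr
  refine (norm_sub_le _ _).trans (add_le_add ?_ (lapInt_invSq.norm_lap_le hs))
  rw [Complex.norm_exp, Real.exp_le_one_iff]
  simpa using hs

theorem E1_ofReal {b : ℝ} (hb : 0 < b) :
    ∃ e : ℝ, 0 ≤ e ∧ E1 b = e := by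
  refine ⟨∫ y : ℝ, Real.exp (-b * y) * wStar y, integral_nonneg fun y => ?_, ?_⟩
  · refine mul_nonneg (Real.exp_pos _).le ?_
    unfold wStar
    split_ifs with h
    · positivity
    · rfl
  · rw [E1_eq_lap (by simpa using hb), lap_ofReal]

/-- The logarithmic lower bound `E₁(b) ≥ -log b - 1` for `0 < b ≤ 1`. -/
theorem neg_log_le_E1 {b : ℝ} (hb : 0 < b) (hb1 : b ≤ 1) : -Real.log b - 1 ≤ (E1 b).re := by
  -- The derivative of `E₁(b) + log b - b` is `-(e^{-b} - (1 - b)) / b ≤ 0`, and its value at `1` is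
  -- at least `-1`.
  let f : ℝ → ℝ := fun b => (E1 b).re + Real.log b - b
  have hd : ∀ x : ℝ, 0 < x → HasDerivAt f (-(Real.exp (-x) / x) + x⁻¹ - 1) x := by
    intro x hx
    have h1 := (hasDerivAt_E1 (s := (x : ℂ)) (by simpa using hx)).comp_ofReal
    have h2 := Complex.reCLM.hasFDerivAt.comp_hasDerivAt x h1
    have h3 : Complex.reCLM (-(Complex.exp (-(x : ℂ)) / x)) = -(Real.exp (-x) / x) := by
      rw [Complex.reCLM_apply, ← Complex.ofReal_neg, ← Complex.ofReal_exp, ← Complex.ofReal_div,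
        ← Complex.ofReal_neg, Complex.ofReal_re]
    rw [h3] at h2
    exact (h2.add (Real.hasDerivAt_log hx.ne')).sub (hasDerivAt_id x)
  have hanti : AntitoneOn f (Icc b 1) := by
    refine antitoneOn_of_deriv_nonpos (convex_Icc b 1)
      (fun x hx => (hd x (hb.trans_le hx.1)).continuousAt.continuousWithinAt)
      (fun x hx => (hd x (hb.trans_le (interior_subset hx).1)).differentiableAt.differentiableWithinAt)
      fun x hx => ?_
    have hx0 := hb.trans_le (interior_subset hx).1
    rw [(hd x hx0).deriv]
    have := Real.add_one_le_exp (-x)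
    have e : -(Real.exp (-x) / x) + x⁻¹ - 1 = -((Real.exp (-x) - (-x + 1)) / x) := by
      field_simp; ring
    rw [e, neg_nonpos]
    exact div_nonneg (by linarith) hx0.le
  have h1 := hanti ⟨le_rfl, hb1⟩ ⟨hb1, le_rfl⟩ hb1
  obtain ⟨e, he, he'⟩ := E1_ofReal one_pos
  simp only [f, he', Real.log_one, Complex.ofReal_re] at h1
  linarith

end Coarsening

/-! ### The flow under a character, and a first solution far to the right. -/

namespace Coarsening

/-- `X` solves `X' = d - Q(X) * d` in the convolution algebra on `[0, 1]`. -/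
def IsFlow {γ : ℝ} (hγ : 1 / 2 < γ) (Q : Polynomial ℝ) (d : E) (X : ℝ → E) : Prop :=
  ∀ t ∈ Icc (0 : ℝ) 1, HasDerivWithinAt X (d - BL hγ (QE hγ Q (X t)) d) (Icc 0 1) t

namespace IsFlow

variable {γ : ℝ} {hγ : 1 / 2 < γ} {Q : Polynomial ℝ} {q : ℝ} {d : E} {X : ℝ → E}

theorem chi (h : IsFlow hγ Q d X) (hQ : Q.coeff 0 = 0) {s : ℂ} (hs : 0 ≤ s.re) :
    ∀ t ∈ Icc (0 : ℝ) 1, HasDerivWithinAt (fun t => chi hγ hs (X t))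
      ((1 - Polynomial.aeval (Coarsening.chi hγ hs (X t)) Q) * Coarsening.chi hγ hs d)
      (Icc 0 1) t := by
  intro t ht
  have h1 := (Coarsening.chi hγ hs).hasFDerivAt.comp_hasDerivWithinAt t (h t ht)
  refine h1.congr_deriv ?_
  rw [map_sub, chi_BL, chi_QE hγ hs hQ]
  ring

/-- Along the flow `F(X)` has constant velocity under a character, as long as the path stays in the
unit disc. -/
theorem prim_eq (h : IsFlow hγ Q d X) (hQ : IsPGF Q q) {F : ℂ → ℂ} (hF : IsPrim Q F) {s : ℂ}
    (hs : 0 ≤ s.re) (hlt : ∀ t ∈ Icc (0 : ℝ) 1, ‖Coarsening.chi hγ hs (X t)‖ < 1) :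
    F (Coarsening.chi hγ hs (X 1)) = F (Coarsening.chi hγ hs (X 0)) + Coarsening.chi hγ hs d := by
  have hd : ∀ t ∈ Icc (0 : ℝ) 1, HasDerivWithinAt
      (fun t : ℝ => F (Coarsening.chi hγ hs (X t)) - t * Coarsening.chi hγ hs d) 0 (Icc 0 1) t := by
    intro t ht
    have h1 := (hF.hasDerivAt _ (hlt t ht)).comp_hasDerivWithinAt t (h.chi hQ.coeff_zero hs t ht)
    have h2 : HasDerivWithinAt (fun t : ℝ => (t : ℂ) * Coarsening.chi hγ hs d)
        (1 * Coarsening.chi hγ hs d) (Icc 0 1) t :=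
      ((Complex.ofRealCLM.hasDerivAt (x := t)).mul_const _).hasDerivWithinAt
    refine (h1.sub h2).congr_deriv ?_
    have := hQ.one_sub_ne_zero (hlt t ht)
    field_simp
    simp
  have := (convex_Icc (0 : ℝ) 1).norm_image_sub_le_of_norm_hasDerivWithin_le (C := 0) hd
    (fun x _ => by simp) (left_mem_Icc.2 zero_le_one) (right_mem_Icc.2 zero_le_one)
  rw [zero_mul, norm_le_zero_iff] at this
  push_cast at this
  linear_combination this

/-- The counterpart of `prim_eq` near `1`, where `T` plays the role of `exp (-q F)`: here `T(X)
e^{qtd}` is constant under the character. The path may leave the unit disc and may pass through `1`.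
-/
theorem chart_eq (h : IsFlow hγ Q d X) (hQ : IsPGF Q q) {F T θ : ℂ → ℂ} {ρ σ : ℝ}
    (hT : IsLogChart Q q F T θ ρ σ) {s : ℂ} (hs : 0 ≤ s.re)
    (hlt : ∀ t ∈ Icc (0 : ℝ) 1, ‖Coarsening.chi hγ hs (X t) - 1‖ < ρ) :
    T (Coarsening.chi hγ hs (X 1)) =
      T (Coarsening.chi hγ hs (X 0)) * Complex.exp (-(q * Coarsening.chi hγ hs d)) := by
  set c := Coarsening.chi hγ hs d with hc
  have hTd : ∀ t ∈ Icc (0 : ℝ) 1, HasDerivWithinAt (fun t => T (Coarsening.chi hγ hs (X t)))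
      (-(q * c * T (Coarsening.chi hγ hs (X t)))) (Icc 0 1) t := by
    intro t ht
    have h1 := h.chi hQ.coeff_zero hs t ht
    -- At the point `1` the formula for `T'` degenerates, but both sides vanish because `Q(1) = 1`
    -- and `T 1 = 0`.
    rcases eq_or_ne (Coarsening.chi hγ hs (X t)) 1 with h2 | h2
    · have h3 : HasDerivAt T (deriv T 1) (Coarsening.chi hγ hs (X t)) := by
        rw [h2]; exact hT.differentiableAt.hasDerivAt
      refine (h3.comp_hasDerivWithinAt t h1).congr_deriv ?_
      rw [h2, hT.map_one, hQ.one_sub_aeval]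
      simp
    · obtain ⟨h3, h4⟩ := hT.hasDerivAt _ (hlt t ht) h2
      refine (h4.comp_hasDerivWithinAt t h1).congr_deriv ?_
      rw [hc]
      field_simp
  have hd : ∀ t ∈ Icc (0 : ℝ) 1, HasDerivWithinAt
      (fun t : ℝ => T (Coarsening.chi hγ hs (X t)) * Complex.exp (t * (q * c))) 0
      (Icc 0 1) t := by
    intro t ht
    have h2 : HasDerivWithinAt (fun t : ℝ => (t : ℂ) * (q * c)) (1 * (q * c)) (Icc 0 1) t :=
      ((Complex.ofRealCLM.hasDerivAt (x := t)).mul_const _).hasDerivWithinAt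
    refine ((hTd t ht).mul h2.cexp).congr_deriv ?_
    ring
  have := (convex_Icc (0 : ℝ) 1).norm_image_sub_le_of_norm_hasDerivWithin_le (C := 0) hd
    (fun x _ => by simp) (left_mem_Icc.2 zero_le_one) (right_mem_Icc.2 zero_le_one)
  rw [zero_mul, norm_le_zero_iff, sub_eq_zero] at this
  simp only [Complex.ofReal_one, one_mul, Complex.ofReal_zero, zero_mul, Complex.exp_zero,
    mul_one] at this
  rw [← this, mul_assoc, ← Complex.exp_add]
  simp

end IsFlow

/-- The function `e^{-by} w*(y) / q`. -/
noncomputable def wDamp (q b : ℝ) (y : ℝ) : ℝ := Real.exp (-b * y) * (1 / q * wStar y)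

theorem measurable_wStar : Measurable wStar :=
  Measurable.ite measurableSet_Ici (by fun_prop) measurable_const

theorem wDamp_sq_le {q b y : ℝ} (hq : 1 ≤ q) (hb : 1 ≤ b) (hy : 1 ≤ y) :
    (y ^ (1 : ℝ) * |wDamp q b y|) ^ 2 ≤ Real.exp (-b) * Real.exp (-1 * y) := by
  have hy0 : 0 < y := by linarith
  have hq0 : 0 < q := by linarith
  have e : y ^ (1 : ℝ) * |wDamp q b y| = Real.exp (-b * y) * (1 / q) := by
    rw [wDamp, wStar, if_pos hy, abs_of_nonneg (by positivity), Real.rpow_one]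
    field_simp
  rw [e, mul_pow, ← Real.exp_nat_mul, ← Real.exp_add]
  calc _ ≤ Real.exp (-b + -1 * y) * 1 := by
        gcongr
        -- For `b, y ≥ 1` one has `2by ≥ b + y`.
        · push_cast; nlinarith
        · refine pow_le_one₀ (by positivity) ?_
          rw [div_le_one hq0]; exact hq
    _ = _ := mul_one _

theorem memL2_wDamp {q b : ℝ} (hq : 1 ≤ q) (hb : 1 ≤ b) : MemL2 1 (wDamp q b) := by
  have hm : Measurable fun y : ℝ => y ^ (1 : ℝ) * wDamp q b y := by
    have := measurable_wStar
    unfold wDamp; fun_prop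
  refine (memLp_two_iff_integrable_sq hm.aestronglyMeasurable).2 ?_
  have h1 : IntegrableOn (fun y : ℝ => Real.exp (-b) * Real.exp (-1 * y)) (Ici 1) :=
    Integrable.const_mul
      ((integrableOn_Ici_iff_integrableOn_Ioi).2 (exp_neg_integrableOn_Ioi 1 one_pos)) _
  refine h1.mono' (hm.pow_const 2).aestronglyMeasurable
    ((ae_restrict_iff' measurableSet_Ici).2 (Eventually.of_forall fun y (hy : 1 ≤ y) => ?_))
  have := wDamp_sq_le hq hb hy
  rw [Real.norm_of_nonneg (sq_nonneg _)]
  rwa [mul_pow, sq_abs, ← mul_pow] at this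

theorem normL2_wDamp_le {q b : ℝ} (hq : 1 ≤ q) (hb : 1 ≤ b) :
    normL2 1 (wDamp q b) ≤ Real.exp (-b / 2) := by
  have h1 : IntegrableOn (fun y : ℝ => Real.exp (-b) * Real.exp (-1 * y)) (Ici 1) :=
    Integrable.const_mul
      ((integrableOn_Ici_iff_integrableOn_Ioi).2 (exp_neg_integrableOn_Ioi 1 one_pos)) _
  have h2 : ∫ y in Ici (1 : ℝ), (y ^ (1 : ℝ) * |wDamp q b y|) ^ 2 ≤
      ∫ y in Ici (1 : ℝ), Real.exp (-b) * Real.exp (-1 * y) := by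
    refine integral_mono_of_nonneg (Eventually.of_forall fun y => sq_nonneg _) h1
      ((ae_restrict_iff' measurableSet_Ici).2 (Eventually.of_forall fun y (hy : 1 ≤ y) => ?_))
    exact wDamp_sq_le hq hb hy
  have h3 : ∫ y in Ici (1 : ℝ), Real.exp (-b) * Real.exp (-1 * y) ≤ Real.exp (-b) := by
    rw [integral_const_mul, integral_Ici_eq_integral_Ioi]
    have : ∫ y in Ioi (1 : ℝ), Real.exp (-1 * y) = Real.exp (-1) := by
      simpa using integral_exp_neg_Ioi 1
    rw [this]
    exact mul_le_of_le_one_right (Real.exp_pos _).le (by simp)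
  rw [normL2, Real.sqrt_le_left (Real.exp_pos _).le, ← Real.exp_nat_mul]
  refine h2.trans (h3.trans (le_of_eq ?_))
  congr 1; push_cast; ring

/-- Far to the right in the complex plane, `E₁ / q` lifts through `F` to a Laplace transform. -/
theorem exists_lap_lift {Q : Polynomial ℝ} {q : ℝ} (h : IsPGF Q q) {F : ℂ → ℂ}
    (hF : IsPrim Q F) : ∃ b : ℝ, 0 < b ∧ ∃ η : ℝ → ℝ, LapInt b η ∧ (∀ y < 1, η y = 0) ∧
      ∀ s : ℂ, b ≤ s.re → ‖lap η s‖ < 1 ∧ F (lap η s) = 1 / q * E1 s := by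
  -- The weight exponent `1` is only auxiliary: the damped function decays exponentially.
  have hγ : (1 : ℝ) / 2 < 1 := by norm_num
  obtain ⟨ε, hε, C, hC, hflow⟩ := exists_flow hγ Q 0
  have hcL := cL_nonneg 1
  -- The second bound keeps every character of the flow within `1/2` of the origin, so `F` is
  -- defined along it.
  let ε' := min ε (1 / (2 * C * (cL 1 + 1)))
  have hε' : 0 < ε' := by positivity
  have hlim : Tendsto (fun b : ℝ => Real.exp (-b / 2)) atTop (𝓝 0) := by
    refine Real.tendsto_exp_atBot.comp ?_
    have := (tendsto_neg_atTop_atBot (G := ℝ)).atBot_div_const (show (0 : ℝ) < 2 by norm_num)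
    exact this
  obtain ⟨b, hb1, hb⟩ := ((eventually_ge_atTop (1 : ℝ)).and
    (hlim.eventually (ge_mem_nhds hε'))).exists
  have hq1 := h.one_le_mean
  let d : E := toE (memL2_wDamp hq1 hb1)
  have hd : ‖d‖ ≤ ε' := by
    rw [norm_toE]; exact (normL2_wDamp_le hq1 hb1).trans hb
  obtain ⟨X, hX0, hX, hXn⟩ := hflow d (hd.trans (min_le_left _ _))
  have hsmall : ∀ s : ℂ, ∀ hs : 0 ≤ s.re, ∀ t ∈ Icc (0 : ℝ) 1, ‖chi hγ hs (X t)‖ < 1 := by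
    intro s hs t ht
    have h1 := hXn t ht
    rw [sub_zero] at h1
    have h2 : ‖d‖ ≤ 1 / (2 * C * (cL 1 + 1)) := hd.trans (min_le_right _ _)
    calc ‖chi hγ hs (X t)‖ ≤ cL 1 * ‖X t‖ := norm_chi_le hγ hs _
      _ ≤ (cL 1 + 1) * (C * (1 / (2 * C * (cL 1 + 1)))) := by
        refine mul_le_mul (by linarith) (h1.trans ?_) (norm_nonneg _) (by linarith)
        gcongr
      _ = 1 / 2 := by field_simp
      _ < 1 := by norm_num
  have hFX : ∀ s : ℂ, ∀ hs : 0 ≤ s.re, F (chi hγ hs (X 1)) = chi hγ hs d := by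
    intro s hs
    rw [IsFlow.prim_eq hX h hF hs (hsmall s hs), hX0, map_zero, hF.zero, zero_add]
  -- The damping is undone by a translation of the transform variable.
  have hlap : ∀ (f : ℝ → ℝ) (s : ℂ),
      lap (fun y => Real.exp (b * y) * f y) s = lap f (s - b) := by
    intro f s
    unfold lap
    congr 1; ext y
    push_cast
    rw [← mul_assoc, ← Complex.exp_add]
    ring_nf
  refine ⟨b, by linarith, fun y => Real.exp (b * y) * fn 1 (X 1) y, ⟨fun y hy => ?_, ?_⟩,
    fun y hy => ?_, fun s hs => ?_⟩
  · rw [(lapInt_fn hγ (X 1)).zero y hy, mul_zero]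
  · refine (integrable_fn hγ (X 1)).congr (Eventually.of_forall fun y => ?_)
    simp [← mul_assoc, ← Real.exp_add]
  · simp [fn, if_neg (not_le.2 hy)]
  · have hs' : 0 ≤ (s - b).re := by simpa using hs
    rw [hlap]
    refine ⟨hsmall _ hs' 1 (right_mem_Icc.2 zero_le_one), ?_⟩
    rw [← chi_apply hγ hs', hFX _ hs', chi_toE, E1_eq_lap (by linarith)]
    have := lap_const_mul wStar (1 / q) s
    push_cast at this
    rw [← this]
    unfold lap
    congr 1; ext y
    dsimp only
    split_ifs with hy
    · rw [wDamp]
      push_cast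
      rw [← mul_assoc, ← Complex.exp_add]
      ring_nf
    · simp [wStar, hy]

end Coarsening

/-! ### The delay equation for the profile and the integral equation for its tail. -/

namespace Coarsening

/-- The distribution functions of the convolution powers of `η`. -/
noncomputable def Ap (η : ℝ → ℝ) : ℕ → ℝ → ℝ
  | 0 => st 0
  | j + 1 => cv η (Ap η j)

/-- The tail function of `Q(η)`. -/
noncomputable def tl (Q : Polynomial ℝ) (η : ℝ → ℝ) (y : ℝ) : ℝ :=
  st 0 y - ∑ j ∈ Finset.range (Q.natDegree + 1), Q.coeff j * Ap η j y

/-- The kernel of the integral equation for the tail function of `η`. -/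
noncomputable def kap (Q : Polynomial ℝ) (q : ℝ) (η : ℝ → ℝ) (y : ℝ) : ℝ :=
  st 0 y - 1 / q * ∑ j ∈ Finset.range (Q.natDegree + 1),
    Q.coeff j * ∑ i ∈ Finset.range j, Ap η i (y - 1)

/-- The tail function of `η`. -/
noncomputable def gt (η : ℝ → ℝ) (y : ℝ) : ℝ := st 0 y - Ap η 1 y

theorem cv_congr {f f' : ℝ → ℝ} (h : f =ᵐ[volume] f') (g : ℝ → ℝ) : cv f g = cv f' g := by
  ext x
  refine integral_congr_ae ?_
  filter_upwards [h] with t ht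
  rw [ht]

/-- Equality holds at every point, not just almost everywhere; this allows `η` to be changed on a
null set without affecting its tail functions. -/
theorem Ap_congr {η η' : ℝ → ℝ} (h : η =ᵐ[volume] η') (j : ℕ) : Ap η j = Ap η' j := by
  induction j with
  | zero => rfl
  | succ j ih => rw [Ap, Ap, ih, cv_congr h]

theorem lapInt_Ap {c : ℝ} {η : ℝ → ℝ} (hc : 0 < c) (hη : LapInt c η) (j : ℕ) :
    LapInt c (Ap η j) := by
  induction j with
  | zero => exact lapInt_st le_rfl hc
  | succ j ih => exact hη.cv ih

theorem lap_Ap {c : ℝ} {η : ℝ → ℝ} (hc : 0 < c) (hη : LapInt c η) (j : ℕ) {s : ℂ}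
    (hs : c ≤ s.re) : lap (Ap η j) s = lap η s ^ j / s := by
  induction j with
  | zero => simp [Ap, lap_st 0 (hc.trans_le hs)]
  | succ j ih => rw [Ap, lap_cv hη (lapInt_Ap hc hη j) hs, ih]; ring

theorem LapInt.shift {c : ℝ} {f : ℝ → ℝ} (hf : LapInt c f) : LapInt c (fun y => f (y - 1)) := by
  refine ⟨fun y hy => hf.zero _ (by linarith), ?_⟩
  refine ((hf.int.comp_sub_right 1).const_mul (Real.exp (-c))).congr
    (Eventually.of_forall fun y => ?_)
  dsimp only
  rw [← mul_assoc, ← Real.exp_add]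
  ring_nf

theorem lap_shift (f : ℝ → ℝ) (s : ℂ) :
    lap (fun y => f (y - 1)) s = Complex.exp (-s) * lap f s := by
  rw [lap, lap, ← integral_const_mul,
    ← integral_sub_right_eq_self (fun y : ℝ => Complex.exp (-s) * (Complex.exp (-s * y) * f y)) 1]
  congr 1; ext y
  rw [← mul_assoc, ← Complex.exp_add]
  push_cast
  ring_nf

theorem lapInt_tl {c : ℝ} {η : ℝ → ℝ} (hc : 0 < c) (hη : LapInt c η) (Q : Polynomial ℝ) :
    LapInt c (tl Q η) :=
  (lapInt_st le_rfl hc).sub (LapInt.sum _ fun j _ => (lapInt_Ap hc hη j).const_mul _)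

theorem lap_tl {c : ℝ} {η : ℝ → ℝ} (hc : 0 < c) (hη : LapInt c η) (Q : Polynomial ℝ) {s : ℂ}
    (hs : c ≤ s.re) : lap (tl Q η) s = (1 - Polynomial.aeval (lap η s) Q) / s := by
  unfold tl
  rw [lap_sub (lapInt_st le_rfl hc)
    (LapInt.sum _ fun j _ => (lapInt_Ap hc hη j).const_mul _) hs,
    lap_sum _ (fun j _ => (lapInt_Ap hc hη j).const_mul _) hs, lap_st 0 (hc.trans_le hs),
    aeval_eq_sum, sub_div, Finset.sum_div]
  congr 1
  · simp
  · refine Finset.sum_congr rfl fun j _ => ?_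
    rw [lap_const_mul, lap_Ap hc hη j hs]; ring

theorem lapInt_kap {c : ℝ} {η : ℝ → ℝ} (hc : 0 < c) (hη : LapInt c η) (Q : Polynomial ℝ)
    (q : ℝ) : LapInt c (kap Q q η) :=
  (lapInt_st le_rfl hc).sub ((LapInt.sum _ fun _ _ => (LapInt.sum _ fun i _ =>
    (lapInt_Ap hc hη i).shift).const_mul _).const_mul _)

theorem lap_kap {c : ℝ} {η : ℝ → ℝ} (hc : 0 < c) (hη : LapInt c η) (Q : Polynomial ℝ)
    (q : ℝ) {s : ℂ} (hs : c ≤ s.re) :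
    lap (kap Q q η) s = 1 / s - 1 / q * (Complex.exp (-s) / s) * Rc Q (lap η s) := by
  have h1 : ∀ j : ℕ, LapInt c fun y => ∑ i ∈ Finset.range j, Ap η i (y - 1) := fun j =>
    LapInt.sum _ fun i _ => (lapInt_Ap hc hη i).shift
  have h2 : ∀ j : ℕ, LapInt c fun y => Q.coeff j * ∑ i ∈ Finset.range j, Ap η i (y - 1) :=
    fun j => (h1 j).const_mul _
  unfold kap
  rw [lap_sub (lapInt_st le_rfl hc) ((LapInt.sum _ fun j _ => h2 j).const_mul _) hs,
    lap_const_mul, lap_sum _ (fun j _ => h2 j) hs, lap_st 0 (hc.trans_le hs), Rc, Finset.mul_sum,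
    Finset.mul_sum]
  congr 1
  · simp
  · refine Finset.sum_congr rfl fun j _ => ?_
    rw [lap_const_mul, lap_sum _ (fun i _ => (lapInt_Ap hc hη i).shift) hs]
    simp only [lap_shift, lap_Ap hc hη _ hs]
    push_cast
    rw [← Finset.mul_sum, ← Finset.sum_div]
    ring

theorem lapInt_gt {c : ℝ} {η : ℝ → ℝ} (hc : 0 < c) (hη : LapInt c η) : LapInt c (gt η) :=
  (lapInt_st le_rfl hc).sub (lapInt_Ap hc hη 1)

theorem lap_gt {c : ℝ} {η : ℝ → ℝ} (hc : 0 < c) (hη : LapInt c η) {s : ℂ}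
    (hs : c ≤ s.re) : lap (gt η) s = (1 - lap η s) / s := by
  unfold gt
  rw [lap_sub (lapInt_st le_rfl hc) (lapInt_Ap hc hη 1) hs, lap_Ap hc hη 1 hs,
    lap_st 0 (hc.trans_le hs)]
  simp [sub_div]

/-- `η` solves the delay equation `q y η(y) = P(S > y - 1)`, where `S` has density `Q(η)`. -/
structure IsProfile (Q : Polynomial ℝ) (q : ℝ) (η : ℝ → ℝ) : Prop where
  zero : ∀ y < 1, η y = 0
  eq : ∀ y, q * (y * η y) = tl Q η (y - 1)

theorem IsProfile.lap_id_mul {Q : Polynomial ℝ} {q : ℝ} {η : ℝ → ℝ} (hη : IsProfile Q q η)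
    (hQ : IsPGF Q q) {c : ℝ} (hc : 0 < c) (hl : LapInt c η) {s : ℂ} (hs : c ≤ s.re) :
    lap (fun y => y * η y) s =
      1 / q * (Complex.exp (-s) / s) * (1 - Polynomial.aeval (lap η s) Q) := by
  have hq : q ≠ 0 := by linarith [hQ.one_le_mean]
  have e : (fun y => y * η y) = fun y => (1 / q) * (fun y => tl Q η (y - 1)) y := by
    ext y; dsimp only; rw [← hη.eq y]; field_simp
  rw [e, lap_const_mul, lap_shift, lap_tl hc hl Q hs]
  push_cast; ring

/-- The integral equation `y g(y) = (g * κ)(y)` for the tail function `g` of `η`. -/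
theorem IsProfile.id_mul_gt {Q : Polynomial ℝ} {q : ℝ} {η : ℝ → ℝ} (hη : IsProfile Q q η)
    (hQ : IsPGF Q q) {c : ℝ} (hc : 0 < c) (hl : LapInt c η) :
    (fun y => y * gt η y) =ᵐ[volume] cv (gt η) (kap Q q η) := by
  have hc1 : c < c + 1 := by linarith
  have hc0 : 0 < c + 1 := by linarith
  have hg := lapInt_gt hc hl
  have hk := lapInt_kap hc hl Q q
  refine lap_inj (hg.id_mul hc1) ((hg.cv hk).mono hc1.le) fun s hs => ?_
  have hs' : c < s.re := by linarith
  have hs0 : s ≠ 0 := by rintro rfl; simp at hs; linarith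
  rw [lap_cv hg hk hs'.le, lap_gt hc hl hs'.le, lap_kap hc hl Q q hs'.le]
  have h1 := hg.hasDerivAt_lap hs'
  have h2 : HasDerivAt (fun s => (1 - lap η s) / s) _ s :=
    ((hl.hasDerivAt_lap hs').const_sub 1).div (hasDerivAt_id s) hs0
  have h3 : lap (gt η) =ᶠ[𝓝 s] fun s => (1 - lap η s) / s := by
    filter_upwards [(isOpen_lt continuous_const Complex.continuous_re).mem_nhds hs'] with z hz
    exact lap_gt hc hl (le_of_lt hz)
  have h4 := h1.unique (h2.congr_of_eventuallyEq h3)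
  rw [hη.lap_id_mul hQ hc hl hs'.le, hQ.one_sub_aeval] at h4
  rw [← neg_inj, h4]
  field_simp
  ring

/-- Differentiating `F(lap η) = E1 / q` gives `lap (y η) = e^{-s} (1 - Q(lap η)) / (q s)`, whose
inverse transform is the delay equation, almost everywhere. The solution is then redefined pointwise
by the right-hand side of that equation, so that it holds for every `y`. -/
theorem exists_profile {Q : Polynomial ℝ} {q : ℝ} (hQ : IsPGF Q q) {F : ℂ → ℂ}
    (hF : IsPrim Q F) : ∃ b : ℝ, 0 < b ∧ ∃ η : ℝ → ℝ, IsProfile Q q η ∧ LapInt b η ∧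
      ∀ s : ℂ, b ≤ s.re → F (lap η s) = 1 / q * E1 s := by
  obtain ⟨b, hb, η₀, hl, hz, hs⟩ := exists_lap_lift hQ hF
  have hq : q ≠ 0 := by linarith [hQ.one_le_mean]
  have hqc : (q : ℂ) ≠ 0 := by exact_mod_cast hq
  let η : ℝ → ℝ := fun y => 1 / q * (1 / y * tl Q η₀ (y - 1))
  have hb1 : b < b + 1 := by linarith
  have hb0 : 0 < b + 1 := by linarith
  have htl : ∀ y < 1, tl Q η₀ (y - 1) = 0 := fun y hy =>
    (lapInt_tl hb hl Q).zero _ (by linarith)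
  have hae : (fun y => y * η₀ y) =ᵐ[volume] fun y => 1 / q * tl Q η₀ (y - 1) := by
    refine lap_inj (hl.id_mul hb1)
      (((lapInt_tl hb hl Q).shift.const_mul (1 / q)).mono hb1.le) fun s hs1 => ?_
    have hs' : b < s.re := by linarith
    rw [lap_const_mul, lap_shift, lap_tl hb hl Q hs'.le]
    have h1 := (hF.hasDerivAt _ (hs s hs'.le).1).comp s (hl.hasDerivAt_lap hs')
    have h2 := (hasDerivAt_E1 (hb.trans hs')).const_mul (1 / (q : ℂ))
    have h3 : F ∘ lap η₀ =ᶠ[𝓝 s] fun s => 1 / q * E1 s := by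
      filter_upwards [(isOpen_lt continuous_const Complex.continuous_re).mem_nhds hs'] with z hz
      exact (hs z (le_of_lt hz)).2
    have h4 := h1.unique (h2.congr_of_eventuallyEq h3)
    have h5 := hQ.one_sub_ne_zero (hs s hs'.le).1
    field_simp at h4
    push_cast
    field_simp
    linear_combination -h4
  have hηη : η₀ =ᵐ[volume] η := by
    filter_upwards [hae] with y hy
    rcases lt_or_ge y 1 with h1 | h1
    · simp only [η, hz y h1, htl y h1, mul_zero]
    · have hy0 : y ≠ 0 := by linarith
      simp only [η]
      rw [show tl Q η₀ (y - 1) = q * (y * η₀ y) by rw [hy]; field_simp]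
      field_simp
  have htl' : tl Q η₀ = tl Q η := by
    unfold tl; simp only [Ap_congr hηη]
  refine ⟨b, hb, η, ⟨fun y hy => by simp only [η, htl y hy, mul_zero], fun y => ?_⟩, ⟨?_, ?_⟩,
    fun s hs1 => ?_⟩
  · rw [← htl']
    rcases lt_or_ge y 1 with h1 | h1
    · simp only [η, htl y h1, mul_zero]
    · have hy0 : y ≠ 0 := by linarith
      simp only [η]
      field_simp
  · exact fun y hy => by simp only [η, htl y (by linarith), mul_zero]
  · refine hl.int.congr ?_
    filter_upwards [hηη] with y hy
    rw [hy]
  · rw [← lap_congr hηη, (hs s hs1).2]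

end Coarsening

/-! ### The profile is non-negative with mass at most one. -/

namespace Coarsening

variable {Q : Polynomial ℝ} {q : ℝ} {η : ℝ → ℝ} {c : ℝ}

theorem LapInt.integrable_mul_st (hl : LapInt c η) (z : ℝ) :
    Integrable fun t => η t * st 0 (z - t) := by
  have h1 : AEStronglyMeasurable (fun t => η t * st 0 (z - t)) volume :=
    hl.aesm.mul ((measurable_st 0).comp
      (measurable_const.sub measurable_id)).aestronglyMeasurable
  refine (hl.absInt.const_mul (Real.exp (|c| * |z|))).mono' h1 (Eventually.of_forall fun t => ?_)
  rw [norm_mul, Real.norm_eq_abs, Real.norm_of_nonneg (st_nonneg _ _), ← mul_assoc,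
    ← Real.exp_add, mul_comm]
  rcases lt_or_ge t 0 with ht | ht
  · simp [hl.zero t ht]
  · gcongr
    unfold st
    split_ifs with h
    · rw [Real.one_le_exp_iff]
      have h1 : c * t ≤ |c| * t := by gcongr; exact le_abs_self c
      have h2 : |c| * t ≤ |c| * |z| := by
        gcongr
        linarith [le_abs_self z]
      linarith
    · positivity

/-- Near the left, the convolution powers of a non-negative `η` of mass at most one have
distribution functions with values in `[0, 1]`. -/
theorem Ap_mem {z₀ : ℝ} (hc : 0 < c) (hl : LapInt c η) (hη : ∀ y ≤ z₀, 0 ≤ η y)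
    (hg : ∀ y ≤ z₀, Ap η 1 y ≤ 1) (j : ℕ) : ∀ z ≤ z₀, 0 ≤ Ap η j z ∧ Ap η j z ≤ 1 := by
  induction j with
  | zero => exact fun z _ => ⟨st_nonneg 0 z, st_le_one 0 z⟩
  | succ j ih =>
    intro z hz
    have hpt : ∀ t, 0 ≤ η t * Ap η j (z - t) ∧ η t * Ap η j (z - t) ≤ η t * st 0 (z - t) := by
      intro t
      rcases lt_or_ge t 0 with ht | ht
      · simp [hl.zero t ht]
      rcases lt_or_ge (z - t) 0 with hzt | hzt
      · simp [(lapInt_Ap hc hl j).zero _ hzt, st, not_le.2 hzt]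
      · have h1 := ih (z - t) (by linarith)
        have h2 := hη t (by linarith)
        refine ⟨mul_nonneg h2 h1.1, ?_⟩
        rw [st, if_pos hzt]
        exact mul_le_mul_of_nonneg_left h1.2 h2
    refine ⟨integral_nonneg fun t => (hpt t).1, le_trans ?_ (hg z hz)⟩
    exact integral_mono_of_nonneg (Eventually.of_forall fun t => (hpt t).1)
      (hl.integrable_mul_st z) (Eventually.of_forall fun t => (hpt t).2)

theorem sum_coeff_mul_le (hQ : IsPGF Q q) {a : ℕ → ℝ} (ha : ∀ j, a j ≤ 1) :
    ∑ j ∈ Finset.range (Q.natDegree + 1), Q.coeff j * a j ≤ 1 := by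
  rw [← hQ.sum_coeff]
  refine Finset.sum_le_sum fun j _ => ?_
  nlinarith [hQ.nonneg j, ha j]

theorem tl_nonneg (hQ : IsPGF Q q) {y : ℝ} (hA : ∀ j, Ap η j y ≤ 1) (hy : 0 ≤ y) :
    0 ≤ tl Q η y := by
  rw [tl, st, if_pos hy, sub_nonneg]
  exact sum_coeff_mul_le hQ hA

theorem kap_eq_one (hc : 0 < c) (hl : LapInt c η) {y : ℝ} (hy0 : 0 ≤ y) (hy : y < 1) :
    kap Q q η y = 1 := by
  rw [kap, st, if_pos hy0]
  simp [(lapInt_Ap hc hl _).zero (y - 1) (by linarith)]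

/-- The double sum has `j` terms of weight `p_j`, each at most one, hence total at most `∑ j p_j =
q`. -/
theorem kap_nonneg (hQ : IsPGF Q q) {y : ℝ} (hA : ∀ j, Ap η j (y - 1) ≤ 1) (hy : 0 ≤ y) :
    0 ≤ kap Q q η y := by
  have hq : 0 < q := by linarith [hQ.one_le_mean]
  rw [kap, st, if_pos hy, sub_nonneg, one_div, inv_mul_le_iff₀ hq, mul_one, ← hQ.sum_mul_coeff]
  refine Finset.sum_le_sum fun j _ => mul_le_mul_of_nonneg_left ?_ (hQ.nonneg j)
  calc _ ≤ ∑ i ∈ Finset.range j, (1 : ℝ) := Finset.sum_le_sum fun i _ => hA i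
    _ = j := by simp

theorem Ap_one_eq (y : ℝ) : Ap η 1 y = ∫ t in Iic y, η t := by
  rw [← integral_indicator measurableSet_Iic]
  simp only [Ap, cv]
  congr 1; ext t
  by_cases h : t ≤ y <;> simp [st, indicator, h]

theorem integrableOn_Iic (hl : LapInt c η) (y : ℝ) : IntegrableOn η (Iic y) := by
  rw [← integrable_indicator_iff measurableSet_Iic]
  refine (hl.integrable_mul_st y).congr (Eventually.of_forall fun t => ?_)
  by_cases h : t ≤ y <;> simp [st, indicator, h]

theorem continuous_Ap_one (hl : LapInt c η) : Continuous (Ap η 1) := by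
  have hi : ∀ a b : ℝ, IntervalIntegrable η volume a b := fun a b =>
    ((integrableOn_Iic hl (max a b)).mono_set fun x hx => by
      simp only [uIcc, mem_Icc] at hx; exact hx.2).intervalIntegrable
  have e : Ap η 1 = fun y => (∫ t in Iic (0 : ℝ), η t) + ∫ t in (0 : ℝ)..y, η t := by
    ext y
    rw [Ap_one_eq, ← intervalIntegral.integral_Iic_sub_Iic (integrableOn_Iic hl 0)
      (integrableOn_Iic hl y)]
    ring
  rw [e]
  exact continuous_const.add (intervalIntegral.continuous_primitive hi 0)

theorem gt_of_nonneg {y : ℝ} (hy : 0 ≤ y) : gt η y = 1 - Ap η 1 y := by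
  rw [gt, st, if_pos hy]

/-- The induction step in the proof that the profile is non-negative with mass at most one. -/
theorem IsProfile.step (hη : IsProfile Q q η) (hQ : IsPGF Q q) (hc : 0 < c) (hl : LapInt c η)
    {n : ℝ} (hn : 1 ≤ n) (h1 : ∀ y ≤ n, 0 ≤ η y) (h2 : ∀ y ≤ n, Ap η 1 y < 1) :
    (∀ y ≤ n + 1, 0 ≤ η y) ∧ ∀ y ≤ n + 1, Ap η 1 y < 1 := by
  have hq : 0 < q := by linarith [hQ.one_le_mean]
  have hA : ∀ j, ∀ z ≤ n, 0 ≤ Ap η j z ∧ Ap η j z ≤ 1 := fun j =>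
    Ap_mem hc hl h1 (fun y hy => (h2 y hy).le) j
  have hpos : ∀ y ≤ n + 1, 0 ≤ η y := by
    intro y hy
    rcases lt_or_ge y 1 with hy1 | hy1
    · rw [hη.zero y hy1]
    · have := tl_nonneg hQ (y := y - 1) (fun j => (hA j (y - 1) (by linarith)).2) (by linarith)
      rw [← hη.eq y] at this
      exact nonneg_of_mul_nonneg_right (nonneg_of_mul_nonneg_right this hq) (by linarith)
  refine ⟨hpos, ?_⟩
  by_contra! hcon
  obtain ⟨y₁, hy₁, hy₁'⟩ := hcon
  have hAc := continuous_Ap_one hl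
  have hcpt : IsCompact (Icc n (n + 1) ∩ Ap η 1 ⁻¹' Ici 1) :=
    isCompact_Icc.inter_right (isClosed_Ici.preimage hAc)
  -- Let `y₀` be the first point where the tail `g` fails to be positive. Just to its left, `y g(y)
  -- = (g * κ)(y)` is bounded below by the integral `m > 0` of `g` over `[y₀ - 1, y₀ - 1/2]`,
  -- because `κ = 1` on `[0, 1)` and the integrand is non-negative elsewhere. This contradicts the
  -- continuity of `g` at `y₀`.
  obtain ⟨y₀, ⟨hy₀, hy₀'⟩, hleast⟩ := hcpt.exists_isLeast
    ⟨y₁, ⟨le_of_lt (not_le.1 fun h => by linarith [h2 y₁ h]), hy₁⟩, hy₁'⟩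
  simp only [mem_preimage, mem_Ici] at hy₀'
  have hlt : ∀ y < y₀, Ap η 1 y < 1 := by
    intro y hy
    by_contra! h
    have hny : n ≤ y := le_of_lt (not_le.1 fun h' => by linarith [h2 y h'])
    exact absurd (hleast ⟨⟨hny, by linarith [hy₀.2]⟩, h⟩) (not_le.2 hy)
  have hy₀1 : 1 ≤ y₀ := hn.trans hy₀.1
  have hgnn : ∀ t < y₀, 0 ≤ gt η t := by
    intro t ht
    rcases lt_or_ge t 0 with h | h
    · rw [(lapInt_gt hc hl).zero t h]
    · rw [gt_of_nonneg h]; linarith [hlt t ht]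
  set m := ∫ t in (y₀ - 1)..(y₀ - 1 / 2), (1 - Ap η 1 t) with hm
  have hmpos : 0 < m := by
    refine intervalIntegral.intervalIntegral_pos_of_pos_on ?_ (fun t ht => ?_) (by linarith)
    · exact (continuous_const.sub hAc).intervalIntegrable _ _
    · linarith [hlt t (by linarith [ht.2])]
  have hae : ∀ᵐ y, y ∈ Ioo (y₀ - 1 / 2) y₀ → m ≤ y * (1 - Ap η 1 y) := by
    filter_upwards [hη.id_mul_gt hQ hc hl, (lapInt_gt hc hl).cv_integrable_ae
      (lapInt_kap hc hl Q q)] with y hy hint hyI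
    rw [gt_of_nonneg (by linarith [hyI.1])] at hy
    rw [hy, hm, intervalIntegral.integral_of_le (by linarith)]
    have hnn : ∀ t, 0 ≤ gt η t * kap Q q η (y - t) := by
      intro t
      rcases lt_or_ge t 0 with ht | ht
      · rw [(lapInt_gt hc hl).zero t ht, zero_mul]
      rcases lt_or_ge (y - t) 0 with ht' | ht'
      · rw [(lapInt_kap hc hl Q q).zero _ ht', mul_zero]
      · exact mul_nonneg (hgnn t (by linarith [hyI.2]))
          (kap_nonneg hQ (fun j => (hA j _ (by linarith [hyI.2, hy₀.2])).2) ht')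
    refine le_trans (le_of_eq ?_) (setIntegral_le_integral (s := Ioc (y₀ - 1) (y₀ - 1 / 2)) hint
      (Eventually.of_forall hnn))
    refine setIntegral_congr_fun measurableSet_Ioc fun t ht => ?_
    rw [kap_eq_one hc hl (by linarith [ht.2, hyI.1]) (by linarith [ht.1, hyI.2]), mul_one,
      gt_of_nonneg (by linarith [ht.1])]
  have hcont : ContinuousAt (fun y => y * (1 - Ap η 1 y)) y₀ := by fun_prop
  have hsmall : ∀ᶠ y in 𝓝 y₀, y * (1 - Ap η 1 y) < m := by
    refine hcont.eventually_lt continuousAt_const ?_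
    have : y₀ * (1 - Ap η 1 y₀) ≤ 0 := mul_nonpos_of_nonneg_of_nonpos (by linarith) (by linarith)
    linarith
  obtain ⟨δ, hδ, hball⟩ := Metric.eventually_nhds_iff.1 hsmall
  -- The integral equation holds only almost everywhere, so the contradiction is that a non-empty
  -- interval would be null.
  have hnull : volume (Ioo (y₀ - min δ (1 / 2)) y₀) = 0 := by
    refine measure_mono_null (fun y hy => ?_) (ae_iff.1 hae)
    rw [Set.mem_ofPred_eq, Classical.not_imp]
    have h3 := min_le_left δ (1 / 2)
    have h4 := min_le_right δ (1 / 2)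
    refine ⟨⟨by linarith [hy.1], hy.2⟩, not_le.2 (hball ?_)⟩
    rw [Real.dist_eq, abs_lt]
    constructor <;> linarith [hy.1, hy.2]
  rw [Real.volume_Ioo, ENNReal.ofReal_eq_zero] at hnull
  have : 0 < min δ (1 / 2) := by positivity
  linarith

theorem IsProfile.nonneg_and_lt (hη : IsProfile Q q η) (hQ : IsPGF Q q) (hc : 0 < c)
    (hl : LapInt c η) (n : ℕ) :
    (∀ y ≤ (n : ℝ) + 1, 0 ≤ η y) ∧ ∀ y ≤ (n : ℝ) + 1, Ap η 1 y < 1 := by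
  have hq : 0 < q := by linarith [hQ.one_le_mean]
  induction n with
  | zero =>
    have h0 : ∀ y ≤ (1 : ℝ), 0 ≤ η y := by
      intro y hy
      rcases hy.lt_or_eq with h | rfl
      · rw [hη.zero y h]
      · have := tl_nonneg (η := η) hQ (y := (1 : ℝ) - 1) (fun j => ?_) (by norm_num)
        · rw [← hη.eq 1] at this
          exact nonneg_of_mul_nonneg_right (nonneg_of_mul_nonneg_right this hq) one_pos
        · rcases j with _ | j
          · exact st_le_one _ _
          · refine le_of_eq_of_le (integral_eq_zero_of_ae (Eventually.of_forall fun t => ?_))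
              zero_le_one
            rcases lt_or_ge t 1 with ht | ht
            · simp [hη.zero t ht]
            · simp only [(lapInt_Ap hc hl j).zero (1 - 1 - t) (by linarith), mul_zero, Pi.zero_apply]
    refine ⟨by simpa using h0, fun y hy => ?_⟩
    have hy' : y ≤ 1 := by simpa using hy
    have : Ap η 1 y = 0 := by
      rw [Ap_one_eq, integral_Iic_eq_integral_Iio]
      exact setIntegral_eq_zero_of_forall_eq_zero fun t ht => hη.zero t (by
        simp only [mem_Iio] at ht; linarith)
    rw [this]; exact one_pos
  | succ n ih =>
    have := hη.step hQ hc hl (n := (n : ℝ) + 1) (by linarith [(n.cast_nonneg : (0 : ℝ) ≤ n)])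
      ih.1 ih.2
    push_cast
    exact this

theorem IsProfile.nonneg (hη : IsProfile Q q η) (hQ : IsPGF Q q) (hc : 0 < c)
    (hl : LapInt c η) (y : ℝ) : 0 ≤ η y := by
  obtain ⟨n, hn⟩ := exists_nat_ge y
  exact (hη.nonneg_and_lt hQ hc hl n).1 y (by linarith)

theorem IsProfile.Ap_one_lt (hη : IsProfile Q q η) (hQ : IsPGF Q q) (hc : 0 < c)
    (hl : LapInt c η) (y : ℝ) : Ap η 1 y < 1 := by
  obtain ⟨n, hn⟩ := exists_nat_ge y
  exact (hη.nonneg_and_lt hQ hc hl n).2 y (by linarith)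

/-- Non-negativity turns the bound on the distribution function into a uniform bound on the `L¹`
norms over `(-∞, y]`. -/
theorem IsProfile.integrable (hη : IsProfile Q q η) (hQ : IsPGF Q q) (hc : 0 < c)
    (hl : LapInt c η) : Integrable η := by
  refine (aecover_Iic tendsto_id).integrable_of_integral_norm_bounded 1
    (fun y => integrableOn_Iic hl y) (Eventually.of_forall fun y : ℝ => ?_)
  have h1 := (hη.Ap_one_lt hQ hc hl y).le
  rw [Ap_one_eq] at h1
  simpa only [Real.norm_of_nonneg (hη.nonneg hQ hc hl _), id] using h1

theorem IsProfile.integral_le (hη : IsProfile Q q η) (hQ : IsPGF Q q) (hc : 0 < c)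
    (hl : LapInt c η) : ∫ y, η y ≤ 1 := by
  have h1 := (aecover_Iic (μ := volume) (tendsto_id (α := ℝ))).integral_tendsto_of_countably_generated
    (hη.integrable hQ hc hl)
  refine le_of_tendsto h1 (Eventually.of_forall fun y => ?_)
  simpa only [Ap_one_eq, id] using (hη.Ap_one_lt hQ hc hl y).le

theorem IsProfile.lapInt_zero (hη : IsProfile Q q η) (hQ : IsPGF Q q) (hc : 0 < c)
    (hl : LapInt c η) : LapInt 0 η :=
  ⟨hl.zero, by simpa using hη.integrable hQ hc hl⟩

end Coarsening

/-! ### The transform of the profile on the closed half-plane: mass one and finite mean. -/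

namespace Coarsening

variable {Q : Polynomial ℝ} {q : ℝ} {η : ℝ → ℝ} {c : ℝ} {F : ℂ → ℂ}

namespace IsProfile

/-- On this range `y - 1 < 1`, where no convolution power of positive order has mass yet and the
tail equals one. Hence `η y = 1 / (q y)`. -/
theorem pos_of_mem (hη : IsProfile Q q η) (hQ : IsPGF Q q) (hc : 0 < c) (hl : LapInt c η) {y : ℝ}
    (hy : y ∈ Ioo (1 : ℝ) 2) : 0 < η y := by
  have hq : 0 < q := by linarith [hQ.one_le_mean]
  have h1 : tl Q η (y - 1) = 1 := by
    rw [tl, st, if_pos (by linarith [hy.1]), Finset.sum_eq_zero, sub_zero]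
    intro j _
    rcases j with _ | j
    · rw [hQ.coeff_zero, zero_mul]
    · have : Ap η (j + 1) (y - 1) = 0 := by
        refine integral_eq_zero_of_ae (Eventually.of_forall fun t => ?_)
        rcases lt_or_ge t 1 with ht | ht
        · simp [hη.zero t ht]
        · simp only [(lapInt_Ap hc hl j).zero (y - 1 - t) (by linarith [hy.2]), mul_zero,
            Pi.zero_apply]
      rw [this, mul_zero]
  have h2 : q * (y * η y) = 1 := (hη.eq y).trans h1
  have hy0 : 0 < y := by linarith [hy.1]
  have : η y = 1 / (q * y) := by field_simp; linarith
  rw [this]; positivity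

/-- Off the origin, the Laplace transform of the profile takes values in the open unit disc. -/
theorem norm_lap_lt (hη : IsProfile Q q η) (hQ : IsPGF Q q) (hc : 0 < c) (hl : LapInt c η) {s : ℂ}
    (hs : 0 ≤ s.re) (hs0 : s ≠ 0) : ‖lap η s‖ < 1 := by
  have hl0 := hη.lapInt_zero hQ hc hl
  have hnn := hη.nonneg hQ hc hl
  have hint := hη.integrable hQ hc hl
  by_contra! hge
  set w := lap η s with hw
  have hw0 : (‖w‖ : ℂ) ≠ 0 := by
    have : ‖w‖ ≠ 0 := by linarith
    exact_mod_cast this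
  -- A rotation making the transform real and positive. If its modulus were at least one, equality
  -- would hold in `Re (a e^{-sy} η) ≤ η` almost everywhere, so `a e^{-sy} = 1` on `(1, 2)`;
  -- differentiating there gives `s = 0`.
  set a : ℂ := (starRingEnd ℂ) w / ‖w‖ with ha
  have ha1 : ‖a‖ = 1 := by
    rw [ha, norm_div, Complex.norm_conj, Complex.norm_real, norm_norm]
    exact div_self (by linarith)
  have haw : a * w = ‖w‖ := by
    rw [ha, div_mul_eq_mul_div, ← Complex.normSq_eq_conj_mul_self, Complex.normSq_eq_norm_sq]
    push_cast
    field_simp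
  have hci := (hl0.cint hs).const_mul a
  have hre : ∫ y : ℝ, (a * (Complex.exp (-s * y) * η y)).re = ‖w‖ := by
    have h1 := integral_re hci
    simp only [RCLike.re_eq_complex_re] at h1
    rw [h1, integral_const_mul]
    have : ∫ y : ℝ, Complex.exp (-s * y) * η y = w := rfl
    rw [this, haw, Complex.ofReal_re]
  have hle : ∀ y : ℝ, (a * (Complex.exp (-s * y) * η y)).re ≤ η y := by
    intro y
    refine (Complex.re_le_norm _).trans ?_
    rw [norm_mul, ha1, one_mul, norm_cexp_mul, abs_of_nonneg (hnn y)]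
    rcases lt_or_ge y 0 with hy | hy
    · simp [hl.zero y hy]
    · refine mul_le_of_le_one_left (hnn y) ?_
      rw [Real.exp_le_one_iff]
      nlinarith
  have hcr : Integrable fun y : ℝ => (a * (Complex.exp (-s * y) * η y)).re := hci.re
  have hzero : ∫ y : ℝ, (η y - (a * (Complex.exp (-s * y) * η y)).re) = 0 := by
    refine le_antisymm ?_ (integral_nonneg fun y => sub_nonneg.2 (hle y))
    rw [integral_sub hint hcr, hre]
    linarith [hη.integral_le hQ hc hl]
  rw [integral_eq_zero_iff_of_nonneg (fun y => sub_nonneg.2 (hle y)) (hint.sub hcr)] at hzero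
  have hre1 : ∀ᵐ y : ℝ ∂(volume.restrict (Ioo (1 : ℝ) 2)), a * Complex.exp (-s * y) = 1 := by
    rw [ae_restrict_iff' measurableSet_Ioo]
    filter_upwards [hzero] with y hy hyI
    simp only [Pi.zero_apply] at hy
    have h1 : (a * (Complex.exp (-s * y) * η y)).re = (a * Complex.exp (-s * y)).re * η y := by
      rw [← mul_assoc, mul_comm _ (η y : ℂ), Complex.re_ofReal_mul, mul_comm]
    rw [h1] at hy
    have hpos := hη.pos_of_mem hQ hc hl hyI
    have h2 : (a * Complex.exp (-s * y)).re = 1 := by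
      have : (1 - (a * Complex.exp (-s * y)).re) * η y = 0 := by linarith
      rcases mul_eq_zero.1 this with h | h
      · linarith
      · exact absurd h hpos.ne'
    have h3 : ‖a * Complex.exp (-s * y)‖ ≤ 1 := by
      rw [norm_mul, ha1, one_mul, Complex.norm_exp, Real.exp_le_one_iff]
      simp
      nlinarith [hyI.1]
    have h4 := Complex.sq_norm_sub_sq_re (a * Complex.exp (-s * y))
    have h5 : (a * Complex.exp (-s * y)).im = 0 := by
      rw [h2] at h4
      have := norm_nonneg (a * Complex.exp (-s * y))
      nlinarith [sq_nonneg (a * Complex.exp (-s * y)).im]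
    exact Complex.ext (by simpa using h2) (by simpa using h5)
  have hEq := Measure.eqOn_open_of_ae_eq (f := fun y : ℝ => a * Complex.exp (-s * y))
    (g := fun _ => (1 : ℂ)) hre1 isOpen_Ioo (by fun_prop) continuousOn_const
  have hy0 : (3 / 2 : ℝ) ∈ Ioo (1 : ℝ) 2 := by constructor <;> norm_num
  have hd1 : HasDerivAt (fun y : ℝ => a * Complex.exp (-s * y)) 0 (3 / 2 : ℝ) :=
    (hasDerivAt_const (3 / 2 : ℝ) (1 : ℂ)).congr_of_eventuallyEq
      (hEq.eventuallyEq_of_mem (isOpen_Ioo.mem_nhds hy0))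
  have hd2 : HasDerivAt (fun y : ℝ => -s * (y : ℂ)) (-s * 1) (3 / 2 : ℝ) :=
    (Complex.ofRealCLM.hasDerivAt (x := (3 / 2 : ℝ))).const_mul (-s)
  have h6 := hd1.unique (hd2.cexp.const_mul a)
  have h7 : a ≠ 0 := by
    rintro h
    rw [h, norm_zero] at ha1
    exact zero_ne_one ha1
  have h8 := Complex.exp_ne_zero (-s * ((3 / 2 : ℝ) : ℂ))
  simp [h7, hs0] at h6

/-- The identity `F(η̂) = E₁ / q` propagates from the far right to the open right half-plane. -/
theorem prim_lap_of_pos (hη : IsProfile Q q η) (hQ : IsPGF Q q) (hF : IsPrim Q F) (hc : 0 < c)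
    (hl : LapInt c η) (hFc : ∀ s : ℂ, c ≤ s.re → F (lap η s) = 1 / q * E1 s) {s : ℂ}
    (hs : 0 < s.re) : F (lap η s) = 1 / q * E1 s := by
  have hl0 := hη.lapInt_zero hQ hc hl
  have hqc : (q : ℂ) ≠ 0 := by
    have : q ≠ 0 := by linarith [hQ.one_le_mean]
    exact_mod_cast this
  have hd : ∀ z : ℂ, 0 < z.re → HasDerivAt (fun z => F (lap η z) - 1 / q * E1 z) 0 z := by
    intro z hz
    have hz0 : z ≠ 0 := by rintro rfl; simp at hz
    have hlt := hη.norm_lap_lt hQ hc hl hz.le hz0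
    have h1 := (hF.hasDerivAt _ hlt).comp z (hl0.hasDerivAt_lap hz)
    have h2 := (hasDerivAt_E1 hz).const_mul (1 / (q : ℂ))
    refine (h1.sub h2).congr_deriv ?_
    rw [hη.lap_id_mul hQ hz (hl0.mono hz.le) le_rfl]
    have := hQ.one_sub_ne_zero hlt
    field_simp
    ring
  have hconv : Convex ℝ {z : ℂ | 0 < z.re} := convex_halfSpace_re_gt 0
  have hcmem : ((c : ℝ) : ℂ) ∈ {z : ℂ | 0 < z.re} := by simpa using hc
  have := hconv.norm_image_sub_le_of_norm_hasDerivWithin_le (C := 0)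
    (fun x hx => (hd x hx).hasDerivWithinAt) (fun x _ => by simp) hcmem
    (show s ∈ {z : ℂ | 0 < z.re} from hs)
  have hcc := hFc (c : ℂ) (by simp)
  rw [zero_mul, norm_le_zero_iff, hcc, sub_self, sub_zero, sub_eq_zero] at this
  exact this

/-- The imaginary axis is reached by continuity along `s + t`, `t ↓ 0`; `F` is continuous at the
limit because `norm_lap_lt` keeps the boundary value inside the open disc. -/
theorem prim_lap (hη : IsProfile Q q η) (hQ : IsPGF Q q) (hF : IsPrim Q F) (hc : 0 < c)
    (hl : LapInt c η) (hFc : ∀ s : ℂ, c ≤ s.re → F (lap η s) = 1 / q * E1 s) {s : ℂ}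
    (hs : 0 ≤ s.re) (hs0 : s ≠ 0) : F (lap η s) = 1 / q * E1 s := by
  have hl0 := hη.lapInt_zero hQ hc hl
  have hlim : Tendsto (fun t : ℝ => s + t) (𝓝[>] 0) (𝓝[{z : ℂ | 0 ≤ z.re ∧ z ≠ 0}] s) := by
    refine tendsto_nhdsWithin_iff.2 ⟨?_, ?_⟩
    · have : Continuous fun t : ℝ => s + (t : ℂ) := by fun_prop
      have h := this.tendsto 0
      simp only [Complex.ofReal_zero, add_zero] at h
      exact h.mono_left nhdsWithin_le_nhds
    · filter_upwards [self_mem_nhdsWithin] with t (ht : 0 < t)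
      have : 0 < (s + t).re := by simp; linarith
      exact ⟨this.le, fun h => by rw [h] at this; simp at this⟩
  have hlt := hη.norm_lap_lt hQ hc hl hs hs0
  have h1 : Tendsto (fun t : ℝ => F (lap η (s + t))) (𝓝[>] 0) (𝓝 (F (lap η s))) := by
    have h3 : Tendsto (lap η) (𝓝[{z : ℂ | 0 ≤ z.re ∧ z ≠ 0}] s) (𝓝 (lap η s)) :=
      ((hl0.continuousOn_lap s hs).mono fun z hz => hz.1).tendsto
    exact (hF.hasDerivAt _ hlt).continuousAt.tendsto.comp (h3.comp hlim)
  have h2 : Tendsto (fun t : ℝ => 1 / q * E1 (s + t)) (𝓝[>] 0) (𝓝 (1 / q * E1 s)) :=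
    (((continuousOn_E1 s ⟨hs, hs0⟩).tendsto).comp hlim).const_mul _
  refine tendsto_nhds_unique h1 (h2.congr' ?_)
  filter_upwards [self_mem_nhdsWithin] with t (ht : 0 < t)
  exact (hη.prim_lap_of_pos hQ hF hc hl hFc (by simp; linarith)).symm

end IsProfile

theorem tendsto_re_E1 : Tendsto (fun b : ℝ => (E1 b).re) (𝓝[>] 0) atTop := by
  have h1 : Tendsto (fun b : ℝ => -Real.log b - 1) (𝓝[>] 0) atTop := by
    refine tendsto_atTop_add_const_right _ _ ?_
    exact tendsto_neg_atBot_atTop.comp Real.tendsto_log_nhdsGT_zero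
  refine tendsto_atTop_mono' _ ?_ h1
  filter_upwards [self_mem_nhdsWithin, nhdsWithin_le_nhds (Iio_mem_nhds (zero_lt_one' ℝ))] with b
    (hb : 0 < b) (hb1 : b < 1)
  exact neg_log_le_E1 hb hb1.le

theorem tendsto_ofReal_zero :
    Tendsto (fun t : ℝ => (t : ℂ)) (𝓝[>] 0) (𝓝[{z : ℂ | 0 ≤ z.re}] 0) := by
  refine tendsto_nhdsWithin_iff.2 ⟨?_, ?_⟩
  · exact (Complex.continuous_ofReal.tendsto' 0 0 rfl).mono_left nhdsWithin_le_nhds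
  · filter_upwards [self_mem_nhdsWithin] with t (ht : 0 < t)
    simpa using ht.le

namespace IsProfile

/-- If the mass were below one, `F(lap η)` would have a finite limit at `0`, whereas `E1 b → ∞` as
`b ↓ 0`. -/
theorem lap_zero (hη : IsProfile Q q η) (hQ : IsPGF Q q) (hF : IsPrim Q F) (hc : 0 < c)
    (hl : LapInt c η) (hFc : ∀ s : ℂ, c ≤ s.re → F (lap η s) = 1 / q * E1 s) : lap η 0 = 1 := by
  have hl0 := hη.lapInt_zero hQ hc hl
  have hq : 0 < q := by linarith [hQ.one_le_mean]
  have h0 : lap η 0 = ((∫ y, η y : ℝ) : ℂ) := by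
    have := lap_ofReal η 0
    simpa using this
  have hle := hη.integral_le hQ hc hl
  have hge : 0 ≤ ∫ y, η y := integral_nonneg (hη.nonneg hQ hc hl)
  rcases hle.lt_or_eq with hlt | heq
  · exfalso
    have hnorm : ‖lap η 0‖ < 1 := by
      rw [h0, Complex.norm_real, Real.norm_of_nonneg hge]; exact hlt
    have h1 : Tendsto (fun t : ℝ => F (lap η t)) (𝓝[>] 0) (𝓝 (F (lap η 0))) :=
      (hF.hasDerivAt _ hnorm).continuousAt.tendsto.comp
        ((hl0.continuousOn_lap 0 (by simp)).tendsto.comp tendsto_ofReal_zero)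
    have h2 : Tendsto (fun t : ℝ => (F (lap η t)).re) (𝓝[>] 0) atTop := by
      refine (tendsto_re_E1.const_mul_atTop (show 0 < 1 / q by positivity)).congr' ?_
      filter_upwards [self_mem_nhdsWithin] with t (ht : 0 < t)
      rw [hη.prim_lap_of_pos hQ hF hc hl hFc (by simpa using ht)]
      rw [← Complex.ofReal_one, ← Complex.ofReal_div, Complex.re_ofReal_mul]
    exact not_tendsto_nhds_of_tendsto_atTop h2 _ ((Complex.continuous_re.tendsto _).comp h1)
  · rw [h0, heq, Complex.ofReal_one]

theorem tendsto_lap (hη : IsProfile Q q η) (hQ : IsPGF Q q) (hF : IsPrim Q F) (hc : 0 < c)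
    (hl : LapInt c η) (hFc : ∀ s : ℂ, c ≤ s.re → F (lap η s) = 1 / q * E1 s) :
    Tendsto (lap η) (𝓝[{z : ℂ | 0 ≤ z.re}] 0) (𝓝 1) := by
  have := ((hη.lapInt_zero hQ hc hl).continuousOn_lap 0 (by simp)).tendsto
  rwa [hη.lap_zero hQ hF hc hl hFc] at this

theorem chart_lap (hη : IsProfile Q q η) (hQ : IsPGF Q q) (hF : IsPrim Q F) (hc : 0 < c)
    (hl : LapInt c η) (hFc : ∀ s : ℂ, c ≤ s.re → F (lap η s) = 1 / q * E1 s) {T θ : ℂ → ℂ}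
    {ρ σ : ℝ} (hT : IsLogChart Q q F T θ ρ σ) {s : ℂ} (hs : 0 ≤ s.re) (hs0 : s ≠ 0)
    (hρ : ‖lap η s - 1‖ < ρ) : T (lap η s) = Complex.exp (-E1 s) := by
  have hqc : (q : ℂ) ≠ 0 := by
    have : q ≠ 0 := by linarith [hQ.one_le_mean]
    exact_mod_cast this
  rw [hT.eq_exp _ hρ (hη.norm_lap_lt hQ hc hl hs hs0), hη.prim_lap hQ hF hc hl hFc hs hs0]
  congr 1
  field_simp

/-- The tail function of the profile is integrable: the profile has finite mean. -/
theorem integrable_gt (hη : IsProfile Q q η) (hQ : IsPGF Q q) (hF : IsPrim Q F) (hc : 0 < c)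
    (hl : LapInt c η) (hFc : ∀ s : ℂ, c ≤ s.re → F (lap η s) = 1 / q * E1 s) :
    Integrable (gt η) := by
  have hl0 := hη.lapInt_zero hQ hc hl
  obtain ⟨T, θ, ρ, σ, hT⟩ := hQ.exists_logChart hF
  have hθ0 : θ 0 = 1 := by
    have := hT.θ_T 1 (by simpa using hT.ρ_pos)
    rwa [hT.map_one] at this
  have hlim := (hη.tendsto_lap hQ hF hc hl hFc).comp tendsto_ofReal_zero
  have hTlim : Tendsto (fun b : ℝ => T (lap η b)) (𝓝[>] 0) (𝓝 0) := by
    have := hT.differentiableAt.continuousAt.tendsto.comp hlim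
    rwa [hT.map_one] at this
  obtain ⟨C, hC⟩ := hT.θ_differentiableAt.isBigO_sub.bound
  rw [hθ0] at hC
  -- In the chart `T(lap η) = exp (-E1)`, which is at most `e b` by the logarithmic bound. As `θ` is
  -- differentiable at `0`, `1 - lap η` is `O(b)`, so `∫ e^{-by} g` stays bounded.
  have hev : ∀ᶠ b : ℝ in 𝓝[>] 0, ‖lap (gt η) b‖ ≤ |C| * Real.exp 1 := by
    have hball : ∀ᶠ b : ℝ in 𝓝[>] 0, ‖lap η b - 1‖ < ρ := by
      have := hlim.eventually (Metric.ball_mem_nhds 1 hT.ρ_pos)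
      simpa only [Metric.mem_ball, dist_eq_norm, Function.comp_apply] using this
    filter_upwards [self_mem_nhdsWithin, nhdsWithin_le_nhds (Iio_mem_nhds (zero_lt_one' ℝ)),
      hball, hTlim.eventually hC] with b (hb : 0 < b) (hb1 : b < 1) hρ hCb
    have hbre : 0 < ((b : ℝ) : ℂ).re := by simpa using hb
    have hb0 : ((b : ℝ) : ℂ) ≠ 0 := by exact_mod_cast hb.ne'
    rw [hT.θ_T _ hρ, sub_zero, hη.chart_lap hQ hF hc hl hFc hT hbre.le hb0 hρ,
      Complex.norm_exp] at hCb
    have h1 : Real.exp (-E1 b).re ≤ Real.exp 1 * b := by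
      have := neg_log_le_E1 hb hb1.le
      calc Real.exp (-E1 b).re ≤ Real.exp (1 + Real.log b) := by
            rw [Real.exp_le_exp, Complex.neg_re]; linarith
        _ = _ := by rw [Real.exp_add, Real.exp_log hb]
    rw [lap_gt hb (hl0.mono hb.le) (by simp), norm_div, norm_sub_rev, Complex.norm_real,
      Real.norm_of_nonneg hb.le, div_le_iff₀ hb]
    refine hCb.trans ?_
    calc C * Real.exp (-E1 b).re ≤ |C| * (Real.exp 1 * b) := by
          gcongr; exact le_abs_self C
      _ = _ := by ring
  have hgnn : ∀ y, 0 ≤ gt η y := by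
    intro y
    rcases lt_or_ge y 0 with h | h
    · rw [(lapInt_gt hc hl).zero y h]
    · rw [gt_of_nonneg h]; linarith [hη.Ap_one_lt hQ hc hl y]
  have hmeas := (lapInt_gt hc hl).aesm
  refine ⟨hmeas, ?_⟩
  let b : ℕ → ℝ := fun n => 1 / ((n : ℝ) + 1)
  have hbpos : ∀ n, 0 < b n := fun n => by positivity
  have hbt : Tendsto b atTop (𝓝[>] 0) := tendsto_nhdsWithin_iff.2
    ⟨tendsto_one_div_add_atTop_nhds_zero_nat, Eventually.of_forall hbpos⟩
  -- Fatou's lemma along `b = 1 / (n + 1)` removes the damping.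
  have hpt : ∀ y, liminf (fun n => ‖Real.exp (-b n * y) * gt η y‖ₑ) atTop = ‖gt η y‖ₑ := by
    intro y
    refine Tendsto.liminf_eq ?_
    have h1 : Tendsto (fun n => Real.exp (-b n * y) * gt η y) atTop (𝓝 (gt η y)) := by
      have h2 : Tendsto b atTop (𝓝 0) := hbt.mono_right nhdsWithin_le_nhds
      have h3 := ((Real.continuous_exp.tendsto _).comp ((h2.neg).mul_const y)).mul_const (gt η y)
      simpa using h3
    exact h1.enorm
  unfold HasFiniteIntegral
  simp only [← hpt]
  refine (lintegral_liminf_le' fun n => ?_).trans_lt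
    (lt_of_le_of_lt (b := ENNReal.ofReal (|C| * Real.exp 1)) ?_ ENNReal.ofReal_lt_top)
  · exact ((by fun_prop : Continuous fun y : ℝ =>
      Real.exp (-b n * y)).aestronglyMeasurable.mul hmeas).enorm
  · refine liminf_le_of_frequently_le' (Eventually.frequently ?_)
    filter_upwards [hbt.eventually hev] with n hn
    have hlb := lapInt_gt (hbpos n) (hl0.mono (hbpos n).le)
    have h1 : ∫⁻ y, ‖Real.exp (-b n * y) * gt η y‖ₑ =
        ENNReal.ofReal (∫ y, Real.exp (-b n * y) * gt η y) := by
      rw [ofReal_integral_eq_lintegral_ofReal hlb.int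
        (Eventually.of_forall fun y => mul_nonneg (Real.exp_pos _).le (hgnn y))]
      congr 1; ext y
      rw [Real.enorm_of_nonneg (mul_nonneg (Real.exp_pos _).le (hgnn y))]
    rw [h1]
    refine ENNReal.ofReal_le_ofReal ?_
    rw [lap_ofReal, Complex.norm_real] at hn
    exact (le_abs_self _).trans hn

end IsProfile

end Coarsening

/-! ### All moments of the profile are finite. -/

namespace Coarsening

variable {Q : Polynomial ℝ} {q : ℝ} {η : ℝ → ℝ} {c : ℝ} {F : ℂ → ℂ}

/-- `f` has an absolute moment of order `k`. -/
def Mi (k : ℕ) (f : ℝ → ℝ) : Prop := Integrable fun y : ℝ => (1 + |y|) ^ k * f y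

namespace Mi

variable {k : ℕ} {f g : ℝ → ℝ}

theorem add (hf : Mi k f) (hg : Mi k g) : Mi k fun y => f y + g y :=
  (Integrable.add hf hg).congr (Eventually.of_forall fun y => by simp [mul_add])

theorem const_mul (hf : Mi k f) (a : ℝ) : Mi k fun y => a * f y :=
  (Integrable.const_mul hf a).congr (Eventually.of_forall fun y => by dsimp only; ring)

theorem sum {ι : Type*} (t : Finset ι) {f : ι → ℝ → ℝ} (h : ∀ i ∈ t, Mi k (f i)) :
    Mi k fun y => ∑ i ∈ t, f i y := by
  unfold Mi
  simp only [Finset.mul_sum]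
  exact integrable_finsetSum _ fun i hi => h i hi

theorem congr (hf : Mi k f) (h : f =ᵐ[volume] g) : Mi k g := by
  refine Integrable.congr hf ?_
  filter_upwards [h] with y hy
  rw [hy]

theorem aesm (hf : Mi k f) : AEStronglyMeasurable f := by
  have h1 : AEStronglyMeasurable (fun y : ℝ => ((1 + |y|) ^ k)⁻¹ * ((1 + |y|) ^ k * f y)) := by
    refine AEStronglyMeasurable.mul ?_ hf.1
    exact (Continuous.inv₀ (by fun_prop) fun y => by positivity).aestronglyMeasurable
  refine h1.congr (Eventually.of_forall fun y => ?_)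
  have : (1 + |y|) ^ k ≠ 0 := by positivity
  field_simp

/-- The weight is submultiplicative: `1 + |x| ≤ (1 + |t|) (1 + |x - t|)`. -/
theorem cv (hf : Mi k f) (hg : Mi k g) : Mi k (cv f g) := by
  have hf' : Integrable fun y : ℝ => |(1 + |y|) ^ k * f y| := hf.abs
  have hg' : Integrable fun y : ℝ => |(1 + |y|) ^ k * g y| := hg.abs
  have h1 := hf'.integrable_convolution (ContinuousLinearMap.mul ℝ ℝ) hg'
  have h2 := hf'.ae_convolution_exists (ContinuousLinearMap.mul ℝ ℝ) hg'
  have hm : AEStronglyMeasurable (Coarsening.cv f g) := by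
    have := hf.aesm.convolution_integrand (ContinuousLinearMap.mul ℝ ℝ) (μ := volume) hg.aesm
    exact this.integral_prod_right'
  refine h1.mono' ((by fun_prop : Continuous fun y : ℝ =>
    (1 + |y|) ^ k).aestronglyMeasurable.mul hm) ?_
  filter_upwards [h2] with x hx
  rw [norm_mul, Real.norm_of_nonneg (by positivity), Coarsening.cv]
  calc (1 + |x|) ^ k * ‖∫ t, f t * g (x - t)‖
      ≤ (1 + |x|) ^ k * ∫ t, ‖f t * g (x - t)‖ := by
        gcongr; exact norm_integral_le_integral_norm _
    _ = ∫ t, (1 + |x|) ^ k * ‖f t * g (x - t)‖ := (integral_const_mul _ _).symm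
    _ ≤ _ := by
        refine integral_mono_of_nonneg (Eventually.of_forall fun t => by positivity) hx
          (Eventually.of_forall fun t => ?_)
        simp only [ContinuousLinearMap.mul_apply', abs_mul, abs_pow, norm_mul, Real.norm_eq_abs]
        have e1 : abs (1 + |t|) = 1 + |t| := abs_of_nonneg (by positivity)
        have e2 : abs (1 + |x - t|) = 1 + |x - t| := abs_of_nonneg (by positivity)
        have e3 : 1 + |x| ≤ (1 + |t|) * (1 + |x - t|) := by
          have h3 := abs_add_le t (x - t)
          rw [add_sub_cancel] at h3
          nlinarith [abs_nonneg t, abs_nonneg (x - t)]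
        rw [e1, e2]
        calc (1 + |x|) ^ k * (|f t| * |g (x - t)|)
            ≤ ((1 + |t|) * (1 + |x - t|)) ^ k * (|f t| * |g (x - t)|) := by gcongr
          _ = _ := by rw [mul_pow]; ring

theorem shift (hf : Mi k f) : Mi k fun y => f (y - 1) := by
  have h1 : Integrable fun y : ℝ => 2 ^ k * |(1 + |y - 1|) ^ k * f (y - 1)| :=
    ((Integrable.comp_sub_right hf 1).abs).const_mul _
  refine h1.mono' ((by fun_prop : Continuous fun y : ℝ =>
    (1 + |y|) ^ k).aestronglyMeasurable.mul ?_) (Eventually.of_forall fun y => ?_)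
  · exact hf.aesm.comp_quasiMeasurePreserving (measurePreserving_sub_right volume (1 : ℝ)).quasiMeasurePreserving
  · rw [norm_mul, Real.norm_of_nonneg (by positivity), abs_mul,
      abs_of_nonneg (by positivity : 0 ≤ (1 + |y - 1|) ^ k), ← mul_assoc, ← mul_pow,
      Real.norm_eq_abs]
    gcongr
    have h3 := abs_add_le (y - 1) 1
    rw [sub_add_cancel, abs_one] at h3
    nlinarith [abs_nonneg (y - 1)]

theorem succ (hf : Mi k f) (hf' : Mi k fun y => y * f y) (hz : ∀ y < 0, f y = 0) :
    Mi (k + 1) f := by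
  refine (Integrable.add hf hf').congr (Eventually.of_forall fun y => ?_)
  simp only [Pi.add_apply]
  rcases lt_or_ge y 0 with hy | hy
  · simp [hz y hy]
  · rw [abs_of_nonneg hy]; ring

end Mi

theorem mi_step (k : ℕ) : Mi k fun y => st 0 y - st 1 y := by
  have h1 : Integrable ((Ico (0 : ℝ) 1).indicator fun _ => (2 : ℝ) ^ k) :=
    (integrable_indicator_iff measurableSet_Ico).2 (integrableOn_const (by simp))
  refine h1.mono' ?_ (Eventually.of_forall fun y => ?_)
  · have m0 := measurable_st 0
    have m1 := measurable_st 1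
    exact (by fun_prop : Measurable fun y : ℝ => (1 + |y|) ^ k * (st 0 y - st 1 y)).aestronglyMeasurable
  · rw [norm_mul, Real.norm_of_nonneg (by positivity)]
    by_cases hy : y ∈ Ico (0 : ℝ) 1
    · have : st 0 y - st 1 y = 1 := by simp [st, hy.1, not_le.2 hy.2]
      rw [indicator_of_mem hy]
      dsimp only
      rw [this, norm_one, mul_one]
      gcongr
      rw [abs_of_nonneg hy.1]
      linarith [hy.2]
    · rw [indicator_of_notMem hy]
      have : st 0 y - st 1 y = 0 := by
        simp only [mem_Ico, not_and, not_lt] at hy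
        unfold st
        split_ifs with h1 h2 h2
        · norm_num
        · exact absurd (hy h1) h2
        · linarith
        · norm_num
      simp [this]

namespace IsProfile

/-- The tails of the convolution powers satisfy `1 - A_{j+1} = g + η * (1 - A_j)` on the half-line.
-/
theorem mi_compl (hc : 0 < c) (hl : LapInt c η) {k : ℕ} (hg : Mi k (gt η)) (hη : Mi k η) (j : ℕ) :
    Mi k fun y => st 0 y - Ap η j y := by
  induction j with
  | zero => simp [Ap, Mi]
  | succ j ih =>
    refine (hg.add (hη.cv ih)).congr ?_
    filter_upwards [hl.cv_integrable_ae (lapInt_Ap hc hl j)] with x hx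
    have h1 := integral_sub (hl.integrable_mul_st x) hx
    have h2 : cv η (fun y => st 0 y - Ap η j y) x = Ap η 1 x - Ap η (j + 1) x := by
      refine Eq.trans ?_ h1
      simp only [cv, mul_sub]
    rw [h2, gt]
    ring

/-- A bootstrap: moments of order `k` for `η` and `g` pass to the tails of all convolution powers,
hence to `κ` and to the tail of `Q(η)`. The two equations express `y g` and `y η` through these,
which gains one order. -/
theorem mi_all (hη : IsProfile Q q η) (hQ : IsPGF Q q) (hc : 0 < c) (hl : LapInt c η)
    (hg : Integrable (gt η)) (k : ℕ) : Mi k (gt η) ∧ Mi k η := by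
  have hq : 0 < q := by linarith [hQ.one_le_mean]
  induction k with
  | zero => exact ⟨by simpa [Mi] using hg, by simpa [Mi] using hη.integrable hQ hc hl⟩
  | succ k ih =>
    have hB := mi_compl hc hl ih.1 ih.2
    have hst : ∀ y : ℝ, st 0 (y - 1) = st 1 y := fun y => by simp [st]
    -- Since `∑ j p_j = q`, the constant parts of `κ` cancel beyond `1`, leaving the indicator of
    -- `[0, 1)` plus a combination of shifted tails.
    have hkap : Mi k (kap Q q η) := by
      have h1 : Mi k fun y => (st 0 y - st 1 y) + 1 / q * ∑ j ∈ Finset.range (Q.natDegree + 1),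
          Q.coeff j * ∑ i ∈ Finset.range j, (st 0 (y - 1) - Ap η i (y - 1)) :=
        (mi_step k).add ((Mi.sum _ fun _ _ => (Mi.sum _ fun i _ =>
          (hB i).shift).const_mul _).const_mul _)
      refine h1.congr (Eventually.of_forall fun y => ?_)
      have h2 : ∑ j ∈ Finset.range (Q.natDegree + 1),
          Q.coeff j * ∑ i ∈ Finset.range j, (st 0 (y - 1) - Ap η i (y - 1)) =
          q * st 1 y - ∑ j ∈ Finset.range (Q.natDegree + 1),
          Q.coeff j * ∑ i ∈ Finset.range j, Ap η i (y - 1) := by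
        rw [← hQ.sum_mul_coeff, Finset.sum_mul, ← Finset.sum_sub_distrib]
        refine Finset.sum_congr rfl fun j _ => ?_
        rw [Finset.sum_sub_distrib, hst]
        simp; ring
      dsimp only
      rw [h2, kap]
      field_simp
      ring
    refine ⟨ih.1.succ ((ih.1.cv hkap).congr (hη.id_mul_gt hQ hc hl).symm) (lapInt_gt hc hl).zero,
      ih.2.succ ?_ hl.zero⟩
    have h1 : Mi k fun y => 1 / q * ∑ j ∈ Finset.range (Q.natDegree + 1),
        Q.coeff j * (st 0 (y - 1) - Ap η j (y - 1)) :=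
      (Mi.sum _ fun j _ => (hB j).shift.const_mul _).const_mul _
    refine h1.congr (Eventually.of_forall fun y => ?_)
    have h2 : tl Q η (y - 1) = ∑ j ∈ Finset.range (Q.natDegree + 1),
        Q.coeff j * (st 0 (y - 1) - Ap η j (y - 1)) := by
      simp only [mul_sub, Finset.sum_sub_distrib, ← Finset.sum_mul, hQ.sum_coeff, one_mul, tl]
    dsimp only
    rw [← h2, ← hη.eq y]
    field_simp

theorem le_one (hη : IsProfile Q q η) (hQ : IsPGF Q q) (hc : 0 < c) (hl : LapInt c η) (y : ℝ) :
    η y ≤ 1 := by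
  have hq := hQ.one_le_mean
  rcases lt_or_ge y 1 with hy | hy
  · rw [hη.zero y hy]; exact zero_le_one
  · have hA : ∀ j, 0 ≤ Ap η j (y - 1) := fun j =>
      (Ap_mem hc hl (fun z _ => hη.nonneg hQ hc hl z)
        (fun z _ => (hη.Ap_one_lt hQ hc hl z).le) j (y - 1) le_rfl).1
    have h1 : tl Q η (y - 1) ≤ 1 := by
      rw [tl]
      have := Finset.sum_nonneg fun j (_ : j ∈ Finset.range (Q.natDegree + 1)) =>
        mul_nonneg (hQ.nonneg j) (hA j)
      linarith [st_le_one 0 (y - 1)]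
    rw [← hη.eq y] at h1
    have h2 := hη.nonneg hQ hc hl y
    have h3 : η y ≤ q * (y * η y) := by
      have : 1 ≤ q * y := one_le_mul_of_one_le_of_one_le hq hy
      nlinarith
    linarith

theorem memL2 (hη : IsProfile Q q η) (hQ : IsPGF Q q) (hc : 0 < c) (hl : LapInt c η)
    (hg : Integrable (gt η)) (γ : ℝ) : MemL2 γ η := by
  obtain ⟨k, hk⟩ := exists_nat_ge (2 * γ)
  have hM := (hη.mi_all hQ hc hl hg k).2
  have hm : AEStronglyMeasurable (fun y : ℝ => y ^ γ * η y) (volume.restrict (Ici 1)) :=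
    ((by fun_prop : Measurable fun y : ℝ => y ^ γ).aestronglyMeasurable.mul hl.aesm).restrict
  refine (memLp_two_iff_integrable_sq hm).2 ?_
  refine (hM.restrict (s := Ici 1)).mono' (hm.pow 2)
    ((ae_restrict_iff' measurableSet_Ici).2 (Eventually.of_forall fun y (hy : 1 ≤ y) => ?_))
  have h0 := hη.nonneg hQ hc hl y
  have h1 := hη.le_one hQ hc hl y
  have hy0 : 0 ≤ y := by linarith
  rw [Real.norm_of_nonneg (sq_nonneg _), mul_pow, abs_of_nonneg hy0]
  have h2 : (y ^ γ) ^ 2 ≤ (1 + y) ^ k := by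
    rw [← Real.rpow_natCast, ← Real.rpow_mul hy0]
    calc y ^ (γ * (2 : ℕ)) ≤ y ^ (k : ℝ) :=
          Real.rpow_le_rpow_of_exponent_le hy (by push_cast; linarith)
      _ = y ^ k := Real.rpow_natCast y k
      _ ≤ _ := by gcongr; linarith
  -- The bound `η ≤ 1` reduces the weighted `L²` norm to a moment of order `k ≥ 2γ`.
  have h3 : η y ^ 2 ≤ η y := by nlinarith
  gcongr

end IsProfile

end Coarsening

/-! ### Inverting the perturbed transform by the flow. -/

namespace Coarsening

variable {Q : Polynomial ℝ} {q : ℝ} {η : ℝ → ℝ} {c γ : ℝ} {F : ℂ → ℂ}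

/-- On a bounded region away from `0` this is compactness together with `norm_lap_lt`. For large
`|s|`, `E1 = O(1/|s|)` and the 2-Lipschitz inverse of `F` give the bound `1/2`. -/
theorem IsProfile.exists_norm_lap_le (hη : IsProfile Q q η) (hQ : IsPGF Q q) (hF : IsPrim Q F)
    (hc : 0 < c) (hl : LapInt c η) (hFc : ∀ s : ℂ, c ≤ s.re → F (lap η s) = 1 / q * E1 s)
    {δ : ℝ} (hδ : 0 < δ) :
    ∃ r, 0 < r ∧ r < 1 ∧ ∀ s : ℂ, 0 ≤ s.re → δ ≤ ‖s‖ → ‖lap η s‖ ≤ r := by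
  have hq : 0 < q := by linarith [hQ.one_le_mean]
  have hl0 := hη.lapInt_zero hQ hc hl
  obtain ⟨C, hC⟩ := exists_norm_E1_le
  let K : Set ℂ := {s | 0 ≤ s.re} ∩ (Metric.closedBall 0 (4 * |C| / q + δ) ∩ {s | δ ≤ ‖s‖})
  have hK : IsCompact K := by
    refine IsCompact.inter_left (IsCompact.inter_right (isCompact_closedBall _ _) ?_) ?_
    · exact isClosed_le continuous_const continuous_norm
    · exact isClosed_le continuous_const Complex.continuous_re
  have hKne : K.Nonempty := by
    refine ⟨(δ : ℂ), ?_, ?_, ?_⟩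
    · simpa using hδ.le
    · simp only [mem_closedBall_zero_iff, Complex.norm_real, Real.norm_eq_abs, abs_of_pos hδ]
      have : 0 ≤ 4 * |C| / q := by positivity
      linarith
    · simp [abs_of_pos hδ]
  obtain ⟨s₀, hs₀, hmax⟩ := hK.exists_isMaxOn hKne
    ((hl0.continuousOn_lap.mono fun s hs => hs.1).norm)
  have hs₀' : s₀ ≠ 0 := fun h => by
    have := hs₀.2.2
    simp only [h, Set.mem_ofPred_eq, norm_zero] at this
    linarith
  have hlt := hη.norm_lap_lt hQ hc hl hs₀.1 hs₀'
  refine ⟨max ‖lap η s₀‖ (1 / 2), by positivity, max_lt hlt (by norm_num), fun s hs hsδ => ?_⟩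
  by_cases hsK : s ∈ K
  · exact (hmax hsK).trans (le_max_left _ _)
  · refine le_max_of_le_right ?_
    have hbig : 4 * |C| / q + δ < ‖s‖ := by
      by_contra! h
      exact hsK ⟨hs, by simpa using h, hsδ⟩
    have hs0 : s ≠ 0 := norm_pos_iff.1 (hδ.trans_le hsδ)
    have h1 := hF.norm_sub_le hQ (hη.norm_lap_lt hQ hc hl hs hs0) (b := 0) (by simp)
    rw [hF.zero, sub_zero, sub_zero, hη.prim_lap hQ hF hc hl hFc hs hs0, norm_mul, norm_div,
      norm_one, Complex.norm_real, Real.norm_of_nonneg hq.le] at h1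
    have h2 : ‖E1 s‖ ≤ q / 4 := by
      refine (hC s hs).trans ?_
      have hsp : 0 < ‖s‖ := norm_pos_iff.2 hs0
      rw [div_le_iff₀ hsp]
      have h3 : 4 * |C| / q < ‖s‖ := by linarith
      rw [div_lt_iff₀ hq] at h3
      linarith [le_abs_self C]
    calc ‖lap η s‖ ≤ 2 * (1 / q * ‖E1 s‖) := h1
      _ ≤ 2 * (1 / q * (q / 4)) := by gcongr
      _ = 1 / 2 := by field_simp; norm_num

/-- The flow inverts the transform on a domain of `ψ`. -/
theorem exists_inverse (hγ : 1 / 2 < γ) (hQ : IsPGF Q q) :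
    ∃ (O : Set ℂ) (ψ : ℂ → ℂ) (X₀ : E), IsOpen O ∧
      (∀ z ∈ O, HasDerivAt ψ (1 - Polynomial.aeval (ψ z) Q) z) ∧ (0 ∈ O ∧ ψ 0 = 0) ∧
      ∃ ε : ℝ, 0 < ε ∧ ∃ C : ℝ, 0 < C ∧ ∀ d : E, ‖d‖ ≤ ε → ∃ x : E, ‖x - X₀‖ ≤ C * ‖d‖ ∧
        ∀ (s : ℂ) (hs : 0 ≤ s.re), s ≠ 0 →
          1 / q * E1 s + chi hγ hs d ∈ O ∧ ψ (1 / q * E1 s + chi hγ hs d) = chi hγ hs x := by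
  have hq : 0 < q := by linarith [hQ.one_le_mean]
  have hqc : (q : ℂ) ≠ 0 := by exact_mod_cast hq.ne'
  obtain ⟨F, hF⟩ := hQ.exists_prim
  obtain ⟨T, θ, ρ, σ, hT⟩ := hQ.exists_logChart hF
  obtain ⟨c, hc, η, hη, hl, hFc⟩ := exists_profile hQ hF
  have hL2 := hη.memL2 hQ hc hl (hη.integrable_gt hQ hF hc hl hFc) γ
  have hX₀ : ∀ (s : ℂ) (hs : 0 ≤ s.re), chi hγ hs (toE hL2) = lap η s := fun s hs => by
    rw [chi_toE]
    congr 1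
    ext y
    split_ifs with hy
    · rfl
    · exact (hη.zero y (not_le.1 hy)).symm
  have hρ := hT.ρ_pos
  have hlim := hη.tendsto_lap hQ hF hc hl hFc
  obtain ⟨δ₁, hδ₁, hnear₁⟩ := (Metric.tendsto_nhdsWithin_nhds.1 hlim) (ρ / 2) (by positivity)
  obtain ⟨r₁, hr₁0, hr₁, hfar₁⟩ := hη.exists_norm_lap_le hQ hF hc hl hFc hδ₁
  obtain ⟨σ', hσ', O, ψ, hO, hψ, hin, hout⟩ :=
    -- The radius halfway between `r₁` and `1` leaves room for the perturbation.
    exists_psi_domain hQ hF hT (r := (1 + r₁) / 2) (by positivity) (by linarith)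
  have hTlim : Tendsto (fun s => T (lap η s)) (𝓝[{z : ℂ | 0 ≤ z.re}] 0) (𝓝 0) := by
    have := hT.differentiableAt.continuousAt.tendsto.comp hlim
    rwa [hT.map_one] at this
  -- A second scale is needed because `σ'` depends on `r₁`: only for `|s| < δ₂` is the chart value
  -- below `σ' / 2`, and the radius `r₂` governs the range between the two scales.
  obtain ⟨δ₂, hδ₂, hnear₂⟩ := (Metric.tendsto_nhdsWithin_nhds.1 hTlim) (σ' / 2) (by positivity)
  obtain ⟨r₂, hr₂0, hr₂, hfar₂⟩ := hη.exists_norm_lap_le hQ hF hc hl hFc hδ₂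
  obtain ⟨ε, hε, C, hC, hflow⟩ := exists_flow hγ Q (toE hL2)
  have hcL := cL_nonneg γ
  let κ := min (ρ / 2) (min ((1 - r₁) / 2) (1 - r₂))
  have hκ : 0 < κ := lt_min (by positivity) (lt_min (by linarith) (by linarith))
  have hlog : 0 < Real.log 2 := Real.log_pos (by norm_num)
  -- The second bound keeps every transform along the flow strictly within `κ` of its start; the
  -- third ensures `|exp (-q d)| ≤ 2` on the transform side, matching the margin `σ' / 2`.
  refine ⟨O, ψ, toE hL2, hO, hψ, ?_, min ε (min (κ / 2 / (cL γ * C + 1)) (Real.log 2 / (q * cL γ + 1))),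
    by positivity, C, hC, fun d hd => ?_⟩
  · have := hin 0 (by simp) (Or.inl (by rw [norm_zero]; positivity))
    rwa [hF.zero] at this
  obtain ⟨hdε, hd1, hd2⟩ : ‖d‖ ≤ ε ∧ ‖d‖ ≤ κ / 2 / (cL γ * C + 1) ∧
      ‖d‖ ≤ Real.log 2 / (q * cL γ + 1) := by simpa using hd
  rw [le_div_iff₀ (by positivity)] at hd1 hd2
  obtain ⟨X, hX0, hX, hXC⟩ := hflow d hdε
  have hfl : IsFlow hγ Q d X := hX
  refine ⟨X 1, hXC 1 (by simp), fun s hs hs0 => ?_⟩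
  have hdist : ∀ t ∈ Icc (0 : ℝ) 1, ‖chi hγ hs (X t) - lap η s‖ < κ := fun t ht => by
    rw [← hX₀ s hs, ← map_sub]
    calc _ ≤ cL γ * ‖X t - toE hL2‖ := norm_chi_le hγ hs _
      _ ≤ cL γ * (C * ‖d‖) := by gcongr; exact hXC t ht
      _ ≤ ‖d‖ * (cL γ * C + 1) := by nlinarith [norm_nonneg d]
      _ < κ := by linarith
  have hκ1 : κ ≤ ρ / 2 := min_le_left _ _
  have hκ2 : κ ≤ (1 - r₁) / 2 := (min_le_right _ _).trans (min_le_left _ _)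
  have hκ3 : κ ≤ 1 - r₂ := (min_le_right _ _).trans (min_le_right _ _)
  have hnorm : ∀ t ∈ Icc (0 : ℝ) 1, ‖chi hγ hs (X t)‖ < ‖lap η s‖ + κ := fun t ht => by
    linarith [hdist t ht, norm_sub_norm_le (chi hγ hs (X t)) (lap η s)]
  have h1 : (1 : ℝ) ∈ Icc (0 : ℝ) 1 := by simp
  have hprim : (∀ t ∈ Icc (0 : ℝ) 1, ‖chi hγ hs (X t)‖ < 1) →
      (‖chi hγ hs (X 1)‖ < (1 + r₁) / 2 ∨ ‖chi hγ hs (X 1) - 1‖ < ρ) →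
      1 / q * E1 s + chi hγ hs d ∈ O ∧ ψ (1 / q * E1 s + chi hγ hs d) = chi hγ hs (X 1) := by
    intro hlt hor
    have h2 := hfl.prim_eq hQ hF hs hlt
    rw [hX0, hX₀ s hs, hη.prim_lap hQ hF hc hl hFc hs hs0] at h2
    rw [← h2]
    exact hin _ (hlt 1 h1) hor
  rcases le_or_gt δ₁ ‖s‖ with hsδ | hsδ
  · have h3 := hfar₁ s hs hsδ
    refine hprim (fun t ht => ?_) (Or.inl ?_)
    · linarith [hnorm t ht]
    · linarith [hnorm 1 h1]
  have h4 : ‖lap η s - 1‖ < ρ / 2 := by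
    have := hnear₁ (show s ∈ {z : ℂ | 0 ≤ z.re} from hs) (by simpa using hsδ)
    rwa [dist_eq_norm] at this
  have h5 : ∀ t ∈ Icc (0 : ℝ) 1, ‖chi hγ hs (X t) - 1‖ < ρ := fun t ht => by
    have := norm_sub_le_norm_sub_add_norm_sub (chi hγ hs (X t)) (lap η s) 1
    linarith [hdist t ht]
  rcases le_or_gt δ₂ ‖s‖ with hsδ' | hsδ'
  · refine hprim (fun t ht => ?_) (Or.inr (h5 1 h1))
    have h3 := hfar₂ s hs hsδ'
    linarith [hnorm t ht]
  -- Only here, for `s` near `0`, may the path leave the unit disc, so the argument moves from `F`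
  -- to the chart.
  have h6 := hfl.chart_eq hQ hT hs h5
  have h7 : ‖T (lap η s)‖ < σ' / 2 := by
    have := hnear₂ (show s ∈ {z : ℂ | 0 ≤ z.re} from hs) (by simpa using hsδ')
    rwa [dist_eq_norm, sub_zero] at this
  rw [hX0, hX₀ s hs] at h6
  refine hout _ _ (h5 1 h1) ?_ ?_
  · rw [h6, hη.chart_lap hQ hF hc hl hFc hT hs hs0 (by linarith), ← Complex.exp_add]
    congr 1
    field_simp
    ring
  · rw [h6, norm_mul, Complex.norm_exp]
    have h8 : Real.exp (-(q * chi hγ hs d)).re ≤ 2 := by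
      rw [← Real.le_log_iff_exp_le (by norm_num)]
      calc (-(q * chi hγ hs d)).re ≤ ‖-(q * chi hγ hs d)‖ := Complex.re_le_norm _
        _ = q * ‖chi hγ hs d‖ := by
          rw [norm_neg, norm_mul, Complex.norm_real, Real.norm_of_nonneg hq.le]
        _ ≤ q * (cL γ * ‖d‖) := by gcongr; exact norm_chi_le hγ hs d
        _ ≤ _ := by nlinarith [norm_nonneg d]
    calc _ ≤ ‖T (lap η s)‖ * 2 := by gcongr
      _ < σ' := by linarith

end Coarsening

/-! ### Connected domains and assembly of the inverse relation. -/

namespace Coarsening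

variable {Q : Polynomial ℝ} {q : ℝ} {γ : ℝ}

/-- The set is star-shaped about `1`: a segment from `1` to a point of it has positive real part
before its endpoint. -/
theorem isPreconnected_punctured_halfPlane : IsPreconnected {s : ℂ | 0 ≤ s.re ∧ s ≠ 0} := by
  have h : StarConvex ℝ (1 : ℂ) {s : ℂ | 0 ≤ s.re ∧ s ≠ 0} := by
    intro s hs a b ha hb hab
    have hre : (a • (1 : ℂ) + b • s).re = a + b * s.re := by simp
    have hb' := mul_nonneg hb hs.1
    refine ⟨by rw [hre]; linarith, fun h0 => ?_⟩
    rcases ha.eq_or_lt with rfl | ha'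
    · obtain rfl : b = 1 := by linarith
      exact hs.2 (by simpa using h0)
    · rw [h0, Complex.zero_re] at hre
      linarith
  exact (h.isPathConnected (by simp)).isConnected.isPreconnected

theorem MemL2.ext1_ae_eq {d : ℝ → ℝ} (hd : MemL2 γ d) : ext1 d =ᵐ[volume] fn γ (toE hd) :=
  (fn_toE hd).symm

theorem MemL2.integrable_ext1 (hγ : 1 / 2 < γ) {d : ℝ → ℝ} (hd : MemL2 γ d) :
    Integrable (ext1 d) :=
  (integrable_fn hγ (toE hd)).congr hd.ext1_ae_eq.symm

theorem MemL2.lapInt_ext1 (hγ : 1 / 2 < γ) {d : ℝ → ℝ} (hd : MemL2 γ d) : LapInt 0 (ext1 d) :=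
  ⟨fun y hy => if_neg (by linarith), by simpa using hd.integrable_ext1 hγ⟩

theorem LapInt.expIntegrable {f : ℝ → ℝ} (hf : ∀ b, 0 < b → LapInt b (ext1 f)) :
    ExpIntegrable f := fun b hb => by
  refine ((hf b hb).int.integrableOn (s := Ici 1)).congr_fun (fun y (hy : 1 ≤ y) => ?_)
    measurableSet_Ici
  simp [ext1, hy]

theorem MemL2.expIntegrable (hγ : 1 / 2 < γ) {d : ℝ → ℝ} (hd : MemL2 γ d) : ExpIntegrable d :=
  LapInt.expIntegrable fun _ hb => (hd.lapInt_ext1 hγ).mono hb.le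

theorem expIntegrable_wStar : ExpIntegrable wStar :=
  LapInt.expIntegrable fun _ hb => by rw [ext1_wStar]; exact lapInt_wStar hb

theorem ExpIntegrable.intervalIntegrable {f : ℝ → ℝ} (hf : ExpIntegrable f) (ξ : ℂ) {T : ℝ}
    (hT : 1 ≤ T) : IntervalIntegrable
      (fun y : ℝ => Complex.exp (-Complex.I * ξ * (y : ℂ)) * (f y : ℂ)) volume 1 T := by
  rw [intervalIntegrable_iff_integrableOn_Icc_of_le hT]
  have h1 : IntegrableOn (fun y : ℝ => ((Real.exp (-1 * y) * f y : ℝ) : ℂ)) (Icc 1 T) :=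
    ((hf 1 one_pos).mono_set Icc_subset_Ici_self).ofReal
  have h2 := h1.continuousOn_mul (g := fun y : ℝ => Complex.exp (-Complex.I * ξ * (y : ℂ)) *
    Complex.exp (y : ℂ)) (by fun_prop) isCompact_Icc
  refine h2.congr_fun (fun y _ => ?_) measurableSet_Icc
  push_cast
  have : Complex.exp (y : ℂ) * Complex.exp (-1 * y) = 1 := by rw [← Complex.exp_add]; simp
  linear_combination (Complex.exp (-Complex.I * ξ * (y : ℂ)) * f y) * this

theorem HasFourier.add {f g : ℝ → ℝ} {ξ z w : ℂ} (hf : ExpIntegrable f) (hg : ExpIntegrable g)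
    (h1 : HasFourier f ξ z) (h2 : HasFourier g ξ w) : HasFourier (fun y => f y + g y) ξ (z + w) := by
  refine (Tendsto.add h1 h2).congr' ?_
  filter_upwards [eventually_ge_atTop 1] with T hT
  rw [← intervalIntegral.integral_add (hf.intervalIntegrable ξ hT) (hg.intervalIntegrable ξ hT)]
  simp only [Complex.ofReal_add, mul_add]

theorem HasFourier.const_mul {f : ℝ → ℝ} {ξ z : ℂ} (a : ℝ) (h : HasFourier f ξ z) :
    HasFourier (fun y => a * f y) ξ (a * z) := by
  refine (Tendsto.const_mul (a : ℂ) h).congr fun T => ?_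
  rw [← intervalIntegral.integral_const_mul]
  congr 1; ext y; push_cast; ring

theorem MemL2.hasFourier (hγ : 1 / 2 < γ) {d : ℝ → ℝ} (hd : MemL2 γ d) {ξ : ℂ}
    (hs : 0 ≤ (Complex.I * ξ).re) : HasFourier d ξ (chi hγ hs (toE hd)) := by
  rw [chi_toE]
  exact hasFourier_of_integrable (hd.lapInt_ext1 hγ) hs

/-- Intermediate values between the blow-up of `E1` at `0` and its decay at infinity. As a result,
positivity of the half-line inside the domain of `ψ` follows from the values of `E1 / q` alone. -/
theorem exists_E1_eq (hq : 0 < q) {x : ℝ} (hx : 0 < x) : ∃ b : ℝ, 0 < b ∧ 1 / q * E1 b = x := by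
  obtain ⟨C, hC⟩ := exists_norm_E1_le
  have hqx : 0 < q * x := by positivity
  have hcont : ContinuousOn (fun b : ℝ => (E1 b).re) (Ioi 0) := by
    refine Complex.continuous_re.comp_continuousOn (continuousOn_E1.comp (by fun_prop) ?_)
    intro b (hb : 0 < b)
    exact ⟨by simpa using hb.le, by exact_mod_cast hb.ne'⟩
  obtain ⟨b₁, h1, hb₁⟩ := ((tendsto_re_E1.eventually_ge_atTop (q * x)).and
    self_mem_nhdsWithin).exists
  have hb₂ : 0 < (|C| + 1) / (q * x) := by positivity
  have h2 : (E1 (((|C| + 1) / (q * x) : ℝ) : ℂ)).re ≤ q * x := by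
    refine (Complex.re_le_norm _).trans ((hC _ (by rw [Complex.ofReal_re]; exact hb₂.le)).trans ?_)
    rw [Complex.norm_real, Real.norm_of_nonneg hb₂.le, div_le_iff₀ hb₂]
    field_simp
    linarith [le_abs_self C]
  obtain ⟨b, hb, hbx⟩ := isPreconnected_Ioi.intermediate_value (mem_Ioi.2 hb₂) hb₁ hcont ⟨h2, h1⟩
  obtain ⟨e, -, he⟩ := E1_ofReal (mem_Ioi.1 hb)
  refine ⟨b, hb, ?_⟩
  have hqc : (q : ℂ) ≠ 0 := by exact_mod_cast hq.ne'
  simp only [he, Complex.ofReal_re] at hbx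
  rw [he, hbx]
  push_cast
  field_simp

theorem zero_mem_closure_transform (hγ : 1 / 2 < γ) (d : E) :
    (0 : ℂ) ∈ closure ((fun s : ℂ => 1 / q * E1 s + lap (fn γ d) s) ''
      {s : ℂ | 0 ≤ s.re ∧ s ≠ 0}) := by
  have hw := (lapInt_wStar one_pos).const_mul (1 / q)
  have hd := (lapInt_fn hγ d).mono zero_le_one
  refine Metric.mem_closure_iff.2 fun ε hε => ?_
  obtain ⟨c, hc, hsm⟩ := (hw.add hd).exists_lap_small (half_pos hε)
  have hre : c ≤ (c : ℂ).re := by simp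
  refine ⟨_, ⟨c, ⟨by simp; linarith, by
    have : c ≠ 0 := by linarith
    exact_mod_cast this⟩, rfl⟩, ?_⟩
  have h1 := hsm c hre
  rw [lap_add hw hd (by simpa using hc), lap_const_mul] at h1
  have h2 : E1 c = lap wStar c := E1_eq_lap (by simp; linarith)
  rw [dist_zero_left]
  dsimp only
  rw [h2]
  push_cast at h1
  linarith

/-- The open set `O` need not be connected, so `U` is taken to be its component of `0`. It contains
`[0, ∞)`, whose positive points are values of `E1 / q`, and it contains the range of the transform,
which is connected and accumulates at `0`. -/
theorem isNInv_fn (hγ : 1 / 2 < γ) (hq : 0 < q) {O : Set ℂ} {ψ : ℂ → ℂ}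
    (hO : IsOpen O) (hψ : ∀ z ∈ O, HasDerivAt ψ (1 - Polynomial.aeval (ψ z) Q) z) (h0 : 0 ∈ O)
    (hψ0 : ψ 0 = 0) (hbase : ∀ s : ℂ, 0 ≤ s.re → s ≠ 0 → 1 / q * E1 s ∈ O) {d : ℝ → ℝ}
    (hd : MemL2 γ d) {x : E} (hx : ∀ (s : ℂ) (hs : 0 ≤ s.re), s ≠ 0 →
      1 / q * E1 s + chi hγ hs (toE hd) ∈ O ∧
        ψ (1 / q * E1 s + chi hγ hs (toE hd)) = chi hγ hs x) :
    IsNInv Q (fun y => 1 / q * wStar y + d y) (fn γ x) := by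
  have hw : ExpIntegrable fun y => 1 / q * wStar y := fun b hb =>
    IntegrableOn.congr_fun ((expIntegrable_wStar b hb).const_mul (1 / q)) (fun y _ => by dsimp only; ring)
      measurableSet_Ici
  refine ⟨fun b hb => ?_, (memL2_fn γ x).expIntegrable hγ, connectedComponentIn O 0, ψ, ?_, ?_⟩
  · refine IntegrableOn.congr_fun ((hw b hb).add (hd.expIntegrable hγ b hb)) (fun y _ => ?_) measurableSet_Ici
    simp only [Pi.add_apply, mul_add]
  · refine ⟨hO.connectedComponentIn, isPreconnected_connectedComponentIn, fun t ht => ?_, hψ0,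
      fun z hz => hψ z (connectedComponentIn_subset O 0 hz)⟩
    have hpre : IsPreconnected (Complex.ofReal '' Ici (0 : ℝ)) :=
      isPreconnected_Ici.image _ Complex.continuous_ofReal.continuousOn
    refine hpre.subset_connectedComponentIn ⟨0, by simp, by simp⟩ ?_ ⟨t, ht, rfl⟩
    rintro _ ⟨t, ht : 0 ≤ t, rfl⟩
    rcases ht.eq_or_lt with rfl | ht'
    · simpa using h0
    · obtain ⟨b, hb, hbx⟩ := exists_E1_eq hq ht'
      rw [← hbx]
      exact hbase b (by simpa using hb.le) (by exact_mod_cast hb.ne')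
  · let W := (fun s : ℂ => 1 / q * E1 s + lap (fn γ (toE hd)) s) '' {s : ℂ | 0 ≤ s.re ∧ s ≠ 0}
    have hW : IsPreconnected W := by
      refine isPreconnected_punctured_halfPlane.image _ ?_
      refine (continuousOn_const.mul continuousOn_E1).add ?_
      exact (lapInt_fn hγ (toE hd)).continuousOn_lap.mono fun s hs => hs.1
    have hW0 : IsPreconnected (insert 0 W) := hW.subset_closure (subset_insert _ _)
      (insert_subset (zero_mem_closure_transform hγ _) subset_closure)
    have hsub : insert 0 W ⊆ connectedComponentIn O 0 := by
      refine hW0.subset_connectedComponentIn (mem_insert _ _) (insert_subset h0 ?_)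
      rintro _ ⟨s, hs, rfl⟩
      exact (hx s hs.1 hs.2).1
    intro ξ him hξ
    have hs : 0 ≤ (Complex.I * ξ).re := by simpa using him
    have hs0 : Complex.I * ξ ≠ 0 := mul_ne_zero Complex.I_ne_zero hξ
    refine ⟨1 / q * E1 (Complex.I * ξ) + chi hγ hs (toE hd),
      hsub (mem_insert_of_mem _ ⟨_, ⟨hs, hs0⟩, rfl⟩), ?_, ?_⟩
    · refine HasFourier.add hw (hd.expIntegrable hγ) ?_ (hd.hasFourier hγ hs)
      simpa using (hasFourier_wStar him hξ).const_mul (1 / q)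
    · rw [(hx _ hs hs0).2]
      have := (memL2_fn γ x).hasFourier hγ hs
      rwa [toE_fn] at this

theorem normL2_fn_sub (γ : ℝ) (u v : E) :
    normL2 γ (fun y => fn γ u y - fn γ v y) = ‖u - v‖ := by
  rw [← normL2_fn γ (u - v), normL2, normL2]
  congr 1
  refine integral_congr_ae (ae_restrict_of_ae ?_)
  rw [sub_eq_add_neg, ← neg_one_smul ℝ v]
  filter_upwards [fn_add γ u ((-1 : ℝ) • v), fn_smul γ (-1) v] with y h1 h2
  rw [h1, h2, neg_one_mul, ← sub_eq_add_neg]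

end Coarsening

theorem proposition5p3 (Q : Polynomial ℝ) (hQ_zero : Q.coeff 0 = 0)
    (hQ_nonneg : ∀ j : ℕ, 0 ≤ Q.coeff j) (hQ_one : Q.eval 1 = 1)
    (q : ℝ) (hq : q = Q.derivative.eval 1) (γ : ℝ) (hγ : 1 / 2 < γ) :
    ∃ ηs : ℝ → ℝ,
      (Coarsening.MemL2 γ ηs ∧
        Coarsening.IsNInv Q (fun y => 1 / q * Coarsening.wStar y) ηs ∧
        ∀ η' : ℝ → ℝ, Coarsening.IsNInv Q (fun y => 1 / q * Coarsening.wStar y) η' →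
          η' =ᵐ[volume.restrict (Ici 1)] ηs) ∧
      ∃ ε : ℝ, 0 < ε ∧ ∃ C : ℝ, 0 < C ∧
        ∀ d : ℝ → ℝ, Coarsening.MemL2 γ d → Coarsening.normL2 γ d ≤ ε →
          ∃ η : ℝ → ℝ,
            Coarsening.MemL2 γ η ∧
            Coarsening.IsNInv Q (fun y => 1 / q * Coarsening.wStar y + d y) η ∧
            (∀ η' : ℝ → ℝ,
              Coarsening.IsNInv Q (fun y => 1 / q * Coarsening.wStar y + d y) η' →
                η' =ᵐ[volume.restrict (Ici 1)] η) ∧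
            Coarsening.normL2 γ (fun y => η y - ηs y) ≤ C * Coarsening.normL2 γ d := by
  have hQ : Coarsening.IsPGF Q q := ⟨hQ_zero, hQ_nonneg, hQ_one, hq⟩
  have hq0 : 0 < q := by linarith [hQ.one_le_mean]
  obtain ⟨O, ψ, X₀, hO, hψ, ⟨h0, hψ0⟩, ε, hε, C, hC, H⟩ := Coarsening.exists_inverse hγ hQ
  obtain ⟨x₀, hx₀, hinv₀⟩ := H 0 (by simpa using hε.le)
  -- For `d = 0` the Lipschitz bound itself identifies the solution with the base point.
  obtain rfl : x₀ = X₀ := by simpa [sub_eq_zero] using hx₀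
  have hbase : ∀ s : ℂ, 0 ≤ s.re → s ≠ 0 → 1 / q * Coarsening.E1 s ∈ O := fun s hs hs0 => by
    simpa using (hinv₀ s hs hs0).1
  have hzero : Coarsening.MemL2 γ fun _ => 0 := by simp [Coarsening.MemL2]
  have hz : Coarsening.toE hzero = 0 := by
    rw [← norm_eq_zero, Coarsening.norm_toE]
    simp [Coarsening.normL2]
  have hs : Coarsening.IsNInv Q (fun y => 1 / q * Coarsening.wStar y) (Coarsening.fn γ x₀) := by
    have := Coarsening.isNInv_fn hγ hq0 hO hψ h0 hψ0 hbase hzero (x := x₀) (by rwa [hz])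
    simpa using this
  refine ⟨Coarsening.fn γ x₀, ⟨Coarsening.memL2_fn γ x₀, hs, fun η' h' => h'.unique hQ hs⟩,
    ε, hε, C, hC, fun d hd hdε => ?_⟩
  obtain ⟨x, hx, hinv⟩ := H (Coarsening.toE hd) (by rwa [Coarsening.norm_toE])
  have hN := Coarsening.isNInv_fn hγ hq0 hO hψ h0 hψ0 hbase hd hinv
  refine ⟨Coarsening.fn γ x, Coarsening.memL2_fn γ x, hN, fun η' h' => h'.unique hQ hN, ?_⟩
  rw [Coarsening.normL2_fn_sub]
  rwa [Coarsening.norm_toE] at hx
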